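/- Fix $T>0$. Call $f:\mathbb R_+\to\mathbb R_+$ a time-change function if it is $C^1$, non-decreasing, $f(0)=0$ and $|f'(x)|\le c(1+x)$ for all $x\ge 0$ and some $c\ge 0$. Given $G_0,K,f:\mathbb R_+\to\mathbb R_+$ and $\lambda,\nu\ge 0$, a weak solution on $[0,T]$ for the input $(G_0,K,f,\lambda,\nu)$ is a pair $(W,X)$ on a filtered probability space $(\Omega,\mathcal F,(\mathcal G_t)_{t\ge 0},\mathbb P)$, where $W$ is a $(\mathcal G_t)$-Brownian motion and $X=(X_t)_{t\le T}$ is a non-decreasing continuous process with $X_0=0$, such that (i) $f(X_t)$ is a $(\mathcal G_s)_{s\ge 0}$-stopping time for every $t\in[0,T]$; (ii) $(W_{f(X_t)})_{t\le T}$ is a martingale with respect to its own filtration; (iii) almost surely, for all $t\in[0,T]$, $$X_t=G_0(t)+\int_0^t K(t-s)\bigl(-\lambda X_s+\nu W_{f(X_s)}\bigr)\,ds .$$ Let $D^\circ[0,T]=C[0,\infty)\times D^\uparrow[0,T]$ carry the product topology, where $C[0,\infty)$ (continuous real paths) has the topology of uniform convergence on compacts, and $D^\uparrow[0,T]$ (non-negative,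 non-decreasing càdlàg paths on $[0,T]$) has Skorokhod's $M_1$ topology. **Theorem.** For each $n\ge 0$ let $(W^n,X^n)$ be a weak solution on $[0,T]$ for the input $(G_0^n,K^n,f^n,\lambda^n,\nu^n)$, where $\lambda^n,\nu^n\ge 0$, $f^n$ is a time-change function, $K^n\in L^1_{loc}(\mathbb R_+,\mathbb R_+)$, and $G_0^n:\mathbb R_+\to\mathbb R_+$ is non-decreasing with $G_0^n(0)=0$. Suppose that - $K^n(t)\,dt\Rightarrow\delta_0(dt)$ weakly on $[0,T]$, i.e. $\int_0^T\varphi(t)K^n(t)\,dt\to\varphi(0)$ for every continuous $\varphi:[0,T]\to\mathbb R$; - $G_0^n\to G_0$ pointwise on $[0,T]$, where $G_0$ is continuous; - $f^n\to f$ locally uniformly on $\mathbb R_+$, and $\sup_{n\ge 0}\sup_{x\ge 0} f^n(x)/(1+x^2)<\infty$; - $\lambda^n\to\lambda$ and $\nu^n\to\nu$. Then, for a standard Brownian motion $W^*$, almost surely the formula $$X^*_t=\inf\{s\ge 0:\ (1+\lambda)s-\nu W^*_{f(s)}>G_0(t)\},\qquad t\le T,$$ defines a (finite) path in $D^\uparrow[0,T]$,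 and $(W^n,X^n)\Rightarrow(W^*,X^*)$ weakly on $D^\circ[0,T]$ as $n\to\infty$. -/

import Mathlib

open MeasureTheory ProbabilityTheory Filter Topology Set
open scoped NNReal ENNReal

noncomputable section

namespace VolterraClock

/-! ### The Skorokhod space `D[0,T]` and its `M₁` topology -/

/-- The space `D[0,T]` of càdlàg paths `[0,T] → ℝ`. -/
structure CadlagPath (T : ℝ) where
  toFun : Icc (0 : ℝ) T → ℝ
  right_cont : ∀ t, ContinuousWithinAt toFun (Ici t) t
  left_lim : ∀ t, ∃ l : ℝ, Tendsto toFun (𝓝[<] t) (𝓝 l)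

instance (T : ℝ) : CoeFun (CadlagPath T) (fun _ => Icc (0 : ℝ) T → ℝ) := ⟨CadlagPath.toFun⟩

/-- The completed graph `Γ_x = {(z,t) : z ∈ [x(t-), x(t)]}` of a càdlàg path: the graph of `x`
together with the segments bridging its jumps. Here `Function.leftLim x t` is `x(t-)` for `t > 0`,
and is `x(0)` at `t = 0`. -/
def completedGraph {T : ℝ} (x : CadlagPath T) : Set (ℝ × Icc (0 : ℝ) T) :=
  {p | p.1 ∈ segment ℝ (Function.leftLim x p.2) (x p.2)}

/-- The order on the completed graph: first by time, and then, within the segment over a given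
time `t`, by the distance to `x(t-)`. -/
def graphLE {T : ℝ} (x : CadlagPath T) (p q : ℝ × Icc (0 : ℝ) T) : Prop :=
  p.2 < q.2 ∨
    (p.2 = q.2 ∧ |Function.leftLim x p.2 - p.1| ≤ |Function.leftLim x p.2 - q.1|)

/-- Parametric representations of `x`: continuous maps `(u,r)` from `[0,1]` onto the completed
graph of `x` that are non-decreasing for the order of the graph. -/
def IsParametricRep {T : ℝ} (x : CadlagPath T) (γ : C(unitInterval, ℝ × Icc (0 : ℝ) T)) : Prop :=
  Set.range γ = completedGraph x ∧ ∀ a b : unitInterval, a ≤ b → graphLE x (γ a) (γ b)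

/-- Skorokhod's `M₁` distance: the infimum of `max (‖u₁ - u₂‖_∞) (‖r₁ - r₂‖_∞)` over the
parametric representations `(u₁,r₁)` of `x` and `(u₂,r₂)` of `y`. -/
def m1Dist {T : ℝ} (x y : CadlagPath T) : ℝ≥0∞ :=
  ⨅ (γ : C(unitInterval, ℝ × Icc (0 : ℝ) T)) (_ : IsParametricRep x γ)
    (η : C(unitInterval, ℝ × Icc (0 : ℝ) T)) (_ : IsParametricRep y η), edist γ η

/-- The `M₁` topology on `D[0,T]`, i.e. the topology of the metric `m1Dist`. -/
instance m1Topology (T : ℝ) : TopologicalSpace (CadlagPath T) where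
  IsOpen U := ∀ x ∈ U, ∃ ε : ℝ≥0∞, 0 < ε ∧ ∀ y, m1Dist x y < ε → y ∈ U
  isOpen_univ := fun _ _ => ⟨1, one_pos, fun _ _ => mem_univ _⟩
  isOpen_inter := by
    intro U V hU hV x hx
    obtain ⟨ε, hε, h1⟩ := hU x hx.1
    obtain ⟨δ, hδ, h2⟩ := hV x hx.2
    exact ⟨min ε δ, lt_min hε hδ, fun y hy =>
      ⟨h1 y (hy.trans_le (min_le_left _ _)), h2 y (hy.trans_le (min_le_right _ _))⟩⟩
  isOpen_sUnion := by
    intro S hS x hx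
    obtain ⟨U, hU, hxU⟩ := hx
    obtain ⟨ε, hε, h⟩ := hS U hU x hxU
    exact ⟨ε, hε, fun y hy => ⟨U, hU, h y hy⟩⟩

/-- `D^↑[0,T]`: the non-negative, non-decreasing càdlàg paths, with the `M₁` topology. -/
abbrev DUp (T : ℝ) : Type :=
  {x : CadlagPath T // Monotone x.toFun ∧ ∀ t, 0 ≤ x t}

/-! ### The space `D°[0,T]` -/

/-- `D°[0,T] = C[0,∞) × D^↑[0,T]`. -/
def DCirc (T : ℝ) : Type := C(ℝ≥0, ℝ) × DUp T

/-- The first component, in `C[0,∞)`. -/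
def DCirc.path {T : ℝ} (z : DCirc T) : C(ℝ≥0, ℝ) := Prod.fst z

/-- The second component, in `D^↑[0,T]`. -/
def DCirc.clock {T : ℝ} (z : DCirc T) : DUp T := Prod.snd z

/-- The product of the topology of uniform convergence on compacts (the compact-open topology)
and the `M₁` topology. -/
instance (T : ℝ) : TopologicalSpace (DCirc T) :=
  inferInstanceAs (TopologicalSpace (C(ℝ≥0, ℝ) × DUp T))

instance (T : ℝ) : MeasurableSpace (DCirc T) := borel _

instance (T : ℝ) : BorelSpace (DCirc T) := ⟨rfl⟩

/-- A continuous non-decreasing path on `[0,T]` that starts from `0`, as an element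
of `D^↑[0,T]`. -/
def DUp.ofContinuous {T : ℝ} (x : ℝ → ℝ) (hc : ContinuousOn x (Icc 0 T))
    (hm : MonotoneOn x (Icc 0 T)) (h0 : x 0 = 0) : DUp T :=
  ⟨{ toFun := fun t => x t
     right_cont := fun _ => (continuousOn_iff_continuous_domRestrict.1 hc).continuousWithinAt
     left_lim := fun t => ⟨x t, ((continuousOn_iff_continuous_domRestrict.1 hc).tendsto t).mono_left
       nhdsWithin_le_nhds⟩ },
    fun s t hst => hm s.2 t.2 hst,
    fun t => h0.symm.le.trans (hm ⟨le_rfl, t.2.1.trans t.2.2⟩ t.2 t.2.1)⟩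

/-! ### Volterra clocks -/

/-- Admissible time-change functions `f : ℝ₊ → ℝ₊`: `f` is `C¹` on `[0,∞)`, non-decreasing,
starts from zero (so that it is non-negative), and its derivative has at most linear growth.
Values of `f` on `(-∞,0)` are irrelevant. -/
structure IsTimeChange (f : ℝ → ℝ) : Prop where
  contDiff : ContDiffOn ℝ 1 f (Ici 0)
  mono : MonotoneOn f (Ici 0)
  zero : f 0 = 0
  growth : ∃ c : ℝ, 0 ≤ c ∧ ∀ x, 0 ≤ x → |derivWithin f (Ici 0) x| ≤ c * (1 + x)

variable {Ω : Type*} {mΩ : MeasurableSpace Ω}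

/-- `W` is a standard Brownian motion relative to the filtration `𝒢`, with continuous paths. -/
structure IsFilteredBrownian (𝒢 : Filtration ℝ≥0 mΩ) (P : Measure Ω) (W : ℝ≥0 → Ω → ℝ) : Prop where
  brownian : IsBrownianReal W P
  adapted : StronglyAdapted 𝒢 W
  indep : ∀ s t, s ≤ t →
    Indep (MeasurableSpace.comap (fun ω => W t ω - W s ω) inferInstance) (𝒢 s) P
  continuous_path : ∀ ω, Continuous fun s => W s ω

/-- The time-changed process `W_{f(X_t)}`. -/
def timeChanged (f : ℝ → ℝ) (W : ℝ≥0 → Ω → ℝ) (X : ℝ → Ω → ℝ) (t : ℝ) (ω : Ω) : ℝ :=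
  W (f (X t ω)).toNNReal ω

/-- `(W, X)` is a weak solution on `[0,T]`, carried by the filtered probability space
`(Ω, 𝒢, P)`, of
`X_t = G₀(t) + ∫_0^t K(t-s) (-lam X_s + nu W_{f(X_s)}) ds` for the input `(G₀, K, f, lam, nu)`.
Only the restriction of `X` to times in `[0,T]` matters. -/
structure IsWeakSolution (T : ℝ) (G₀ K f : ℝ → ℝ) (lam nu : ℝ)
    (𝒢 : Filtration ℝ≥0 mΩ) (P : Measure Ω) (W : ℝ≥0 → Ω → ℝ) (X : ℝ → Ω → ℝ) : Prop where
  brownian : IsFilteredBrownian 𝒢 P W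
  measurable_clock : ∀ t ∈ Icc 0 T, Measurable (X t)
  continuous_clock : ∀ ω, ContinuousOn (fun t => X t ω) (Icc 0 T)
  monotone_clock : ∀ ω, MonotoneOn (fun t => X t ω) (Icc 0 T)
  clock_zero : ∀ ω, X 0 ω = 0
  stopping : ∀ t ∈ Icc 0 T,
    IsStoppingTime 𝒢 (fun ω => (((f (X t ω)).toNNReal : ℝ≥0) : WithTop ℝ≥0))
  martingale : ∃ hM : ∀ t : Icc (0 : ℝ) T, StronglyMeasurable (timeChanged f W X t),
    Martingale (fun t : Icc (0 : ℝ) T => timeChanged f W X t)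
      (Filtration.natural (fun t : Icc (0 : ℝ) T => timeChanged f W X t) hM) P
  equation : ∀ᵐ ω ∂P, ∀ t ∈ Icc 0 T,
    X t ω = G₀ t + ∫ s in (0 : ℝ)..t, K (t - s) * (-lam * X s ω + nu * timeChanged f W X s ω)

/-- The pair `(W, X)` of a weak solution as a random element of `D°[0,T]`. -/
def IsWeakSolution.toDCirc {T : ℝ} {G₀ K f : ℝ → ℝ} {lam nu : ℝ}
    {𝒢 : Filtration ℝ≥0 mΩ} {P : Measure Ω} {W : ℝ≥0 → Ω → ℝ} {X : ℝ → Ω → ℝ}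
    (h : IsWeakSolution T G₀ K f lam nu 𝒢 P W X) (ω : Ω) : DCirc T :=
  ((⟨fun s => W s ω, h.brownian.continuous_path ω⟩ : C(ℝ≥0, ℝ)),
    DUp.ofContinuous (fun t => X t ω) (h.continuous_clock ω) (h.monotone_clock ω)
      (h.clock_zero ω))

end VolterraClock

end

/-! If the kernel were exactly the unit mass at zero, the equation would read `(1 + λ) X_t - ν
W_{f(X_t)} = G₀(t)`: the clock would sit at a point where the path `g(s) = (1 + λ) s - ν W_{f(s)}`
(`drifted`) takes the value `G₀(t)`. Let `τ_l` be the first time at which `g` exceeds `l`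
(`firstAbove`). The core of the proof, `tendsto_measure_clock_sub`, is that for each fixed `t` the
difference between `Xⁿ_t` and `τ_{G₀(t)}`, computed from the path `Wⁿ` with the limiting
coefficients, tends to zero in probability.

The lower bound is pathwise (`exists_le_of_volterra`, `tendsto_measure_clock_lt`). As long as the
driver stays below a level slightly under `G₀`, the Volterra equation forces the clock to gain a
fixed amount over every short time step, which is incompatible with the clock being bounded. So the
clock cannot lag behind `τ`.

The upper bound is only in mean. The martingale term has mean zero, so the equation yields `limsup E
Xⁿ_t ≤ G₀(t) / (1 + λ)` (`eventually_integral_clock_le`). On the other side, optional stopping gives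
`E τ_l = l / (1 + λ)` exactly (`integral_firstAbove`); the quadratic growth of `f` makes the
contribution of late passages negligible there. A variable that asymptotically dominates `τ` and
whose mean does not exceed that of `τ` in the limit must be close to `τ` in `L¹`.

To pass to path space, note that every `Wⁿ` has the law of Brownian motion, so the pair formed by
`Wⁿ` and its passage clock has the limiting law for every `n`. No tightness is needed: it suffices
that the distance to this pair tends to zero in probability. For monotone paths the `M₁` distance is
controlled by the values on a finite grid (`DUp.dist_rep_le`), through the parametrization of the
completed graph along which `z + t` is affine. -/

noncomputable section

namespace VolterraClock

/-! ### Path spaces -/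

section PathSpace

variable {X Y : Type*} [TopologicalSpace X] [LocallyCompactSpace X] [SecondCountableTopology X]
  [PseudoMetricSpace Y] [SecondCountableTopology Y] [MeasurableSpace Y] [BorelSpace Y]

-- Compactness turns `MapsTo f K U` into a uniform positive distance to `Uᶜ`, a closed condition
-- that can be tested on a countable dense subset of `K`.
omit [LocallyCompactSpace X] [SecondCountableTopology Y] in
theorem measurableSet_mapsTo {K : Set X} (hK : IsCompact K) {U : Set Y} (hU : IsOpen U) :
    MeasurableSet[MeasurableSpace.comap (fun (f : C(X, Y)) x => f x) MeasurableSpace.pi]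
      {f : C(X, Y) | MapsTo f K U} := by
  let _ : MeasurableSpace C(X, Y) :=
    MeasurableSpace.comap (fun (f : C(X, Y)) x => f x) MeasurableSpace.pi
  have heval : ∀ x : X, Measurable fun f : C(X, Y) => f x := fun x =>
    (measurable_pi_apply x).comp (comap_measurable fun (f : C(X, Y)) x => f x)
  rcases K.eq_empty_or_nonempty with rfl | hne
  · simp only [mapsTo_empty, ofPred_true, MeasurableSet.univ]
  obtain ⟨D, hDc, hD⟩ := TopologicalSpace.exists_countable_dense K
  have : {f : C(X, Y) | MapsTo f K U} =
      ⋃ n : ℕ, ⋂ x ∈ D, {f : C(X, Y) | ((n : ℝ≥0∞))⁻¹ ≤ Metric.infEDist (f x) Uᶜ} := by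
    ext f
    simp only [mem_ofPred_eq, mem_iUnion, mem_iInter]
    have hcont : Continuous fun x : X => Metric.infEDist (f x) Uᶜ :=
      Metric.continuous_infEDist.comp f.continuous
    constructor
    · intro h
      obtain ⟨x₀, hx₀, hmin⟩ := hK.exists_isMinOn hne hcont.continuousOn
      have hpos : Metric.infEDist (f x₀) Uᶜ ≠ 0 := by
        intro h0
        have := Metric.mem_closure_iff_infEDist_zero.2 h0
        rw [hU.isClosed_compl.closure_eq] at this
        exact this (h hx₀)
      obtain ⟨n, hn⟩ := ENNReal.exists_inv_nat_lt hpos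
      exact ⟨n, fun x _ => hn.le.trans (hmin x.2)⟩
    · rintro ⟨n, hn⟩ x hx
      by_contra hxU
      have hcl : IsClosed {x : K | ((n : ℝ≥0∞))⁻¹ ≤ Metric.infEDist (f x) Uᶜ} :=
        isClosed_le continuous_const (hcont.comp continuous_subtype_val)
      have hall := hcl.closure_subset_iff.2 (fun x hx => hn x hx)
      rw [hD.closure_eq] at hall
      have h1 : ((n : ℝ≥0∞))⁻¹ ≤ Metric.infEDist (f x) Uᶜ := hall (mem_univ ⟨x, hx⟩)
      rw [Metric.infEDist_zero_of_mem hxU] at h1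
      simp at h1
  rw [this]
  refine MeasurableSet.iUnion fun n => MeasurableSet.biInter hDc fun x _ => ?_
  exact measurableSet_le measurable_const (measurable_infEDist.comp (heval x))

/-- Second countability lets the compact-open subbasis generate the Borel σ-algebra. As a
consequence, measurability of a random path can be checked at fixed times, and its law is determined
by the finite-dimensional ones. -/
theorem borel_continuousMap :
    borel C(X, Y) = MeasurableSpace.comap (fun (f : C(X, Y)) x => f x) MeasurableSpace.pi := by
  apply le_antisymm
  · rw [borel_eq_generateFrom_of_subbasis ContinuousMap.compactOpen_eq]
    refine MeasurableSpace.generateFrom_le ?_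
    rintro _ ⟨K, hK, U, hU, rfl⟩
    exact measurableSet_mapsTo hK hU
  · rw [← measurable_iff_comap_le]
    let _ : MeasurableSpace C(X, Y) := borel _
    have : BorelSpace C(X, Y) := ⟨rfl⟩
    exact measurable_pi_lambda _ fun x => (continuous_eval_const x).measurable

theorem measurable_continuousMap [MeasurableSpace C(X, Y)] [BorelSpace C(X, Y)]
    {α : Type*} [MeasurableSpace α] {F : α → C(X, Y)} (h : ∀ x, Measurable fun a => F a x) :
    Measurable F := by
  have hb : ‹MeasurableSpace C(X, Y)› = _ := (BorelSpace.measurable_eq).trans borel_continuousMap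
  rw [hb, measurable_comap_iff]
  exact measurable_pi_lambda _ h

end PathSpace

instance : MeasurableSpace C(ℝ≥0, ℝ) := borel _

instance : BorelSpace C(ℝ≥0, ℝ) := ⟨rfl⟩

theorem measurable_eval_path (s : ℝ≥0) : Measurable fun w : C(ℝ≥0, ℝ) => w s :=
  (continuous_eval_const s).measurable

theorem isProjectiveLimit_map_path {Ω : Type*} {mΩ : MeasurableSpace Ω} {P : Measure Ω}
    {w : Ω → C(ℝ≥0, ℝ)} (hw : Measurable w) (hB : IsPreBrownianReal (fun s ω => w ω s) P) :
    IsProjectiveLimit ((P.map w).map fun (f : C(ℝ≥0, ℝ)) s => f s)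
      BrownianReal.projectiveFamily := by
  have hcoe : Measurable fun (f : C(ℝ≥0, ℝ)) s => f s :=
    measurable_pi_lambda _ fun s => measurable_eval_path s
  intro I
  rw [Measure.map_map hcoe hw, Measure.map_map (Finset.measurable_restrict _) (hcoe.comp hw),
    ← (hB.hasLaw I).map_eq]
  rfl

/-- The law of Brownian motion on the space of continuous paths is unique. -/
theorem map_eq_of_isPreBrownianReal {Ω Ω' : Type*} {mΩ : MeasurableSpace Ω}
    {mΩ' : MeasurableSpace Ω'} {P : Measure Ω} {P' : Measure Ω'} {w : Ω → C(ℝ≥0, ℝ)}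
    {w' : Ω' → C(ℝ≥0, ℝ)} (hw : Measurable w)
    (hw' : Measurable w') (hB : IsPreBrownianReal (fun s ω => w ω s) P)
    (hB' : IsPreBrownianReal (fun s ω => w' ω s) P') : P.map w = P'.map w' := by
  have hcoe : Measurable fun (f : C(ℝ≥0, ℝ)) s => f s :=
    measurable_pi_lambda _ fun s => measurable_eval_path s
  have heq := (isProjectiveLimit_map_path hw hB).unique (isProjectiveLimit_map_path hw' hB')
  ext A hA
  have hA' : MeasurableSet[MeasurableSpace.comap (fun (f : C(ℝ≥0, ℝ)) x => f x)
      MeasurableSpace.pi] A := by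
    rw [← borel_continuousMap]; exact hA
  obtain ⟨A', hA', rfl⟩ := hA'
  rw [← Measure.map_apply hcoe hA', heq, Measure.map_apply hcoe hA']

/-- A process with almost surely continuous paths has a version in the path space. -/
theorem exists_measurable_path {Ω : Type*} {mΩ : MeasurableSpace Ω} {P : Measure Ω}
    {B : ℝ≥0 → Ω → ℝ} (hm : ∀ s, AEMeasurable (B s) P) (hc : ∀ᵐ ω ∂P, Continuous fun s => B s ω) :
    ∃ w : Ω → C(ℝ≥0, ℝ), Measurable w ∧ ∀ᵐ ω ∂P, ∀ s, w ω s = B s ω := by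
  classical
  obtain ⟨D, hDc, hD⟩ := TopologicalSpace.exists_countable_dense ℝ≥0
  -- Each `B s` is only a.e. measurable, and uncountably many exceptional null sets cannot be
  -- removed together. Measurable versions are therefore compared on a countable dense set of times
  -- only, and continuity handles the other times.
  have hgood : ∀ᵐ ω ∂P, (Continuous fun s => B s ω) ∧ ∀ q ∈ D, B q ω = (hm q).mk (B q) ω := by
    refine hc.and ?_
    rw [ae_ball_iff hDc]
    exact fun q _ => (hm q).ae_eq_mk
  obtain ⟨N, hN, hNm, hN0⟩ := exists_measurable_superset_of_null (ae_iff.1 hgood)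
  have hcont : ∀ ω, ω ∉ N →
      (Continuous fun s => B s ω) ∧ ∀ q ∈ D, B q ω = (hm q).mk (B q) ω := by
    intro ω hω
    by_contra h
    exact hω (hN h)
  refine ⟨fun ω => if h : ω ∈ N then 0 else ⟨fun s => B s ω, (hcont ω h).1⟩, ?_, ?_⟩
  · refine measurable_continuousMap fun s => ?_
    have hq : ∀ q ∈ D, Measurable fun ω =>
        (if h : ω ∈ N then (0 : C(ℝ≥0, ℝ)) else ⟨fun s => B s ω, (hcont ω h).1⟩) q := by
      intro q hq
      have : (fun ω => (if h : ω ∈ N then (0 : C(ℝ≥0, ℝ)) else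
          ⟨fun s => B s ω, (hcont ω h).1⟩) q) = N.piecewise (fun _ => 0) ((hm q).mk (B q)) := by
        ext ω
        by_cases h : ω ∈ N
        · simp [h]
        · simp [h, (hcont ω h).2 q hq]
      rw [this]
      exact measurable_const.piecewise hNm (hm q).measurable_mk
    obtain ⟨u, huD, hu⟩ := mem_closure_iff_seq_limit.1 (hD s)
    refine measurable_of_tendsto_metrizable (fun n => hq (u n) (huD n)) ?_
    rw [tendsto_pi_nhds]
    intro ω
    exact ((ContinuousMap.continuous _).tendsto s).comp hu
  · have : ∀ᵐ ω ∂P, ω ∉ N := by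
      rw [ae_iff]; simpa using hN0
    filter_upwards [this] with ω hω s
    simp [hω]

/-! ### Parametric representations of monotone paths -/

section Graph

variable {T : ℝ}

theorem mem_completedGraph_iff {x : CadlagPath T} (hx : Monotone x.toFun)
    {p : ℝ × Icc (0 : ℝ) T} :
    p ∈ completedGraph x ↔ Function.leftLim x p.2 ≤ p.1 ∧ p.1 ≤ x p.2 := by
  change p.1 ∈ segment ℝ _ _ ↔ _
  rw [segment_eq_Icc (hx.leftLim_le le_rfl), mem_Icc]

theorem mk_mem_completedGraph {x : CadlagPath T} (hx : Monotone x.toFun) (t : Icc (0 : ℝ) T) :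
    (x t, t) ∈ completedGraph x :=
  (mem_completedGraph_iff hx).2 ⟨hx.leftLim_le le_rfl, le_rfl⟩

theorem completedGraph_le_of_lt {x : CadlagPath T} (hx : Monotone x.toFun)
    {p : ℝ × Icc (0 : ℝ) T} (hp : p ∈ completedGraph x) {t : Icc (0 : ℝ) T} (h : p.2 ≤ t) :
    p.1 ≤ x t :=
  ((mem_completedGraph_iff hx).1 hp).2.trans (hx h)

theorem le_completedGraph_of_lt {x : CadlagPath T} (hx : Monotone x.toFun)
    {p : ℝ × Icc (0 : ℝ) T} (hp : p ∈ completedGraph x) {t : Icc (0 : ℝ) T} (h : t < p.2) :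
    x t ≤ p.1 :=
  (hx.le_leftLim h).trans ((mem_completedGraph_iff hx).1 hp).1

/-- The completed graph of a monotone path is a chain for the coordinatewise order, so a point on it
is determined by the sum `z + t`. -/
theorem completedGraph_mono {x : CadlagPath T} (hx : Monotone x.toFun)
    {p q : ℝ × Icc (0 : ℝ) T} (hp : p ∈ completedGraph x) (hq : q ∈ completedGraph x)
    (h : p.1 + p.2 ≤ q.1 + q.2) : p.1 ≤ q.1 ∧ p.2 ≤ q.2 := by
  rcases lt_trichotomy p.2 q.2 with hlt | heq | hgt
  · exact ⟨(completedGraph_le_of_lt hx hp le_rfl).trans (le_completedGraph_of_lt hx hq hlt), hlt.le⟩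
  · refine ⟨?_, heq.le⟩
    rw [heq] at h
    linarith
  · have h1 := (completedGraph_le_of_lt hx hq le_rfl).trans (le_completedGraph_of_lt hx hp hgt)
    have h2 : (q.2 : ℝ) < p.2 := hgt
    linarith

/-- The point lies over the first time `t₀` at which `x t + t` reaches `s`: right-continuity bounds
`s` above by the value at `t₀`, minimality bounds it below by the left limit, and the vertical
segment over `t₀` covers what is between. -/
theorem exists_mem_completedGraph {x : CadlagPath T} (hx : Monotone x.toFun) (hT : 0 ≤ T) {s : ℝ}
    (h0 : x ⟨0, le_rfl, hT⟩ ≤ s) (h1 : s ≤ x ⟨T, hT, le_rfl⟩ + T) :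
    ∃ p ∈ completedGraph x, p.1 + p.2 = s := by
  set A : Set (Icc (0 : ℝ) T) := {t | s ≤ x t + t} with hA
  have hne : (closure A).Nonempty := ⟨_, subset_closure (show (⟨T, hT, le_rfl⟩ : Icc (0 : ℝ) T) ∈ A
    from h1)⟩
  obtain ⟨t₀, ht₀, hmin⟩ := (isClosed_closure (s := A)).isCompact.exists_isLeast hne
  have hlt : ∀ t < t₀, x t + t < s := by
    intro t ht
    by_contra hcon
    exact absurd (hmin (subset_closure (show t ∈ A from not_lt.1 hcon))) (not_le.2 ht)
  have hright : s ≤ x t₀ + t₀ := by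
    by_contra hcon
    have hev : ∀ᶠ t in 𝓝[Ici t₀] t₀, x t + t < s :=
      ((x.right_cont t₀).add continuous_subtype_val.continuousWithinAt).eventually_lt_const
        (not_le.1 hcon)
    rw [eventually_nhdsWithin_iff] at hev
    obtain ⟨t, htA, ht⟩ := ((mem_closure_iff_frequently.1 ht₀).and_eventually hev).exists
    exact absurd (ht (hmin (subset_closure htA))) (not_lt.2 htA)
  have hleft : Function.leftLim x t₀ + t₀ ≤ s := by
    by_cases h00 : (⟨0, le_rfl, hT⟩ : Icc (0 : ℝ) T) < t₀
    · have hnb : (𝓝[<] t₀).NeBot := by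
        rw [← mem_closure_iff_nhdsWithin_neBot, closure_Iio' (a := t₀) ⟨_, h00⟩]
        exact self_mem_Iic
      refine le_of_tendsto ((hx.tendsto_leftLim t₀).add
        (continuous_subtype_val.continuousWithinAt (s := Iio t₀))) ?_
      filter_upwards [self_mem_nhdsWithin] with t ht using (hlt t ht).le
    · have : t₀ = ⟨0, le_rfl, hT⟩ := le_antisymm (not_lt.1 h00) t₀.2.1
      subst this
      have := hx.leftLim_le (le_refl (⟨0, le_rfl, hT⟩ : Icc (0 : ℝ) T))
      simp only [add_zero]
      linarith
  exact ⟨(s - t₀, t₀), (mem_completedGraph_iff hx).2 ⟨by simp only; linarith, by simp only; linarith⟩,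
    by simp⟩

/-- The value of `z + t` at the parameter `a` of the canonical parametric representation. -/
def DUp.level (hT : 0 < T) (x : DUp T) (a : unitInterval) : ℝ :=
  (1 - a) * x.1 ⟨0, le_rfl, hT.le⟩ + a * (x.1 ⟨T, hT.le, le_rfl⟩ + T)

theorem DUp.zero_le_top (hT : 0 < T) (x : DUp T) :
    x.1 ⟨0, le_rfl, hT.le⟩ ≤ x.1 ⟨T, hT.le, le_rfl⟩ := x.2.1 hT.le

theorem DUp.exists_level (hT : 0 < T) (x : DUp T) (a : unitInterval) :
    ∃ p ∈ completedGraph x.1, p.1 + p.2 = x.level hT a := by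
  have h := x.zero_le_top hT
  have ha0 := a.2.1
  have ha1 := a.2.2
  refine exists_mem_completedGraph x.2.1 hT.le ?_ ?_ <;> unfold DUp.level <;> nlinarith

/-- The canonical parametric representation `(z, t)` of a monotone path, for which `z + t` is an
affine function of the parameter. -/
def DUp.repFun (hT : 0 < T) (x : DUp T) (a : unitInterval) : ℝ × Icc (0 : ℝ) T :=
  (x.exists_level hT a).choose

theorem DUp.repFun_mem (hT : 0 < T) (x : DUp T) (a : unitInterval) :
    x.repFun hT a ∈ completedGraph x.1 := (x.exists_level hT a).choose_spec.1

theorem DUp.repFun_add (hT : 0 < T) (x : DUp T) (a : unitInterval) :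
    (x.repFun hT a).1 + (x.repFun hT a).2 = x.level hT a := (x.exists_level hT a).choose_spec.2

theorem DUp.level_mono (hT : 0 < T) (x : DUp T) : Monotone (x.level hT) := by
  intro a b hab
  have h := x.zero_le_top hT
  have hab' : (a : ℝ) ≤ b := hab
  unfold DUp.level
  nlinarith

theorem DUp.repFun_mono (hT : 0 < T) (x : DUp T) {a b : unitInterval} (hab : a ≤ b) :
    (x.repFun hT a).1 ≤ (x.repFun hT b).1 ∧ (x.repFun hT a).2 ≤ (x.repFun hT b).2 :=
  completedGraph_mono x.2.1 (x.repFun_mem hT a) (x.repFun_mem hT b) <| by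
    rw [x.repFun_add, x.repFun_add]; exact x.level_mono hT hab

/-- Both coordinates are non-decreasing in the parameter and add up to the level, so neither can
move more than the level does. -/
theorem DUp.dist_repFun_le (hT : 0 < T) (x : DUp T) (a b : unitInterval) :
    dist (x.repFun hT a) (x.repFun hT b) ≤ dist (x.level hT a) (x.level hT b) := by
  wlog hab : a ≤ b generalizing a b
  · rw [dist_comm, dist_comm (x.level hT a)]
    exact this b a (le_of_not_ge hab)
  obtain ⟨h1, h2⟩ := x.repFun_mono hT hab
  have h2' : ((x.repFun hT a).2 : ℝ) ≤ (x.repFun hT b).2 := h2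
  have ha := x.repFun_add hT a
  have hb := x.repFun_add hT b
  rw [Prod.dist_eq, Subtype.dist_eq, Real.dist_eq, Real.dist_eq, Real.dist_eq,
    abs_of_nonpos (by linarith), abs_of_nonpos (by linarith), abs_of_nonpos (by linarith)]
  exact max_le (by linarith) (by linarith)

theorem DUp.continuous_repFun (hT : 0 < T) (x : DUp T) : Continuous (x.repFun hT) := by
  have hl : Continuous (x.level hT) := by unfold DUp.level; fun_prop
  rw [continuous_iff_continuousAt]
  intro a
  rw [ContinuousAt, tendsto_iff_dist_tendsto_zero]
  refine squeeze_zero (fun _ => dist_nonneg) (fun b => x.dist_repFun_le hT b a) ?_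
  exact tendsto_iff_dist_tendsto_zero.1 (hl.tendsto a)

/-- `DUp.repFun` as a continuous map. -/
def DUp.rep (hT : 0 < T) (x : DUp T) : C(unitInterval, ℝ × Icc (0 : ℝ) T) :=
  ⟨x.repFun hT, x.continuous_repFun hT⟩

theorem DUp.isParametricRep_rep (hT : 0 < T) (x : DUp T) : IsParametricRep x.1 (x.rep hT) := by
  refine ⟨Subset.antisymm ?_ ?_, ?_⟩
  · rintro _ ⟨a, rfl⟩
    exact x.repFun_mem hT a
  · intro p hp
    set x0 := x.1 ⟨0, le_rfl, hT.le⟩ with hx0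
    set x1 := x.1 ⟨T, hT.le, le_rfl⟩ with hx1
    have h01 : x0 ≤ x1 := x.zero_le_top hT
    have hlow : x0 ≤ p.1 + p.2 := by
      by_contra hcon
      have hle : p.1 + p.2 ≤ x0 + (⟨0, le_rfl, hT.le⟩ : Icc (0 : ℝ) T).1 := by
        simp only [add_zero]; exact (not_le.1 hcon).le
      have := completedGraph_mono x.2.1 hp (mk_mem_completedGraph x.2.1 ⟨0, le_rfl, hT.le⟩) hle
      have hp2 : p.2 = ⟨0, le_rfl, hT.le⟩ := le_antisymm this.2 p.2.2.1
      have hl := ((mem_completedGraph_iff x.2.1).1 hp).1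
      -- Nothing approaches time `0` from the left, so the left limit there is the value itself and
      -- the graph over `0` is a single point.
      have hbot : 𝓝[<] p.2 = ⊥ := by
        have : Iio p.2 = ∅ := by
          rw [hp2]; ext t; simp only [mem_Iio, mem_empty_iff_false, iff_false, not_lt]
          exact t.2.1
        rw [this, nhdsWithin_empty]
      rw [leftLim_eq_of_eq_bot _ hbot, hp2] at hl
      have hp0 := p.2.2.1
      apply hcon
      linarith
    have hup : p.1 + p.2 ≤ x1 + T :=
      add_le_add (completedGraph_le_of_lt x.2.1 hp (t := ⟨T, hT.le, le_rfl⟩) p.2.2.2) p.2.2.2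
    have hd : 0 < x1 + T - x0 := by linarith
    refine ⟨⟨(p.1 + p.2 - x0) / (x1 + T - x0), div_nonneg (by linarith) hd.le,
      (div_le_one hd).2 (by linarith)⟩, ?_⟩
    set a : unitInterval := ⟨(p.1 + p.2 - x0) / (x1 + T - x0), _⟩ with ha
    have hlev : x.level hT a = p.1 + p.2 := by
      change (1 - (p.1 + p.2 - x0) / (x1 + T - x0)) * x0 +
        (p.1 + p.2 - x0) / (x1 + T - x0) * (x1 + T) = _
      field_simp
      ring
    have hsum := x.repFun_add hT a
    rw [hlev] at hsum
    have h1 := completedGraph_mono x.2.1 hp (x.repFun_mem hT a) hsum.ge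
    have h2 := completedGraph_mono x.2.1 (x.repFun_mem hT a) hp hsum.le
    exact Prod.ext (le_antisymm h2.1 h1.1) (le_antisymm h2.2 h1.2)
  · intro a b hab
    obtain ⟨h1, h2⟩ := x.repFun_mono hT hab
    rcases h2.lt_or_eq with hlt | heq
    · exact Or.inl hlt
    · refine Or.inr ⟨heq, ?_⟩
      have ha := ((mem_completedGraph_iff x.2.1).1 (x.repFun_mem hT a)).1
      change |Function.leftLim x.1 (x.repFun hT a).2 - (x.repFun hT a).1| ≤
        |Function.leftLim x.1 (x.repFun hT a).2 - (x.repFun hT b).1|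
      rw [abs_of_nonpos (by linarith), abs_of_nonpos (by linarith)]
      linarith

theorem m1Dist_le_edist_rep (hT : 0 < T) (x y : DUp T) :
    m1Dist x.1 y.1 ≤ edist (x.rep hT) (y.rep hT) :=
  (iInf₂_le _ (x.isParametricRep_rep hT)).trans (iInf₂_le _ (y.isParametricRep_rep hT))

/-- Monotone paths that are close on a fine grid have close parametric representations. -/
theorem DUp.dist_rep_le (hT : 0 < T) (x y : DUp T) {ε δ : ℝ} (hε : 0 ≤ ε) (hδ : 0 ≤ δ)
    {S : Set (Icc (0 : ℝ) T)}
    (hS : ∀ t t' : Icc (0 : ℝ) T, (t : ℝ) + ε < t' → ∃ r ∈ S, t ≤ r ∧ r < t')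
    (h0 : ⟨0, le_rfl, hT.le⟩ ∈ S) (h1 : ⟨T, hT.le, le_rfl⟩ ∈ S)
    (hxy : ∀ r ∈ S, |x.1 r - y.1 r| ≤ δ) : dist (x.rep hT) (y.rep hT) ≤ ε + 3 * δ := by
  -- The levels differ by at most `δ`. If the times differed by more than `ε + 2 * δ`, some `r ∈ S`
  -- would lie between them; then the point of `x` is below `x r`, that of `y` above `y r`, and the
  -- heights could offset at most `δ` of the time gap. Height is level minus time, which accounts
  -- for the third `δ`.
  have key : ∀ (x y : DUp T) (hxy : ∀ r ∈ S, |x.1 r - y.1 r| ≤ δ) (a : unitInterval),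
      ((y.repFun hT a).2 : ℝ) - (x.repFun hT a).2 ≤ ε + 2 * δ ∧
        y.level hT a - x.level hT a ≤ δ := by
    intro x y hxy a
    have hl : y.level hT a - x.level hT a ≤ δ := by
      have e0 := (abs_le.1 (hxy _ h0)).1
      have e1 := (abs_le.1 (hxy _ h1)).1
      have ha0 := a.2.1
      have ha1 := a.2.2
      unfold DUp.level
      nlinarith
    refine ⟨?_, hl⟩
    by_contra hcon
    obtain ⟨r, hr, hr1, hr2⟩ := hS (x.repFun hT a).2 (y.repFun hT a).2 (by linarith)
    have e1 := completedGraph_le_of_lt x.2.1 (x.repFun_mem hT a) hr1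
    have e2 := le_completedGraph_of_lt y.2.1 (y.repFun_mem hT a) hr2
    have e3 := (abs_le.1 (hxy r hr)).2
    have ex := x.repFun_add hT a
    have ey := y.repFun_add hT a
    linarith
  rw [ContinuousMap.dist_le (by positivity)]
  intro a
  obtain ⟨h1, h2⟩ := key x y hxy a
  obtain ⟨h3, h4⟩ := key y x (fun r hr => by rw [abs_sub_comm]; exact hxy r hr) a
  have ex := x.repFun_add hT a
  have ey := y.repFun_add hT a
  change dist (x.repFun hT a) (y.repFun hT a) ≤ _
  rw [Prod.dist_eq, Subtype.dist_eq, Real.dist_eq, Real.dist_eq]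
  refine max_le (abs_le.2 ⟨?_, ?_⟩) (abs_le.2 ⟨?_, ?_⟩) <;> linarith

/-- Expresses the time coordinate through values of the path at fixed times, which gives
measurability of the representation. -/
theorem DUp.repFun_snd_le_iff (hT : 0 < T) (x : DUp T) (a : unitInterval) (r : Icc (0 : ℝ) T) :
    (x.repFun hT a).2 ≤ r ↔ x.level hT a ≤ x.1 r + r := by
  rw [← x.repFun_add hT a]
  constructor
  · intro h
    exact add_le_add (completedGraph_le_of_lt x.2.1 (x.repFun_mem hT a) h) h
  · intro h
    exact (completedGraph_mono x.2.1 (x.repFun_mem hT a) (mk_mem_completedGraph x.2.1 r) h).2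

theorem DUp.measurable_rep_apply (hT : 0 < T) {Ω : Type*} [MeasurableSpace Ω] {x : Ω → DUp T}
    (hx : ∀ t, Measurable fun ω => (x ω).1 t) (a : unitInterval) :
    Measurable fun ω => (x ω).rep hT a := by
  have hl : Measurable fun ω => (x ω).level hT a := by
    unfold DUp.level
    exact ((hx _).const_mul _).add (((hx _).add_const _).const_mul _)
  have h2 : Measurable fun ω => ((x ω).repFun hT a).2 := by
    refine measurable_of_Iic fun r => ?_
    have : (fun ω => ((x ω).repFun hT a).2) ⁻¹' Iic r = {ω | (x ω).level hT a ≤ (x ω).1 r + r} := by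
      ext ω
      exact (x ω).repFun_snd_le_iff hT a r
    rw [this]
    exact measurableSet_le hl ((hx r).add_const _)
  have h1 : (fun ω => ((x ω).repFun hT a).1) =
      fun ω => (x ω).level hT a - ((x ω).repFun hT a).2 := by
    ext ω
    rw [← (x ω).repFun_add hT a]
    ring
  have h1' : Measurable fun ω => ((x ω).repFun hT a).1 := by
    rw [h1]
    exact hl.sub (measurable_subtype_coe.comp h2)
  exact h1'.prodMk h2

end Graph

/-! ### Convergence in distribution -/

section ConvergingTogether

variable {E : Type*} [PseudoMetricSpace E] [MeasurableSpace E] [BorelSpace E]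
  [SecondCountableTopology E]

theorem integral_sub_le_of_lipschitz {Ω : Type*} {mΩ : MeasurableSpace Ω} {P : Measure Ω}
    [IsProbabilityMeasure P] {X Y : Ω → E} (hX : Measurable X) (hY : Measurable Y)
    {F : E → ℝ} {M : ℝ} (hM : ∀ x y, dist (F x) (F y) ≤ M) {L : ℝ≥0} (hL : LipschitzWith L F)
    {ε : ℝ} (hε : 0 ≤ ε) :
    |∫ ω, F (X ω) ∂P - ∫ ω, F (Y ω) ∂P| ≤ L * ε + M * P.real {ω | ε < dist (X ω) (Y ω)} := by
  have hFm : Measurable F := hL.continuous.measurable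
  have hint : ∀ {X : Ω → E}, Measurable X → Integrable (fun ω => F (X ω)) P := by
    intro X hX
    obtain ⟨ω₀⟩ : Nonempty Ω := P.nonempty_of_neZero
    refine Integrable.of_bound (hFm.comp hX).aestronglyMeasurable (‖F (X ω₀)‖ + M)
      (ae_of_all _ fun ω => ?_)
    have h1 := hM (X ω) (X ω₀)
    rw [dist_eq_norm] at h1
    have h2 := norm_le_norm_add_norm_sub' (F (X ω)) (F (X ω₀))
    linarith
  have hset : MeasurableSet {ω | ε < dist (X ω) (Y ω)} :=
    measurableSet_lt measurable_const (hX.dist hY)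
  have hM0 : 0 ≤ M := by
    obtain ⟨ω₀⟩ : Nonempty Ω := P.nonempty_of_neZero
    exact dist_nonneg.trans (hM (X ω₀) (X ω₀))
  rw [← integral_sub (hint hX) (hint hY)]
  have hbound : ∀ ω, |F (X ω) - F (Y ω)| ≤
      L * ε + ({ω | ε < dist (X ω) (Y ω)}.indicator (fun _ => M)) ω := by
    intro ω
    by_cases h : ε < dist (X ω) (Y ω)
    · rw [indicator_of_mem (show ω ∈ {ω | ε < dist (X ω) (Y ω)} from h)]
      have h1 := hM (X ω) (Y ω)
      rw [Real.dist_eq] at h1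
      have : 0 ≤ L * ε := by positivity
      linarith
    · rw [indicator_of_notMem (show ω ∉ {ω | ε < dist (X ω) (Y ω)} from h), add_zero, ← Real.dist_eq]
      exact (hL.dist_le_mul _ _).trans (by gcongr; exact not_lt.1 h)
  calc |∫ ω, (F (X ω) - F (Y ω)) ∂P| ≤ ∫ ω, |F (X ω) - F (Y ω)| ∂P := abs_integral_le_integral_abs
    _ ≤ ∫ ω, (L * ε + ({ω | ε < dist (X ω) (Y ω)}.indicator (fun _ => M)) ω) ∂P := by
      refine integral_mono ((hint hX).sub (hint hY)).abs ?_ hbound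
      exact (integrable_const _).add ((integrable_const _).indicator hset)
    _ = _ := by
      rw [integral_add (integrable_const _) ((integrable_const _).indicator hset),
        integral_indicator_const _ hset]
      simp [mul_comm]

/-- Two sequences of random elements whose distances tend to zero in probability converge together
in distribution; here one of them has a constant law. -/
theorem tendstoInDistribution_of_dist {Ω : ℕ → Type*} {mΩ : ∀ n, MeasurableSpace (Ω n)}
    {P : ∀ n, Measure (Ω n)} [∀ n, IsProbabilityMeasure (P n)] {Ωs : Type*}
    {mΩs : MeasurableSpace Ωs} {Ps : Measure Ωs} [IsProbabilityMeasure Ps]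
    {X Y : ∀ n, Ω n → E} {Z : Ωs → E} (hX : ∀ n, Measurable (X n)) (hY : ∀ n, Measurable (Y n))
    (hZ : Measurable Z) (hlaw : ∀ n, (P n).map (Y n) = Ps.map Z)
    (hconv : ∀ ε > 0, Tendsto (fun n => (P n).real {ω | ε < dist (X n ω) (Y n ω)}) atTop (𝓝 0)) :
    TendstoInDistribution X atTop Z P Ps := by
  refine ⟨fun n => (hX n).aemeasurable, hZ.aemeasurable, ?_⟩
  refine tendsto_iff_forall_lipschitz_integral_tendsto.2 ?_
  rintro F ⟨M, hM⟩ ⟨L, hL⟩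
  have hFm : Measurable F := hL.continuous.measurable
  simp only [ProbabilityMeasure.coe_mk]
  have hZY : ∀ n, ∫ x, F x ∂(Ps.map Z) = ∫ ω, F (Y n ω) ∂(P n) := by
    intro n
    rw [← hlaw n, integral_map (hY n).aemeasurable hFm.aestronglyMeasurable]
  have hXX : ∀ n, ∫ x, F x ∂((P n).map (X n)) = ∫ ω, F (X n ω) ∂(P n) := fun n =>
    integral_map (hX n).aemeasurable hFm.aestronglyMeasurable
  rw [Metric.tendsto_atTop']
  intro η hη
  have hε : 0 < η / (2 * (L + 1)) := by positivity
  have hlim := ((hconv _ hε).const_mul M).const_add (L * (η / (2 * (L + 1))))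
  rw [mul_zero, add_zero] at hlim
  have hlt : L * (η / (2 * (L + 1))) < η := by
    have : (L : ℝ) * (η / (2 * (L + 1))) = (η / 2) * (L / (L + 1)) := by field_simp
    rw [this]
    have h1 : (L : ℝ) / (L + 1) ≤ 1 := (div_le_one (by positivity)).2 (by linarith)
    nlinarith
  obtain ⟨N, hN⟩ := eventually_atTop.1 (hlim.eventually_lt_const hlt)
  refine ⟨N, fun n hn => ?_⟩
  rw [Real.dist_eq, hXX n, hZY n]
  exact (integral_sub_le_of_lipschitz (hX n) (hY n) hM hL hε.le).trans_lt (hN n hn.le)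

end ConvergingTogether

/-! ### The space `D°[0,T]` with the metric of the canonical parametric representations -/

section GraphSpace

variable {T : ℝ}

/-- The set `D°[0,T]`, with the topology that is induced by the canonical parametric
representations. -/
def GraphSpace (T : ℝ) (_ : 0 < T) : Type := DCirc T

/-- A pair of paths as an element of `D°[0,T]`. -/
def DCirc.mk (w : C(ℝ≥0, ℝ)) (x : DUp T) : DCirc T := (w, x)

/-- A pair of paths as an element of `GraphSpace`. -/
def GraphSpace.mk (hT : 0 < T) (w : C(ℝ≥0, ℝ)) (x : DUp T) : GraphSpace T hT := DCirc.mk w x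

/-- The embedding of `D°[0,T]` by the canonical parametric representations. -/
def GraphSpace.embed (hT : 0 < T) (z : GraphSpace T hT) :
    C(ℝ≥0, ℝ) × C(unitInterval, ℝ × Icc (0 : ℝ) T) :=
  (DCirc.path z, (DCirc.clock z).rep hT)

/-- Convergence in distribution is proved for this pseudometric and then transported by the identity
map. No metric property of `m1Dist` is needed, only `m1Dist_le_edist_rep`, which makes that identity
continuous; second countability and measurability by evaluations come from the embedding into path
spaces. -/
instance (hT : 0 < T) : PseudoMetricSpace (GraphSpace T hT) :=
  letI : PseudoMetricSpace C(ℝ≥0, ℝ) := TopologicalSpace.pseudoMetrizableSpacePseudoMetric _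
  PseudoMetricSpace.induced (GraphSpace.embed hT) inferInstance

instance (hT : 0 < T) : MeasurableSpace (GraphSpace T hT) := borel _

instance (hT : 0 < T) : BorelSpace (GraphSpace T hT) := ⟨rfl⟩

theorem GraphSpace.isInducing_embed (hT : 0 < T) : IsInducing (GraphSpace.embed hT) := ⟨rfl⟩

instance (hT : 0 < T) : SecondCountableTopology (GraphSpace T hT) :=
  (GraphSpace.isInducing_embed hT).secondCountableTopology

theorem GraphSpace.dist_eq (hT : 0 < T) (w : C(ℝ≥0, ℝ)) (x y : DUp T) :
    dist (GraphSpace.mk hT w x) (GraphSpace.mk hT w y) = dist (x.rep hT) (y.rep hT) := by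
  let _ : PseudoMetricSpace C(ℝ≥0, ℝ) := TopologicalSpace.pseudoMetrizableSpacePseudoMetric _
  change max (dist w w) (dist (x.rep hT) (y.rep hT)) = _
  rw [dist_self, max_eq_right dist_nonneg]

theorem GraphSpace.measurable_mk (hT : 0 < T) {Ω : Type*} [MeasurableSpace Ω]
    {w : Ω → C(ℝ≥0, ℝ)} {x : Ω → DUp T} (hw : Measurable w)
    (hx : ∀ t, Measurable fun ω => (x ω).1 t) :
    Measurable fun ω => GraphSpace.mk hT (w ω) (x ω) := by
  let _ : MeasurableSpace C(unitInterval, ℝ × Icc (0 : ℝ) T) := borel _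
  have : BorelSpace C(unitInterval, ℝ × Icc (0 : ℝ) T) := ⟨rfl⟩
  have hb : (inferInstance : MeasurableSpace (GraphSpace T hT)) =
      MeasurableSpace.comap (GraphSpace.embed hT) inferInstance := by
    have h := BorelSpace.measurable_eq (α := C(ℝ≥0, ℝ) × C(unitInterval, ℝ × Icc (0 : ℝ) T))
    refine Eq.trans ?_ (congrArg (MeasurableSpace.comap (GraphSpace.embed hT)) h).symm
    exact borel_comap
  have hm : Measurable fun ω => GraphSpace.embed hT (GraphSpace.mk hT (w ω) (x ω)) :=
    hw.prodMk (measurable_continuousMap fun a => DUp.measurable_rep_apply hT hx a)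
  intro A hA
  have hA' : MeasurableSet[MeasurableSpace.comap (GraphSpace.embed hT) inferInstance] A := hb ▸ hA
  obtain ⟨B, hB, rfl⟩ := hA'
  exact hm hB

/-- The identity from `GraphSpace` to `D°[0,T]`. -/
def GraphSpace.toDCirc (hT : 0 < T) (z : GraphSpace T hT) : DCirc T := z

theorem GraphSpace.continuous_toDCirc (hT : 0 < T) : Continuous (GraphSpace.toDCirc hT) := by
  have h1 : Continuous fun z : GraphSpace T hT => (GraphSpace.embed hT z).1 :=
    continuous_fst.comp (GraphSpace.isInducing_embed hT).continuous
  have h2 : Continuous fun z : GraphSpace T hT => (GraphSpace.embed hT z).2 :=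
    continuous_snd.comp (GraphSpace.isInducing_embed hT).continuous
  have h3 : Continuous fun z : GraphSpace T hT => (DCirc.clock z).1 := by
    rw [continuous_def]
    intro U hU
    rw [isOpen_iff_mem_nhds]
    intro z hz
    obtain ⟨ε, hε, hU⟩ := hU _ hz
    filter_upwards [h2.tendsto z (Metric.eball_mem_nhds _ hε)] with y hy
    refine hU _ ((m1Dist_le_edist_rep hT _ _).trans_lt ?_)
    rw [edist_comm]
    exact hy
  exact h1.prodMk (Continuous.subtype_mk h3 fun z => (DCirc.clock z).2)

theorem exists_finite_grid (hT : 0 < T) {ε : ℝ} (hε : 0 < ε) :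
    ∃ S : Finset (Icc (0 : ℝ) T),
      (∀ t t' : Icc (0 : ℝ) T, (t : ℝ) + ε < t' → ∃ r ∈ S, t ≤ r ∧ r < t') ∧
      ⟨0, le_rfl, hT.le⟩ ∈ S ∧ ⟨T, hT.le, le_rfl⟩ ∈ S := by
  classical
  obtain ⟨N, hN⟩ := exists_nat_gt (T / ε)
  let g : ℕ → Icc (0 : ℝ) T := fun k => projIcc 0 T hT.le (k * ε)
  refine ⟨(Finset.range (N + 1)).image g, ?_, ?_, ?_⟩
  · intro t t' htt
    have hk0 : 0 ≤ (t : ℝ) / ε := div_nonneg t.2.1 hε.le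
    set k := ⌈(t : ℝ) / ε⌉₊ with hk
    have hk1 : (t : ℝ) ≤ k * ε := (div_le_iff₀ hε).1 (Nat.le_ceil _)
    have hk2 : (k : ℝ) * ε < t + ε := by
      have := Nat.ceil_lt_add_one hk0
      rw [← hk] at this
      calc (k : ℝ) * ε < ((t : ℝ) / ε + 1) * ε := by gcongr
        _ = t + ε := by field_simp
    have hkT : (k : ℝ) * ε ∈ Icc 0 T := ⟨by positivity, (hk2.le.trans htt.le).trans t'.2.2⟩
    refine ⟨g k, Finset.mem_image_of_mem _ (Finset.mem_range.2 ?_), ?_, ?_⟩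
    · have : (k : ℝ) < N := by
        refine lt_of_le_of_lt ?_ hN
        rw [le_div_iff₀ hε]
        exact hkT.2
      have : k < N := by exact_mod_cast this
      omega
    · simp only [g, projIcc_of_mem hT.le hkT]
      exact hk1
    · simp only [g, projIcc_of_mem hT.le hkT]
      exact hk2.trans htt
  · refine Finset.mem_image.2 ⟨0, Finset.mem_range.2 (by omega), ?_⟩
    simp only [g, Nat.cast_zero, zero_mul]
    exact projIcc_left hT.le
  · refine Finset.mem_image.2 ⟨N, Finset.mem_range.2 (by omega), ?_⟩
    exact projIcc_of_right_le hT.le (by rw [div_lt_iff₀ hε] at hN; exact hN.le)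

/-- Convergence in distribution on `D°[0,T]` of pairs `(Wⁿ, Xⁿ)`, where the `Wⁿ` share the same law
and `Xⁿ_t` is asymptotically a functional of `Wⁿ`, for each `t`. -/
theorem tendstoInDistribution_dCirc (hT : 0 < T) {Ω : ℕ → Type*}
    {mΩ : ∀ n, MeasurableSpace (Ω n)}
    {P : ∀ n, Measure (Ω n)} [∀ n, IsProbabilityMeasure (P n)] {Ωs : Type*}
    {mΩs : MeasurableSpace Ωs} {Ps : Measure Ωs} [IsProbabilityMeasure Ps]
    {W : ∀ n, Ω n → C(ℝ≥0, ℝ)} {X : ∀ n, Ω n → DUp T} {w : Ωs → C(ℝ≥0, ℝ)}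
    {clock : C(ℝ≥0, ℝ) → DUp T} (hclock : ∀ t, Measurable fun w => (clock w).1 t)
    (hW : ∀ n, Measurable (W n)) (hX : ∀ n t, Measurable fun ω => (X n ω).1 t) (hw : Measurable w)
    (hlaw : ∀ n, (P n).map (W n) = Ps.map w)
    (hconv : ∀ t, ∀ ε > 0, Tendsto
      (fun n => (P n).real {ω | ε < |(X n ω).1 t - (clock (W n ω)).1 t|}) atTop (𝓝 0)) :
    TendstoInDistribution (fun n ω => DCirc.mk (W n ω) (X n ω)) atTop
      (fun ω => DCirc.mk (w ω) (clock (w ω))) P Ps := by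
  have hcl : Measurable fun w => GraphSpace.mk hT w (clock w) :=
    GraphSpace.measurable_mk hT measurable_id hclock
  have key : TendstoInDistribution (fun n ω => GraphSpace.mk hT (W n ω) (X n ω)) atTop
      (fun ω => GraphSpace.mk hT (w ω) (clock (w ω))) P Ps := by
    refine tendstoInDistribution_of_dist
      (Y := fun n ω => GraphSpace.mk hT (W n ω) (clock (W n ω)))
      (fun n => GraphSpace.measurable_mk hT (hW n) (hX n)) (fun n => hcl.comp (hW n)) (hcl.comp hw)
      ?_ ?_
    · intro n
      change (P n).map ((fun w => GraphSpace.mk hT w (clock w)) ∘ W n) =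
        Ps.map ((fun w => GraphSpace.mk hT w (clock w)) ∘ w)
      rw [← Measure.map_map hcl (hW n), ← Measure.map_map hcl hw, hlaw n]
    · intro ε hε
      -- Mesh `ε / 2` and accuracy `ε / 6` on the grid add up to `ε / 2 + 3 * (ε / 6) = ε` in
      -- `DUp.dist_rep_le`.
      obtain ⟨S, hS, h0, h1⟩ := exists_finite_grid hT (half_pos hε)
      have hsum : Tendsto (fun n => ∑ t ∈ S,
          (P n).real {ω | ε / 6 < |(X n ω).1 t - (clock (W n ω)).1 t|}) atTop (𝓝 0) := by
        simpa using tendsto_finsetSum S fun t _ => hconv t (ε / 6) (by positivity)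
      refine squeeze_zero (fun _ => measureReal_nonneg) (fun n => ?_) hsum
      refine (measureReal_mono ?_ (measure_ne_top _ _)).trans (measureReal_biUnion_finset_le S _)
      intro ω hω
      by_contra hcon
      simp only [mem_iUnion, mem_ofPred_eq, not_exists, not_lt] at hcon
      have hω' : ε < dist (GraphSpace.mk hT (W n ω) (X n ω))
        (GraphSpace.mk hT (W n ω) (clock (W n ω))) := hω
      rw [GraphSpace.dist_eq] at hω'
      have := DUp.dist_rep_le hT (X n ω) (clock (W n ω)) (half_pos hε).le
        (show 0 ≤ ε / 6 by positivity) (S := (S : Set (Icc (0 : ℝ) T))) hS h0 h1 hcon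
      linarith
  exact key.continuous_comp (GraphSpace.continuous_toDCirc hT)

end GraphSpace

/-! ### First passage times of continuous paths -/

section FirstPassage

/-- The first time at which `g` exceeds the level `l`. -/
def firstAbove (g : ℝ → ℝ) (l : ℝ) : ℝ := sInf {s | 0 ≤ s ∧ l < g s}

/-- The first time before `N` at which `g` exceeds the level `l`, and `N` if there is none. -/
def firstAboveBefore (g : ℝ → ℝ) (l N : ℝ) : ℝ := sInf (insert N {s | 0 ≤ s ∧ l < g s})

variable {g : ℝ → ℝ} {l N : ℝ}

theorem bddBelow_above : BddBelow {s | 0 ≤ s ∧ l < g s} := ⟨0, fun _ hs => hs.1⟩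

theorem firstAbove_nonneg : 0 ≤ firstAbove g l := Real.sInf_nonneg fun _ hs => hs.1

theorem firstAbove_le {s : ℝ} (hs : 0 ≤ s) (h : l < g s) : firstAbove g l ≤ s :=
  csInf_le bddBelow_above ⟨hs, h⟩

/-- In this form the event that the truncated passage time is at least `s` is an intersection of
closed conditions on the path, whence its measurability. -/
theorem le_firstAboveBefore_iff {s : ℝ} :
    s ≤ firstAboveBefore g l N ↔ s ≤ N ∧ ∀ u, 0 ≤ u → u < s → g u ≤ l := by
  unfold firstAboveBefore
  rw [le_csInf_iff (bddBelow_above.insert N) (insert_nonempty _ _)]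
  simp only [mem_insert_iff, mem_ofPred_eq, forall_eq_or_imp]
  refine and_congr_right fun _ => ⟨fun h u hu hus => ?_, fun h u hu => ?_⟩
  · by_contra hcon
    exact absurd (h u ⟨hu, not_le.1 hcon⟩) (not_le.2 hus)
  · by_contra hcon
    exact absurd (h u hu.1 (not_le.1 hcon)) (not_le.2 hu.2)

theorem firstAboveBefore_le : firstAboveBefore g l N ≤ N :=
  (le_firstAboveBefore_iff.1 le_rfl).1

theorem firstAboveBefore_nonneg (hN : 0 ≤ N) : 0 ≤ firstAboveBefore g l N :=
  le_firstAboveBefore_iff.2 ⟨hN, fun _ hu hu' => absurd hu (not_le.2 hu')⟩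

theorem firstAboveBefore_le_of_lt {s : ℝ} (hs : 0 ≤ s) (h : l < g s) :
    firstAboveBefore g l N ≤ s :=
  csInf_le (bddBelow_above.insert N) (mem_insert_of_mem _ ⟨hs, h⟩)

theorem firstAboveBefore_of_nonempty (h : {s | 0 ≤ s ∧ l < g s}.Nonempty) :
    firstAboveBefore g l N = min N (firstAbove g l) :=
  csInf_insert bddBelow_above h

theorem firstAboveBefore_of_not_nonempty (h : ¬ {s | 0 ≤ s ∧ l < g s}.Nonempty) :
    firstAboveBefore g l N = N := by
  rw [not_nonempty_iff_eq_empty] at h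
  unfold firstAboveBefore
  rw [h, insert_empty_eq, csInf_singleton]

theorem apply_firstAboveBefore_le (hg : ContinuousOn g (Ici 0)) (h0 : g 0 ≤ l) (hN : 0 ≤ N) :
    g (firstAboveBefore g l N) ≤ l := by
  set σ := firstAboveBefore g l N with hσ
  have hσ0 : 0 ≤ σ := firstAboveBefore_nonneg hN
  have hall := (le_firstAboveBefore_iff.1 (le_refl σ)).2
  rcases hσ0.eq_or_lt with h | h
  · rw [← h]; exact h0
  · have hnb : (𝓝[Ico 0 σ] σ).NeBot := by
      rw [← mem_closure_iff_nhdsWithin_neBot, closure_Ico h.ne]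
      exact right_mem_Icc.2 hσ0
    refine le_of_tendsto ((hg σ hσ0).mono_left (nhdsWithin_mono _ fun u (hu : u ∈ Ico 0 σ) => hu.1)) ?_
    filter_upwards [self_mem_nhdsWithin] with u hu using hall u hu.1 hu.2

theorem le_apply_firstAboveBefore (hg : ContinuousOn g (Ici 0))
    (h : firstAboveBefore g l N < N) : l ≤ g (firstAboveBefore g l N) := by
  have hne : {s | 0 ≤ s ∧ l < g s}.Nonempty := by
    by_contra hcon
    rw [firstAboveBefore_of_not_nonempty hcon] at h
    exact lt_irrefl _ h
  have heq : firstAboveBefore g l N = firstAbove g l := by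
    rw [firstAboveBefore_of_nonempty hne] at h ⊢
    rcases min_lt_iff.1 h with h' | h'
    · exact absurd h' (lt_irrefl _)
    · exact min_eq_right h'.le
  rw [heq]
  have hcl : firstAbove g l ∈ closure {s | 0 ≤ s ∧ l < g s} := csInf_mem_closure hne bddBelow_above
  have hnb := mem_closure_iff_nhdsWithin_neBot.1 hcl
  refine ge_of_tendsto ((hg _ firstAbove_nonneg).mono_left (nhdsWithin_mono _
    (fun u (hu : u ∈ {s | 0 ≤ s ∧ l < g s}) => hu.1))) ?_
  filter_upwards [self_mem_nhdsWithin] with u hu using hu.2.le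

theorem firstAbove_mono {l' : ℝ} (h : l ≤ l') (hne : {s | 0 ≤ s ∧ l' < g s}.Nonempty) :
    firstAbove g l ≤ firstAbove g l' :=
  csInf_le_csInf bddBelow_above hne fun _ hs => ⟨hs.1, h.trans_lt hs.2⟩

theorem above_nonempty_mono {l' : ℝ} (h : l ≤ l') (hne : {s | 0 ≤ s ∧ l' < g s}.Nonempty) :
    {s | 0 ≤ s ∧ l < g s}.Nonempty := hne.mono fun _ hs => ⟨hs.1, h.trans_lt hs.2⟩

/-- The first passage time is right-continuous in the level. -/
theorem exists_firstAbove_lt (hne : {s | 0 ≤ s ∧ l < g s}.Nonempty) {ε : ℝ} (hε : 0 < ε) :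
    ∃ l' > l, ∀ m < l', firstAbove g m < firstAbove g l + ε := by
  obtain ⟨s, hs, hlt⟩ := exists_lt_of_csInf_lt hne (lt_add_of_pos_right (firstAbove g l) hε)
  exact ⟨g s, hs.2, fun m hm => (firstAbove_le hs.1 hm).trans_lt hlt⟩

end FirstPassage

/-! ### First passage times of a time-changed path with drift -/

section Drifted

/-- The path `s ↦ (1 + lam) s - nu w(f(s))`. -/
def drifted (lam nu : ℝ) (f : ℝ → ℝ) (w : C(ℝ≥0, ℝ)) (s : ℝ) : ℝ :=
  (1 + lam) * s - nu * w (f s).toNNReal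

variable {lam nu : ℝ} {f : ℝ → ℝ}

theorem continuousOn_drifted (hf : ContinuousOn f (Ici 0)) (w : C(ℝ≥0, ℝ)) :
    ContinuousOn (drifted lam nu f w) (Ici 0) := by
  unfold drifted
  exact (continuousOn_const.mul continuousOn_id).sub (continuousOn_const.mul
    ((w.continuous.comp continuous_real_toNNReal).comp_continuousOn hf))

theorem continuous_drifted_left (s : ℝ) : Continuous fun w => drifted lam nu f w s :=
  continuous_const.sub (continuous_const.mul (continuous_eval_const _))

theorem measurableSet_above_nonempty (l : ℝ) :
    MeasurableSet {w | {s | 0 ≤ s ∧ l < drifted lam nu f w s}.Nonempty} := by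
  have : {w | {s | 0 ≤ s ∧ l < drifted lam nu f w s}.Nonempty} =
      ⋃ s ∈ Ici (0 : ℝ), {w | l < drifted lam nu f w s} := by
    ext w
    simp [Set.Nonempty]
  rw [this]
  exact (isOpen_biUnion fun s _ => isOpen_lt continuous_const
    (continuous_drifted_left s)).measurableSet

theorem measurable_firstAboveBefore (l N : ℝ) :
    Measurable fun w => firstAboveBefore (drifted lam nu f w) l N := by
  refine measurable_of_Ici fun s => ?_
  have : (fun w => firstAboveBefore (drifted lam nu f w) l N) ⁻¹' Ici s =
      {_w | s ≤ N} ∩ ⋂ u ∈ Ico (0 : ℝ) s, {w | drifted lam nu f w u ≤ l} := by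
    ext w
    simp only [mem_preimage, mem_Ici, le_firstAboveBefore_iff, mem_inter_iff, mem_ofPred_eq,
      mem_iInter, mem_Ico, and_imp]
  rw [this]
  exact (MeasurableSet.const _).inter (isClosed_biInter fun u _ => isClosed_le
    (continuous_drifted_left u) continuous_const).measurableSet

theorem tendsto_firstAboveBefore {g : ℝ → ℝ} {l : ℝ} (h : {s | 0 ≤ s ∧ l < g s}.Nonempty) :
    Tendsto (fun n : ℕ => firstAboveBefore g l n) atTop (𝓝 (firstAbove g l)) := by
  refine tendsto_const_nhds.congr' ?_
  obtain ⟨n₀, hn₀⟩ := exists_nat_ge (firstAbove g l)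
  filter_upwards [eventually_ge_atTop n₀] with n hn
  rw [firstAboveBefore_of_nonempty h, min_eq_right]
  exact hn₀.trans (by exact_mod_cast hn)

theorem measurable_firstAbove (l : ℝ) : Measurable fun w => firstAbove (drifted lam nu f w) l := by
  classical
  -- When the level is never exceeded, `firstAbove` is `sInf ∅ = 0` whereas the truncated times tend
  -- to infinity; the indicator reconciles the two.
  refine measurable_of_tendsto_metrizable
    (f := fun (n : ℕ) w => {w | {s | 0 ≤ s ∧ l < drifted lam nu f w s}.Nonempty}.indicator
      (fun w => firstAboveBefore (drifted lam nu f w) l n) w)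
    (fun n => (measurable_firstAboveBefore l n).indicator (measurableSet_above_nonempty l)) ?_
  rw [tendsto_pi_nhds]
  intro w
  by_cases h : {s | 0 ≤ s ∧ l < drifted lam nu f w s}.Nonempty
  · simp only [indicator_of_mem (show w ∈ {w | {s | 0 ≤ s ∧ l < drifted lam nu f w s}.Nonempty}
      from h)]
    exact tendsto_firstAboveBefore h
  · simp only [indicator_of_notMem (show w ∉ {w | {s | 0 ≤ s ∧ l < drifted lam nu f w s}.Nonempty}
      from h)]
    have : firstAbove (drifted lam nu f w) l = 0 := by
      rw [firstAbove, not_nonempty_iff_eq_empty.1 h, Real.sInf_empty]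
    rw [this]
    exact tendsto_const_nhds

end Drifted

/-! ### Limits of square integrable random variables -/

/-- Fatou's lemma transfers the second-moment bound to the limit. Bounded second moments then give
uniform integrability: `|Z - Y|` is at most its truncation at `R`, handled by dominated convergence,
plus `(2 Z² + 2 Y²) / R`, which is small in mean for large `R`. -/
theorem tendsto_integral_of_sq_le {α : Type*} {mα : MeasurableSpace α} {μ : Measure α}
    [IsFiniteMeasure μ] {Z : ℕ → α → ℝ} {Y : α → ℝ} {b : ℕ → ℝ} {c : ℝ}
    (hZ : ∀ n, MemLp (Z n) 2 μ) (hY : AEStronglyMeasurable Y μ)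
    (hlim : ∀ᵐ x ∂μ, Tendsto (fun n => Z n x) atTop (𝓝 (Y x)))
    (hb : ∀ n, ∫ x, Z n x ^ 2 ∂μ ≤ b n) (hc : Tendsto b atTop (𝓝 c)) :
    MemLp Y 2 μ ∧ ∫ x, Y x ^ 2 ∂μ ≤ c ∧ Tendsto (fun n => ∫ x, Z n x ∂μ) atTop (𝓝 (∫ x, Y x ∂μ)) := by
  have hsqZ : ∀ n, Integrable (fun x => Z n x ^ 2) μ := fun n => (hZ n).integrable_sq
  have hc0 : 0 ≤ c := ge_of_tendsto' hc fun n => (integral_nonneg fun x => sq_nonneg _).trans (hb n)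
  have hfatou : ∫⁻ x, ENNReal.ofReal (Y x ^ 2) ∂μ ≤ ENNReal.ofReal c := by
    calc ∫⁻ x, ENNReal.ofReal (Y x ^ 2) ∂μ
        ≤ ∫⁻ x, liminf (fun n => ENNReal.ofReal (Z n x ^ 2)) atTop ∂μ := by
          refine lintegral_mono_ae ?_
          filter_upwards [hlim] with x hx
          exact (((ENNReal.continuous_ofReal.tendsto _).comp (hx.pow 2)).liminf_eq).ge
      _ ≤ liminf (fun n => ∫⁻ x, ENNReal.ofReal (Z n x ^ 2) ∂μ) atTop :=
          lintegral_liminf_le' fun n => (hsqZ n).aestronglyMeasurable.aemeasurable.ennreal_ofReal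
      _ ≤ liminf (fun n => ENNReal.ofReal (b n)) atTop := by
          refine liminf_le_liminf (Eventually.of_forall fun n => ?_)
          rw [← ofReal_integral_eq_lintegral_ofReal (hsqZ n) (ae_of_all _ fun x => sq_nonneg _)]
          exact ENNReal.ofReal_le_ofReal (hb n)
      _ = ENNReal.ofReal c := ((ENNReal.continuous_ofReal.tendsto _).comp hc).liminf_eq
  have hsqY : Integrable (fun x => Y x ^ 2) μ := by
    refine ⟨hY.pow 2, ?_⟩
    rw [hasFiniteIntegral_iff_ofReal (ae_of_all _ fun x => sq_nonneg _)]
    exact hfatou.trans_lt ENNReal.ofReal_lt_top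
  have hYL : MemLp Y 2 μ := (memLp_two_iff_integrable_sq hY).2 hsqY
  have hYc : ∫ x, Y x ^ 2 ∂μ ≤ c := by
    rw [integral_eq_lintegral_of_nonneg_ae (ae_of_all _ fun x => sq_nonneg _) (hY.pow 2)]
    exact ENNReal.toReal_le_of_le_ofReal hc0 hfatou
  refine ⟨hYL, hYc, ?_⟩
  have hZi : ∀ n, Integrable (Z n) μ := fun n => (hZ n).integrable one_le_two
  have hYi : Integrable Y μ := hYL.integrable one_le_two
  rw [Metric.tendsto_atTop']
  intro ε hε
  set R : ℝ := 4 * (2 * (c + 1) + 2 * c + 1) / ε with hR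
  have hR0 : 0 < R := by positivity
  have hmin : Tendsto (fun n => ∫ x, min |Z n x - Y x| R ∂μ) atTop (𝓝 0) := by
    have : Tendsto (fun n => ∫ x, min |Z n x - Y x| R ∂μ) atTop (𝓝 (∫ _x, (0 : ℝ) ∂μ)) := by
      refine tendsto_integral_of_dominated_convergence (fun _ => R)
        (fun n => ((hZi n).sub hYi).abs.aestronglyMeasurable.inf aestronglyMeasurable_const)
        (integrable_const _) (fun n => ae_of_all _ fun x => ?_) ?_
      · rw [Real.norm_eq_abs, abs_of_nonneg (le_min (abs_nonneg _) hR0.le)]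
        exact min_le_right _ _
      · filter_upwards [hlim] with x hx
        have h1 : Tendsto (fun n => |Z n x - Y x|) atTop (𝓝 0) := by
          simpa using (hx.sub_const (Y x)).abs
        simpa [hR0.le] using h1.min (tendsto_const_nhds (x := R))
    simpa using this
  have hbc : ∀ᶠ n in atTop, b n < c + 1 := hc.eventually_lt_const (by linarith)
  obtain ⟨N, hN⟩ := eventually_atTop.1 (hbc.and (hmin.eventually_lt_const (half_pos hε)))
  refine ⟨N, fun n hn => ?_⟩
  obtain ⟨h1, h2⟩ := hN n hn.le
  rw [Real.dist_eq, ← integral_sub (hZi n) hYi]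
  have hmint : Integrable (fun x => min |Z n x - Y x| R) μ :=
    ((hZi n).sub hYi).abs.mono'
      (((hZi n).sub hYi).abs.aestronglyMeasurable.inf aestronglyMeasurable_const)
      (ae_of_all _ fun x => by
        rw [Real.norm_eq_abs, abs_of_nonneg (le_min (abs_nonneg _) hR0.le)]
        exact min_le_left _ _)
  have hq : Integrable (fun x => 2 * Z n x ^ 2 + 2 * Y x ^ 2) μ :=
    ((hsqZ n).const_mul 2).add (hsqY.const_mul 2)
  calc |∫ x, (Z n x - Y x) ∂μ| ≤ ∫ x, |Z n x - Y x| ∂μ := abs_integral_le_integral_abs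
    _ ≤ ∫ x, (min |Z n x - Y x| R + (2 * Z n x ^ 2 + 2 * Y x ^ 2) / R) ∂μ := by
      refine integral_mono ((hZi n).sub hYi).abs
        (hmint.add (hq.div_const R)) fun x => ?_
      change |Z n x - Y x| ≤ min |Z n x - Y x| R + (2 * Z n x ^ 2 + 2 * Y x ^ 2) / R
      rcases le_total |Z n x - Y x| R with h | h
      · rw [min_eq_left h]
        have : 0 ≤ (2 * Z n x ^ 2 + 2 * Y x ^ 2) / R := by positivity
        linarith
      · rw [min_eq_right h]
        have : |Z n x - Y x| ≤ (2 * Z n x ^ 2 + 2 * Y x ^ 2) / R := by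
          rw [le_div_iff₀ hR0]
          have h3 : |Z n x - Y x| * R ≤ |Z n x - Y x| * |Z n x - Y x| := by gcongr
          rw [abs_mul_abs_self] at h3
          nlinarith [sq_nonneg (Z n x + Y x)]
        linarith
    _ = ∫ x, min |Z n x - Y x| R ∂μ + (2 * ∫ x, Z n x ^ 2 ∂μ + 2 * ∫ x, Y x ^ 2 ∂μ) / R := by
      rw [integral_add hmint (hq.div_const R),
        integral_div, integral_add ((hsqZ n).const_mul 2) (hsqY.const_mul 2), integral_const_mul,
        integral_const_mul]
    _ < ε := by
      have h4 : (2 * ∫ x, Z n x ^ 2 ∂μ + 2 * ∫ x, Y x ^ 2 ∂μ) / R ≤ ε / 4 := by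
        rw [div_le_iff₀ hR0, hR]
        have := hb n
        field_simp
        linarith
      linarith

/-! ### Brownian motion on a grid -/

section Grid

variable {μ : Measure C(ℝ≥0, ℝ)}

/-- The σ-algebra generated by the path up to time `r`. -/
@[reducible] def pastSigma (r : ℝ≥0) : MeasurableSpace C(ℝ≥0, ℝ) :=
  MeasurableSpace.comap (fun (w : C(ℝ≥0, ℝ)) (t : Iic r) => w t) MeasurableSpace.pi

theorem measurable_past_eval {r s : ℝ≥0} (h : s ≤ r) :
    Measurable[pastSigma r] fun w : C(ℝ≥0, ℝ) => w s :=
  (measurable_pi_apply (⟨s, h⟩ : Iic r)).comp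
    (comap_measurable fun (w : C(ℝ≥0, ℝ)) (t : Iic r) => w t)

theorem pastSigma_le (r : ℝ≥0) : pastSigma r ≤ (inferInstance : MeasurableSpace C(ℝ≥0, ℝ)) :=
  (measurable_pi_lambda _ fun t : Iic r => measurable_eval_path (t : ℝ≥0)).comap_le

theorem pastSigma_mono {r s : ℝ≥0} (h : r ≤ s) : pastSigma r ≤ pastSigma s := by
  refine measurable_iff_comap_le.1 ?_
  let _ : MeasurableSpace C(ℝ≥0, ℝ) := pastSigma s
  exact measurable_pi_lambda _ fun t => measurable_past_eval (t.2.trans h)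

theorem indepFun_increment (hB : IsPreBrownianReal (fun s (w : C(ℝ≥0, ℝ)) => w s) μ)
    {r s : ℝ≥0} (hrs : r ≤ s) {Y : C(ℝ≥0, ℝ) → ℝ} (hY : Measurable[pastSigma r] Y) :
    IndepFun Y (fun w => w s - w r) μ := by
  have h := hB.indepFun_shift r
  rw [IndepFun_iff_Indep] at h ⊢
  refine indep_of_indep_of_le_left (indep_of_indep_of_le_right h.symm ?_) hY.comap_le
  have heq : (fun w : C(ℝ≥0, ℝ) => w s - w r) =
      (fun x : ℝ≥0 → ℝ => x (s - r)) ∘ fun (w : C(ℝ≥0, ℝ)) t => w (r + t) - w r := by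
    ext w
    simp [add_tsub_cancel_of_le hrs]
  rw [heq, ← MeasurableSpace.comap_comp]
  exact MeasurableSpace.comap_mono (measurable_pi_apply _).comap_le

theorem memLp_increment (hB : IsPreBrownianReal (fun s (w : C(ℝ≥0, ℝ)) => w s) μ) (r s : ℝ≥0) :
    MemLp (fun w : C(ℝ≥0, ℝ) => w s - w r) 2 μ :=
  (hB.hasLaw_sub s r).hasGaussianLaw.memLp_two

theorem integral_increment (hB : IsPreBrownianReal (fun s (w : C(ℝ≥0, ℝ)) => w s) μ) (r s : ℝ≥0) :
    ∫ w, (w s - w r) ∂μ = 0 := by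
  have h := (hB.hasLaw_sub s r).integral_eq
  rw [integral_id_gaussianReal] at h
  exact h

theorem integral_increment_sq (hB : IsPreBrownianReal (fun s (w : C(ℝ≥0, ℝ)) => w s) μ)
    {r s : ℝ≥0} (hrs : r ≤ s) : ∫ w, (w s - w r) ^ 2 ∂μ = s - r := by
  have h := (hB.hasLaw_sub s r).variance_eq
  rw [variance_id_gaussianReal, variance_of_integral_eq_zero] at h
  · have hd : ((nndist s.1 r.1 : ℝ≥0) : ℝ) = s - r := by
      rw [coe_nndist, Real.dist_eq]
      exact abs_of_nonneg (sub_nonneg.2 (by exact_mod_cast hrs))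
    rw [hd] at h
    exact h
  · exact (memLp_increment hB r s).aestronglyMeasurable.aemeasurable
  · exact integral_increment hB r s

/-- The increments of a path over the cells `[r k, r (k+1)]`, summed over those `k < K` for which
the path belongs to `B k`. -/
def gridSum (r : ℕ → ℝ≥0) (B : ℕ → Set C(ℝ≥0, ℝ)) (K : ℕ) (w : C(ℝ≥0, ℝ)) : ℝ :=
  ∑ k ∈ Finset.range K, (B k).indicator (fun w => w (r (k + 1)) - w (r k)) w

variable {r : ℕ → ℝ≥0} {B : ℕ → Set C(ℝ≥0, ℝ)}

theorem measurable_gridSum (hr : Monotone r) (hBm : ∀ k, MeasurableSet[pastSigma (r k)] (B k))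
    (K : ℕ) : Measurable[pastSigma (r K)] (gridSum r B K) := by
  let _ : MeasurableSpace C(ℝ≥0, ℝ) := pastSigma (r K)
  refine Finset.measurable_fun_sum _ fun k hk => ?_
  have hk' : k + 1 ≤ K := Finset.mem_range.1 hk
  exact ((measurable_past_eval (hr hk')).sub (measurable_past_eval (hr (by omega)))).indicator
    (pastSigma_mono (hr (by omega)) _ (hBm k))

/-- A martingale transform: whether cell `k` is counted is known at its left end `r k`, and the
increment over the cell is independent of that past. Hence means and cross terms vanish, and each
counted cell contributes its length to the second moment. -/
theorem gridSum_moments [IsProbabilityMeasure μ]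
    (hB : IsPreBrownianReal (fun s (w : C(ℝ≥0, ℝ)) => w s) μ)
    (hr : Monotone r) (hBm : ∀ k, MeasurableSet[pastSigma (r k)] (B k)) (K : ℕ) :
    MemLp (gridSum r B K) 2 μ ∧ ∫ w, gridSum r B K w ∂μ = 0 ∧
      ∫ w, gridSum r B K w ^ 2 ∂μ =
        ∫ w, ∑ k ∈ Finset.range K, (B k).indicator (fun _ => (r (k + 1) - r k : ℝ)) w ∂μ := by
  have hBm' : ∀ k, MeasurableSet (B k) := fun k => pastSigma_le _ _ (hBm k)
  induction K with
  | zero =>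
    have h0 : gridSum r B 0 = fun _ => 0 := by ext w; simp [gridSum]
    rw [h0]
    exact ⟨memLp_const 0, by simp, by simp⟩
  | succ K ih =>
    obtain ⟨h1, h2, h3⟩ := ih
    set S := gridSum r B K with hS
    set ξ : C(ℝ≥0, ℝ) → ℝ := fun w => w (r (K + 1)) - w (r K) with hξ
    have hξL : MemLp ξ 2 μ := memLp_increment hB _ _
    have hrK : r K ≤ r (K + 1) := hr (Nat.le_succ K)
    have hstep : gridSum r B (K + 1) = fun w => S w + (B K).indicator ξ w := by
      ext w
      rw [gridSum, Finset.sum_range_succ]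
      rfl
    have hindL : MemLp ((B K).indicator ξ) 2 μ := hξL.indicator (hBm' K)
    have hone : Measurable[pastSigma (r K)] ((B K).indicator (fun _ => (1 : ℝ))) := by
      let _ : MeasurableSpace C(ℝ≥0, ℝ) := pastSigma (r K)
      exact measurable_const.indicator (hBm K)
    have hSone : Measurable[pastSigma (r K)] (fun w => S w * (B K).indicator (fun _ => (1 : ℝ)) w) :=
      by
      let _ : MeasurableSpace C(ℝ≥0, ℝ) := pastSigma (r K)
      exact (measurable_gridSum hr hBm K).mul hone
    have hsm : ∀ {Y : C(ℝ≥0, ℝ) → ℝ}, Measurable[pastSigma (r K)] Y → AEStronglyMeasurable Y μ :=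
      fun hY => (hY.mono (pastSigma_le _) le_rfl).aestronglyMeasurable
    have hmean : ∫ w, (B K).indicator ξ w ∂μ = 0 := by
      have := (indepFun_increment hB hrK hone).integral_fun_mul_eq_mul_integral (hsm hone)
        hξL.aestronglyMeasurable
      rw [integral_increment hB, mul_zero] at this
      rw [← this]
      congr 1 with w
      by_cases hw : w ∈ B K <;> simp [hw, hξ]
    have hcross : ∫ w, S w * (B K).indicator ξ w ∂μ = 0 := by
      have := (indepFun_increment hB hrK hSone).integral_fun_mul_eq_mul_integral (hsm hSone)
        hξL.aestronglyMeasurable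
      rw [integral_increment hB, mul_zero] at this
      rw [← this]
      congr 1 with w
      by_cases hw : w ∈ B K <;> simp [hw, hξ]
    have hsq : ∫ w, (B K).indicator ξ w ^ 2 ∂μ =
        ∫ w, (B K).indicator (fun _ => (r (K + 1) - r K : ℝ)) w ∂μ := by
      have hind := (indepFun_increment hB hrK hone).comp measurable_id
        (measurable_id.pow_const 2)
      have := hind.integral_fun_mul_eq_mul_integral (hsm hone)
        (hξL.integrable_sq.aestronglyMeasurable)
      simp only [Function.comp_apply, id] at this
      rw [integral_increment_sq hB hrK] at this
      rw [integral_indicator_const _ (hBm' K), smul_eq_mul]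
      rw [integral_indicator_const _ (hBm' K), smul_eq_mul, mul_one] at this
      rw [← this]
      congr 1 with w
      by_cases hw : w ∈ B K <;> simp [hw, hξ]
    refine ⟨?_, ?_, ?_⟩
    · rw [hstep]
      exact h1.add hindL
    · rw [hstep, integral_add (h1.integrable one_le_two) (hindL.integrable one_le_two), h2, hmean,
        add_zero]
    · have hexp : ∀ w, gridSum r B (K + 1) w ^ 2 =
          S w ^ 2 + 2 * (S w * (B K).indicator ξ w) + (B K).indicator ξ w ^ 2 := by
        intro w
        rw [hstep]
        ring
      have hprod : Integrable (fun w => S w * (B K).indicator ξ w) μ := h1.integrable_mul hindL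
      have hq : Integrable (fun w => S w ^ 2 + 2 * (S w * (B K).indicator ξ w)) μ :=
        h1.integrable_sq.add (hprod.const_mul 2)
      simp_rw [hexp, Finset.sum_range_succ]
      rw [integral_add hq hindL.integrable_sq,
        integral_add h1.integrable_sq (hprod.const_mul 2), integral_const_mul, hcross, mul_zero,
        add_zero, h3, hsq, integral_add]
      · exact integrable_finsetSum _ fun k _ => (integrable_const _).indicator (hBm' k)
      · exact (integrable_const _).indicator (hBm' K)

end Grid

/-! ### Optional stopping at first passage times -/

section OptionalStopping

variable {lam nu : ℝ} {f : ℝ → ℝ} {μ : Measure C(ℝ≥0, ℝ)}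

/-- The paths for which `drifted` stays below the level `l` up to time `t`. -/
def staysBelow (lam nu : ℝ) (f : ℝ → ℝ) (l t : ℝ) : Set C(ℝ≥0, ℝ) :=
  {w | ∀ u ∈ Icc 0 t, drifted lam nu f w u ≤ l}

/-- This is the stopping-time property: since `f` is monotone, `drifted` up to time `t` only reads
the path up to time `f t`, and by continuity countably many times suffice. -/
theorem measurableSet_staysBelow (hf : ContinuousOn f (Ici 0)) (hm : MonotoneOn f (Ici 0))
    (l t : ℝ) : MeasurableSet[pastSigma (f t).toNNReal] (staysBelow lam nu f l t) := by
  let _ : MeasurableSpace C(ℝ≥0, ℝ) := pastSigma (f t).toNNReal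
  obtain ⟨D, hDc, hD⟩ := TopologicalSpace.exists_countable_dense (Icc 0 t)
  have : staysBelow lam nu f l t = ⋂ u ∈ D, {w | drifted lam nu f w u ≤ l} := by
    ext w
    simp only [staysBelow, mem_ofPred_eq, mem_iInter]
    refine ⟨fun h u _ => h u u.2, fun h u hu => ?_⟩
    have hcl : IsClosed {u : Icc 0 t | drifted lam nu f w u ≤ l} :=
      isClosed_le (continuousOn_iff_continuous_domRestrict.1
        ((continuousOn_drifted hf w).mono fun u hu => hu.1)) continuous_const
    have hall := hcl.closure_subset_iff.2 (fun x hx => h x hx)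
    rw [hD.closure_eq] at hall
    exact hall (mem_univ ⟨u, hu⟩)
  rw [this]
  refine MeasurableSet.biInter hDc fun u _ => measurableSet_le ?_ measurable_const
  refine measurable_const.sub ((measurable_past_eval ?_).const_mul nu)
  exact Real.toNNReal_le_toNNReal (hm u.2.1 (u.2.1.trans u.2.2) u.2.2)

theorem sum_range_ite_sub (φ : ℕ → ℝ) {k K : ℕ} (h : k ≤ K) :
    ∑ i ∈ Finset.range K, (if i < k then φ (i + 1) - φ i else 0) = φ k - φ 0 := by
  rw [← Finset.sum_range_sub, ← Finset.sum_filter]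
  congr 1
  ext i
  simp only [Finset.mem_filter, Finset.mem_range]
  omega

/-- `σ` is the first multiple of the mesh at which the path has already exceeded the level, capped
at `N`. The sets `staysBelow` decrease in time, so the cells that are counted are exactly those
before `σ` and the sum telescopes. It is needed for two choices of `φ`: the time-changed path and
`f` itself. -/
theorem exists_grid_time {l N : ℝ} (hN : 0 < N) (w : C(ℝ≥0, ℝ)) (m : ℕ) :
    ∃ σ, firstAboveBefore (drifted lam nu f w) l N ≤ σ ∧
      σ ≤ firstAboveBefore (drifted lam nu f w) l N + N / (m + 1) ∧ σ ≤ N ∧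
      ∀ φ : ℝ → ℝ, ∑ k ∈ Finset.range (m + 1), (staysBelow lam nu f l (k * (N / (m + 1)))).indicator
        (fun _ => φ ((k + 1 : ℕ) * (N / (m + 1))) - φ (k * (N / (m + 1)))) w = φ σ - φ 0 := by
  classical
  set h := N / (m + 1 : ℝ) with hh
  have hh0 : 0 < h := by positivity
  set B : ℕ → Set C(ℝ≥0, ℝ) := fun k => staysBelow lam nu f l (k * h) with hBdef
  have hex : ∃ k, m + 1 ≤ k ∨ w ∉ B k := ⟨m + 1, Or.inl le_rfl⟩
  set k₀ := Nat.find hex with hk₀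
  have hle : k₀ ≤ m + 1 := Nat.find_min' hex (Or.inl le_rfl)
  have hlt : ∀ k < k₀, w ∈ B k := by
    intro k hk
    have := Nat.find_min hex hk
    push Not at this
    exact this.2
  have hanti : ∀ k k', k ≤ k' → w ∈ B k' → w ∈ B k := by
    intro k k' hkk hw u hu
    exact hw u ⟨hu.1, hu.2.trans (by gcongr)⟩
  have hge : ∀ k, k < m + 1 → k₀ ≤ k → w ∉ B k := by
    intro k hk hkk hw
    rcases Nat.find_spec hex with h1 | h1
    · rw [← hk₀] at h1
      omega
    · exact h1 (hanti _ _ hkk hw)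
  have hNh : ((m + 1 : ℕ) : ℝ) * h = N := by
    rw [hh]; push_cast; field_simp
  have hkN : (k₀ : ℝ) * h ≤ N := by
    rw [← hNh]; gcongr
  refine ⟨k₀ * h, ?_, ?_, hkN, fun φ => ?_⟩
  · rcases Nat.find_spec hex with h1 | h1
    · rw [← hk₀] at h1
      have : k₀ = m + 1 := le_antisymm hle h1
      rw [this, hNh]
      exact firstAboveBefore_le
    · rw [← hk₀] at h1
      simp only [hBdef, staysBelow, mem_ofPred_eq, not_forall, not_le] at h1
      obtain ⟨u, hu, hu'⟩ := h1
      exact (firstAboveBefore_le_of_lt hu.1 hu').trans hu.2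
  · rcases Nat.eq_zero_or_pos k₀ with h0 | h0
    · rw [h0, Nat.cast_zero, zero_mul]
      exact add_nonneg (firstAboveBefore_nonneg hN.le) hh0.le
    · obtain ⟨j, hj⟩ : ∃ j, k₀ = j + 1 := ⟨k₀ - 1, by omega⟩
      have hjB := hlt j (by omega)
      have : (j : ℝ) * h ≤ firstAboveBefore (drifted lam nu f w) l N := by
        refine le_firstAboveBefore_iff.2 ⟨?_, fun u hu hu' => hjB u ⟨hu, hu'.le⟩⟩
        refine le_trans ?_ hkN
        gcongr
        omega
      rw [hj]
      push_cast
      linarith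
  · have := sum_range_ite_sub (fun k : ℕ => φ (k * h)) hle
    simp only [Nat.cast_zero, zero_mul] at this
    rw [← this]
    refine Finset.sum_congr rfl fun k hk => ?_
    by_cases hkk : k < k₀
    · rw [if_pos hkk, indicator_of_mem (hlt k hkk)]
    · rw [if_neg hkk, indicator_of_notMem (hge k (Finset.mem_range.1 hk) (not_lt.1 hkk))]

/-- Wald's identities at the truncated first passage time. -/
theorem wald_firstAboveBefore [IsProbabilityMeasure μ]
    (hB : IsPreBrownianReal (fun s (w : C(ℝ≥0, ℝ)) => w s) μ) (hf : ContinuousOn f (Ici 0))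
    (hm : MonotoneOn f (Ici 0)) (hf0 : f 0 = 0) {l N : ℝ} (hN : 0 < N) :
    MemLp (fun w => w (f (firstAboveBefore (drifted lam nu f w) l N)).toNNReal) 2 μ ∧
    ∫ w, w (f (firstAboveBefore (drifted lam nu f w) l N)).toNNReal ∂μ = 0 ∧
    ∫ w, (w (f (firstAboveBefore (drifted lam nu f w) l N)).toNNReal) ^ 2 ∂μ ≤
      ∫ w, f (firstAboveBefore (drifted lam nu f w) l N) ∂μ := by
  set τ : C(ℝ≥0, ℝ) → ℝ := fun w => firstAboveBefore (drifted lam nu f w) l N with hτ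
  have hf_nonneg : ∀ s, 0 ≤ s → 0 ≤ f s := fun s hs => by
    rw [← hf0]; exact hm self_mem_Ici hs hs
  let r : ℕ → ℕ → ℝ≥0 := fun m k => (f (k * (N / (m + 1)))).toNNReal
  let B : ℕ → ℕ → Set C(ℝ≥0, ℝ) := fun m k => staysBelow lam nu f l (k * (N / (m + 1)))
  have hr : ∀ m, Monotone (r m) := by
    intro m k k' hk
    refine Real.toNNReal_le_toNNReal (hm ?_ ?_ ?_)
    · exact mem_Ici.2 (by positivity)
    · exact mem_Ici.2 (by positivity)
    · gcongr
  have hBm : ∀ m k, MeasurableSet[pastSigma (r m k)] (B m k) := fun m k =>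
    measurableSet_staysBelow hf hm l _
  have hBm' : ∀ m k, MeasurableSet (B m k) := fun m k => pastSigma_le _ _ (hBm m k)
  have hmom := fun m => gridSum_moments hB (hr m) (hBm m) (m + 1)
  choose σ hσ1 hσ2 hσN hσ using fun w => exists_grid_time (lam := lam) (nu := nu) (f := f) (l := l)
    hN w
  have hτ0 : ∀ w, 0 ≤ τ w := fun w => firstAboveBefore_nonneg hN.le
  have hσlim : ∀ w, Tendsto (σ w) atTop (𝓝[Ici 0] (τ w)) := by
    intro w
    refine tendsto_nhdsWithin_iff.2 ⟨?_, Eventually.of_forall fun m => (hτ0 w).trans (hσ1 w m)⟩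
    refine tendsto_of_tendsto_of_tendsto_of_le_of_le tendsto_const_nhds ?_ (hσ1 w) (hσ2 w)
    have h1 : Tendsto (fun m : ℕ => N / ((m : ℝ) + 1)) atTop (𝓝 0) :=
      (tendsto_natCast_atTop_atTop.atTop_add tendsto_const_nhds).const_div_atTop N
    simpa using h1.const_add (τ w)
  have hfσ : ∀ w, Tendsto (fun m => f (σ w m)) atTop (𝓝 (f (τ w))) := fun w =>
    (hf (τ w) (hτ0 w)).tendsto.comp (hσlim w)
  have hgrid : ∀ m w, gridSum (r m) (B m) (m + 1) w = w (f (σ w m)).toNNReal - w 0 := by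
    intro m w
    have := hσ w m (fun s => w (f s).toNNReal)
    rw [hf0, Real.toNNReal_zero] at this
    rw [← this]
    refine Finset.sum_congr rfl fun k _ => ?_
    by_cases hk : w ∈ B m k
    · rw [indicator_of_mem hk, indicator_of_mem hk]
    · rw [indicator_of_notMem hk, indicator_of_notMem hk]
  have hgrid2 : ∀ m w, ∑ k ∈ Finset.range (m + 1),
      (B m k).indicator (fun _ => (r m (k + 1) - r m k : ℝ)) w = f (σ w m) := by
    intro m w
    have := hσ w m f
    rw [hf0, sub_zero] at this
    rw [← this]
    refine Finset.sum_congr rfl fun k _ => ?_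
    have e1 : ((r m (k + 1) : ℝ≥0) : ℝ) = f ((k + 1 : ℕ) * (N / (m + 1))) :=
      Real.coe_toNNReal _ (hf_nonneg _ (by positivity))
    have e2 : ((r m k : ℝ≥0) : ℝ) = f (k * (N / (m + 1))) :=
      Real.coe_toNNReal _ (hf_nonneg _ (by positivity))
    rw [e1, e2]
  have hlim : ∀ w, Tendsto (fun m => gridSum (r m) (B m) (m + 1) w) atTop
      (𝓝 (w (f (τ w)).toNNReal - w 0)) := by
    intro w
    simp_rw [hgrid]
    exact ((w.continuous.tendsto _).comp ((continuous_real_toNNReal.tendsto _).comp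
      (hfσ w))).sub_const _
  have hV : Tendsto (fun m => ∫ w, gridSum (r m) (B m) (m + 1) w ^ 2 ∂μ) atTop
      (𝓝 (∫ w, f (τ w) ∂μ)) := by
    simp_rw [fun m => (hmom m).2.2]
    refine tendsto_integral_of_dominated_convergence (fun _ => f N) (fun m => ?_)
      (integrable_const _) (fun m => ae_of_all _ fun w => ?_) (ae_of_all _ fun w => ?_)
    · exact (Finset.measurable_fun_sum _ fun k _ =>
        measurable_const.indicator (hBm' m k)).aestronglyMeasurable
    · have h0 : 0 ≤ σ w m := (hτ0 w).trans (hσ1 w m)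
      rw [hgrid2, Real.norm_eq_abs, abs_of_nonneg (hf_nonneg _ h0)]
      exact hm h0 hN.le (hσN w m)
    · simp_rw [hgrid2]
      exact hfσ w
  have hae0 : ∀ᵐ w ∂μ, (w : C(ℝ≥0, ℝ)) 0 = 0 := hB.eval_zero_ae_eq_zero
  -- The second moment passes to the limit by Fatou, hence only as an inequality; the first moment
  -- passes exactly.
  obtain ⟨h1, h2, h3⟩ := tendsto_integral_of_sq_le (fun m => (hmom m).1)
    (aestronglyMeasurable_of_tendsto_ae atTop (fun m => (hmom m).1.aestronglyMeasurable)
      (ae_of_all _ hlim)) (ae_of_all _ hlim) (fun m => le_rfl) hV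
  simp_rw [fun m => (hmom m).2.1] at h3
  have h4 := tendsto_nhds_unique h3 tendsto_const_nhds
  have hcongr : (fun w : C(ℝ≥0, ℝ) => w (f (τ w)).toNNReal - w 0) =ᵐ[μ]
      fun w => w (f (τ w)).toNNReal := by
    filter_upwards [hae0] with w hw
    rw [hw, sub_zero]
  refine ⟨h1.ae_eq hcongr, ?_, ?_⟩
  · rw [← integral_congr_ae hcongr]
    exact h4
  · refine le_trans (le_of_eq (integral_congr_ae ?_)) h2
    filter_upwards [hcongr] with w hw
    rw [hw]

end OptionalStopping

/-! ### Expected first passage times -/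

section Expectation

variable {lam nu : ℝ} {f : ℝ → ℝ} {μ : Measure C(ℝ≥0, ℝ)}

theorem integrable_firstAboveBefore [IsFiniteMeasure μ] {l N : ℝ} (hN : 0 ≤ N) :
    Integrable (fun w => firstAboveBefore (drifted lam nu f w) l N) μ :=
  Integrable.of_bound (measurable_firstAboveBefore l N).aestronglyMeasurable N
    (ae_of_all _ fun w => by
      rw [Real.norm_eq_abs, abs_of_nonneg (firstAboveBefore_nonneg hN)]
      exact firstAboveBefore_le)

theorem integral_drifted_firstAboveBefore [IsProbabilityMeasure μ]
    (hB : IsPreBrownianReal (fun s (w : C(ℝ≥0, ℝ)) => w s) μ) (hf : ContinuousOn f (Ici 0))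
    (hm : MonotoneOn f (Ici 0)) (hf0 : f 0 = 0) {l N : ℝ} (hN : 0 < N) :
    Integrable (fun w => drifted lam nu f w (firstAboveBefore (drifted lam nu f w) l N)) μ ∧
    ∫ w, drifted lam nu f w (firstAboveBefore (drifted lam nu f w) l N) ∂μ =
      (1 + lam) * ∫ w, firstAboveBefore (drifted lam nu f w) l N ∂μ := by
  obtain ⟨h1, h2, -⟩ := wald_firstAboveBefore (lam := lam) (nu := nu) (l := l) hB hf hm hf0 hN
  have hi1 := (integrable_firstAboveBefore (lam := lam) (nu := nu) (f := f) (μ := μ) (l := l)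
    hN.le).const_mul (1 + lam)
  have hi2 := (h1.integrable one_le_two).const_mul nu
  refine ⟨hi1.sub hi2, ?_⟩
  unfold drifted at *
  rw [integral_sub hi1 hi2, integral_const_mul, integral_const_mul, h2, mul_zero, sub_zero]

/-- At the truncated passage time the path is at most `l`, and by Wald's identity its mean is `1 +
lam` times that of the time. -/
theorem integral_firstAboveBefore_le [IsProbabilityMeasure μ]
    (hB : IsPreBrownianReal (fun s (w : C(ℝ≥0, ℝ)) => w s) μ) (hf : ContinuousOn f (Ici 0))
    (hm : MonotoneOn f (Ici 0)) (hf0 : f 0 = 0) (hlam : 0 ≤ lam) {l N : ℝ} (hl : 0 ≤ l)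
    (hN : 0 < N) : ∫ w, firstAboveBefore (drifted lam nu f w) l N ∂μ ≤ l / (1 + lam) := by
  obtain ⟨h1, h2⟩ := integral_drifted_firstAboveBefore (lam := lam) (nu := nu) (l := l) hB hf hm
    hf0 hN
  rw [le_div_iff₀' (by linarith), ← h2]
  have hae0 : ∀ᵐ w ∂μ, (w : C(ℝ≥0, ℝ)) 0 = 0 := hB.eval_zero_ae_eq_zero
  calc _ ≤ ∫ _w, l ∂μ := by
        refine integral_mono_ae h1 (integrable_const _) ?_
        filter_upwards [hae0] with w hw
        refine apply_firstAboveBefore_le (continuousOn_drifted hf w) ?_ hN.le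
        simpa [drifted, hf0, hw] using hl
    _ = l := by simp

/-- On the event that the level is never exceeded, the truncated time equals its cap, while its mean
stays below `l / (1 + lam)` for every cap. Letting the cap grow forces the event to be null. -/
theorem ae_above_nonempty [IsProbabilityMeasure μ]
    (hB : IsPreBrownianReal (fun s (w : C(ℝ≥0, ℝ)) => w s) μ) (hf : ContinuousOn f (Ici 0))
    (hm : MonotoneOn f (Ici 0)) (hf0 : f 0 = 0) (hlam : 0 ≤ lam) {l : ℝ} (hl : 0 ≤ l) :
    ∀ᵐ w ∂μ, {s | 0 ≤ s ∧ l < drifted lam nu f w s}.Nonempty := by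
  set A : Set C(ℝ≥0, ℝ) := {w | ¬ {s | 0 ≤ s ∧ l < drifted lam nu f w s}.Nonempty} with hA
  have hAm : MeasurableSet A := (measurableSet_above_nonempty l).compl
  have hbound : ∀ n : ℕ, μ.real A ≤ (l / (1 + lam)) / (n + 1) := by
    intro n
    have hn : (0 : ℝ) < n + 1 := by positivity
    rw [le_div_iff₀ hn]
    refine le_trans ?_ (integral_firstAboveBefore_le (nu := nu) hB hf hm hf0 hlam hl hn)
    calc μ.real A * (n + 1) = ∫ w, A.indicator (fun _ => (n + 1 : ℝ)) w ∂μ := by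
          rw [integral_indicator_const _ hAm, smul_eq_mul]
      _ ≤ _ := by
          refine integral_mono ((integrable_const _).indicator hAm)
            (integrable_firstAboveBefore hn.le) fun w => ?_
          by_cases hw : w ∈ A
          · rw [indicator_of_mem hw, firstAboveBefore_of_not_nonempty hw]
          · rw [indicator_of_notMem hw]
            exact firstAboveBefore_nonneg hn.le
  have hlim : Tendsto (fun n : ℕ => (l / (1 + lam)) / ((n : ℝ) + 1)) atTop (𝓝 0) :=
    (tendsto_natCast_atTop_atTop.atTop_add tendsto_const_nhds).const_div_atTop _
  have h0 : μ.real A = 0 := le_antisymm (ge_of_tendsto' hlim hbound) measureReal_nonneg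
  rw [ae_iff]
  exact (measureReal_eq_zero_iff).1 h0

theorem integrable_firstAbove [IsProbabilityMeasure μ]
    (hB : IsPreBrownianReal (fun s (w : C(ℝ≥0, ℝ)) => w s) μ) (hf : ContinuousOn f (Ici 0))
    (hm : MonotoneOn f (Ici 0)) (hf0 : f 0 = 0) (hlam : 0 ≤ lam) {l : ℝ} (hl : 0 ≤ l) :
    Integrable (fun w => firstAbove (drifted lam nu f w) l) μ := by
  refine ⟨(measurable_firstAbove l).aestronglyMeasurable, ?_⟩
  rw [hasFiniteIntegral_iff_ofReal (ae_of_all _ fun w => firstAbove_nonneg)]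
  have hn : ∀ n : ℕ, (0 : ℝ) < (n + 1 : ℕ) := fun n => by positivity
  calc ∫⁻ w, ENNReal.ofReal (firstAbove (drifted lam nu f w) l) ∂μ
      ≤ ∫⁻ w, liminf (fun n : ℕ => ENNReal.ofReal
          (firstAboveBefore (drifted lam nu f w) l (n + 1 : ℕ))) atTop ∂μ := by
        refine lintegral_mono_ae ?_
        filter_upwards [ae_above_nonempty (nu := nu) hB hf hm hf0 hlam hl] with w hw
        exact (((ENNReal.continuous_ofReal.tendsto _).comp
          ((tendsto_firstAboveBefore hw).comp (tendsto_add_atTop_nat 1))).liminf_eq).ge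
    _ ≤ liminf (fun n : ℕ => ∫⁻ w, ENNReal.ofReal
          (firstAboveBefore (drifted lam nu f w) l (n + 1 : ℕ)) ∂μ) atTop :=
        lintegral_liminf_le fun n => (measurable_firstAboveBefore l _).ennreal_ofReal
    _ ≤ liminf (fun _ : ℕ => ENNReal.ofReal (l / (1 + lam))) atTop := by
        refine liminf_le_liminf (Eventually.of_forall fun n => ?_)
        rw [← ofReal_integral_eq_lintegral_ofReal (integrable_firstAboveBefore (hn n).le)
          (ae_of_all _ fun w => firstAboveBefore_nonneg (hn n).le)]
        exact ENNReal.ofReal_le_ofReal (integral_firstAboveBefore_le hB hf hm hf0 hlam hl (hn n))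
    _ = ENNReal.ofReal (l / (1 + lam)) := by simp
    _ < ∞ := ENNReal.ofReal_lt_top

theorem tendsto_integral_firstAboveBefore [IsProbabilityMeasure μ]
    (hB : IsPreBrownianReal (fun s (w : C(ℝ≥0, ℝ)) => w s) μ) (hf : ContinuousOn f (Ici 0))
    (hm : MonotoneOn f (Ici 0)) (hf0 : f 0 = 0) (hlam : 0 ≤ lam) {l : ℝ} (hl : 0 ≤ l) :
    Tendsto (fun n : ℕ => ∫ w, firstAboveBefore (drifted lam nu f w) l (n + 1 : ℕ) ∂μ) atTop
      (𝓝 (∫ w, firstAbove (drifted lam nu f w) l ∂μ)) := by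
  have hne := ae_above_nonempty (nu := nu) hB hf hm hf0 hlam hl
  refine tendsto_integral_of_dominated_convergence _
    (fun n => (measurable_firstAboveBefore l _).aestronglyMeasurable)
    (integrable_firstAbove (nu := nu) hB hf hm hf0 hlam hl) (fun n => ?_) ?_
  · filter_upwards [hne] with w hw
    rw [Real.norm_eq_abs, abs_of_nonneg (firstAboveBefore_nonneg (by positivity)),
      firstAboveBefore_of_nonempty hw]
    exact min_le_right _ _
  · filter_upwards [hne] with w hw
    exact (tendsto_firstAboveBefore hw).comp (tendsto_add_atTop_nat 1)

theorem tendsto_mul_measure_le [IsProbabilityMeasure μ] {Y : C(ℝ≥0, ℝ) → ℝ} (hYm : Measurable Y)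
    (hY : Integrable Y μ) (hY0 : ∀ w, 0 ≤ Y w) :
    Tendsto (fun n : ℕ => ((n + 1 : ℕ) : ℝ) * μ.real {w | ((n + 1 : ℕ) : ℝ) ≤ Y w}) atTop
      (𝓝 0) := by
  have hset : ∀ n : ℕ, MeasurableSet {w | ((n + 1 : ℕ) : ℝ) ≤ Y w} := fun n =>
    measurableSet_le measurable_const hYm
  have heq : ∀ n : ℕ, ((n + 1 : ℕ) : ℝ) * μ.real {w | ((n + 1 : ℕ) : ℝ) ≤ Y w} =
      ∫ w, {w | ((n + 1 : ℕ) : ℝ) ≤ Y w}.indicator (fun _ => ((n + 1 : ℕ) : ℝ)) w ∂μ := fun n => by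
    rw [integral_indicator_const _ (hset n), smul_eq_mul, mul_comm]
  simp_rw [heq]
  have : Tendsto (fun n : ℕ => ∫ w, {w | ((n + 1 : ℕ) : ℝ) ≤ Y w}.indicator
      (fun _ => ((n + 1 : ℕ) : ℝ)) w ∂μ) atTop (𝓝 (∫ _w, (0 : ℝ) ∂μ)) := by
    refine tendsto_integral_of_dominated_convergence Y
      (fun n => (measurable_const.indicator (hset n)).aestronglyMeasurable) hY
      (fun n => ae_of_all _ fun w => ?_) (ae_of_all _ fun w => ?_)
    · by_cases hw : w ∈ {w | ((n + 1 : ℕ) : ℝ) ≤ Y w}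
      · rw [indicator_of_mem hw, Real.norm_eq_abs, abs_of_nonneg (by positivity)]
        exact hw
      · rw [indicator_of_notMem hw, norm_zero]
        exact hY0 w
    · obtain ⟨n₀, hn₀⟩ := exists_nat_gt (Y w)
      refine tendsto_const_nhds.congr' ?_
      filter_upwards [eventually_ge_atTop n₀] with n hn
      rw [indicator_of_notMem]
      simp only [mem_ofPred_eq, not_le]
      refine hn₀.trans_le ?_
      exact_mod_cast hn.trans (Nat.le_succ n)
  simpa using this

/-- If passage occurs before `N`, continuity gives at least `l`. Otherwise the shortfall is at most
`l + |nu * y|`, with `|y| ≤ N / (2δ) + (δ / (2N)) y²`. The weights suit `integral_firstAbove`: the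
first term is integrated over an event whose probability is `o(1/N)`, and the mean of `y²` grows at
most linearly in `N`. -/
theorem le_drifted_firstAboveBefore (hf : ContinuousOn f (Ici 0)) (hlam : 0 ≤ lam) {l N δ : ℝ}
    (hN : 0 < N) (hδ : 0 < δ) {w : C(ℝ≥0, ℝ)}
    (hne : {s | 0 ≤ s ∧ l < drifted lam nu f w s}.Nonempty) :
    l - ({w | N ≤ firstAbove (drifted lam nu f w) l}.indicator
        (fun _ => l + |nu| * (N / (2 * δ))) w +
        |nu| * (δ / (2 * N)) * (w (f (firstAboveBefore (drifted lam nu f w) l N)).toNNReal) ^ 2) ≤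
      drifted lam nu f w (firstAboveBefore (drifted lam nu f w) l N) := by
  set σ := firstAboveBefore (drifted lam nu f w) l N with hσ
  set y := w (f σ).toNNReal with hy
  have hσ0 : 0 ≤ σ := firstAboveBefore_nonneg hN.le
  have hq : 0 ≤ |nu| * (δ / (2 * N)) * y ^ 2 := by positivity
  by_cases hw : w ∈ {w | N ≤ firstAbove (drifted lam nu f w) l}
  · rw [indicator_of_mem hw]
    have h1 : |y| ≤ N / (2 * δ) + δ / (2 * N) * y ^ 2 := by
      rw [← sq_abs y]
      have : 0 ≤ (N - δ * |y|) ^ 2 / (2 * δ * N) := by positivity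
      have h2 : (N - δ * |y|) ^ 2 / (2 * δ * N) =
          N / (2 * δ) + δ / (2 * N) * |y| ^ 2 - |y| := by
        field_simp; ring
      linarith
    have h2 : nu * y ≤ |nu| * |y| := (le_abs_self _).trans (abs_mul nu y).le
    have h3 : |nu| * |y| ≤ |nu| * (N / (2 * δ) + δ / (2 * N) * y ^ 2) := by gcongr
    have h4 : 0 ≤ (1 + lam) * σ := by positivity
    have h5 : drifted lam nu f w σ = (1 + lam) * σ - nu * y := rfl
    rw [h5]
    nlinarith
  · rw [indicator_of_notMem hw]
    have hlt : σ < N := by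
      rw [hσ, firstAboveBefore_of_nonempty hne]
      exact (min_le_right _ _).trans_lt (not_le.1 hw)
    have := le_apply_firstAboveBefore (continuousOn_drifted hf w) hlt
    linarith

/-- The expected first passage time. -/
theorem integral_firstAbove [IsProbabilityMeasure μ]
    (hB : IsPreBrownianReal (fun s (w : C(ℝ≥0, ℝ)) => w s) μ) (hf : ContinuousOn f (Ici 0))
    (hm : MonotoneOn f (Ici 0)) (hf0 : f 0 = 0) {C : ℝ} (hC : ∀ x, 0 ≤ x → f x ≤ C * (1 + x ^ 2))
    (hlam : 0 ≤ lam) {l : ℝ} (hl : 0 ≤ l) :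
    ∫ w, firstAbove (drifted lam nu f w) l ∂μ = l / (1 + lam) := by
  have hlim := tendsto_integral_firstAboveBefore (nu := nu) hB hf hm hf0 hlam hl
  have hn : ∀ n : ℕ, (0 : ℝ) < (n + 1 : ℕ) := fun n => by positivity
  set c := l / (1 + lam) with hc
  have hc0 : 0 ≤ c := by positivity
  have hC0 : 0 ≤ C := by
    have := hC 0 le_rfl
    rw [hf0] at this
    linarith
  refine le_antisymm (le_of_tendsto' hlim fun n =>
    integral_firstAboveBefore_le hB hf hm hf0 hlam hl (hn n)) ?_
  rw [hc, div_le_iff₀' (by linarith)]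
  refine le_of_forall_pos_le_add fun ε hε => ?_
  -- Chosen so that the only error surviving as `N → ∞`, namely `|nu| * (δ / 2) * (C * c)`, is at
  -- most `ε`; the `+ 1` keeps the denominator positive.
  set δ : ℝ := ε / (|nu| * (C * c) / 2 + 1) with hδ
  have hδ0 : 0 < δ := by positivity
  set a : ℕ → ℝ := fun n => μ.real {w | ((n + 1 : ℕ) : ℝ) ≤ firstAbove (drifted lam nu f w) l}
    with ha
  have hNa : Tendsto (fun n : ℕ => ((n + 1 : ℕ) : ℝ) * a n) atTop (𝓝 0) :=
    tendsto_mul_measure_le (measurable_firstAbove l)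
      (integrable_firstAbove (nu := nu) hB hf hm hf0 hlam hl) fun w => firstAbove_nonneg
  have ha0 : Tendsto a atTop (𝓝 0) := by
    refine squeeze_zero (fun n => measureReal_nonneg) (fun n => ?_) hNa
    have h1 : (1 : ℝ) ≤ (n + 1 : ℕ) := by exact_mod_cast Nat.le_add_left 1 n
    have h2 : 0 ≤ a n := measureReal_nonneg
    nlinarith
  have hbound : ∀ n : ℕ, l - (l * a n + |nu| / (2 * δ) * (((n + 1 : ℕ) : ℝ) * a n) +
      |nu| * (δ / 2) * (C / (n + 1 : ℕ) + C * c)) ≤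
      (1 + lam) * ∫ w, firstAboveBefore (drifted lam nu f w) l (n + 1 : ℕ) ∂μ := by
    intro n
    set N : ℝ := ((n + 1 : ℕ) : ℝ) with hN
    have hN0 : 0 < N := hn n
    obtain ⟨w1, -, w3⟩ := wald_firstAboveBefore (lam := lam) (nu := nu) (l := l) hB hf hm hf0 hN0
    obtain ⟨d1, d2⟩ := integral_drifted_firstAboveBefore (lam := lam) (nu := nu) (l := l) hB hf hm
      hf0 hN0
    have hiN := integrable_firstAboveBefore (lam := lam) (nu := nu) (f := f) (l := l) (μ := μ)
      hN0.le
    have hset : MeasurableSet {w | N ≤ firstAbove (drifted lam nu f w) l} :=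
      measurableSet_le measurable_const (measurable_firstAbove l)
    -- Quadratic growth enters here: for the truncated time `σ ≤ N` one has `σ² ≤ N σ`, so the mean
    -- of `f σ` grows only linearly in `N`.
    have hfτ : ∫ w, f (firstAboveBefore (drifted lam nu f w) l N) ∂μ ≤ C * (1 + N * c) := by
      calc _ ≤ ∫ w, C * (1 + N * firstAboveBefore (drifted lam nu f w) l N) ∂μ := by
            refine integral_mono_of_nonneg (ae_of_all _ fun w => ?_)
              (((integrable_const 1).add (hiN.const_mul N)).const_mul C) (ae_of_all _ fun w => ?_)
            · have h0 : 0 ≤ firstAboveBefore (drifted lam nu f w) l N :=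
                firstAboveBefore_nonneg hN0.le
              have := hm self_mem_Ici h0 h0
              rw [hf0] at this
              exact this
            · have h0 : 0 ≤ firstAboveBefore (drifted lam nu f w) l N :=
                firstAboveBefore_nonneg hN0.le
              have h1 : firstAboveBefore (drifted lam nu f w) l N ≤ N := firstAboveBefore_le
              refine (hC _ h0).trans ?_
              change C * (1 + _) ≤ C * (1 + _)
              gcongr
              nlinarith
        _ = C * (1 + N * ∫ w, firstAboveBefore (drifted lam nu f w) l N ∂μ) := by
            rw [integral_const_mul, integral_add (integrable_const 1) (hiN.const_mul N),
              integral_const_mul]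
            simp
        _ ≤ _ := by
            gcongr
            exact integral_firstAboveBefore_le hB hf hm hf0 hlam hl hN0
    have hi1 : Integrable (fun w => {w | N ≤ firstAbove (drifted lam nu f w) l}.indicator
        (fun _ => l + |nu| * (N / (2 * δ))) w) μ := (integrable_const _).indicator hset
    have hi2 : Integrable (fun w => |nu| * (δ / (2 * N)) *
        (w (f (firstAboveBefore (drifted lam nu f w) l N)).toNNReal) ^ 2) μ :=
      w1.integrable_sq.const_mul _
    have hi3 : Integrable (fun w => {w | N ≤ firstAbove (drifted lam nu f w) l}.indicator
        (fun _ => l + |nu| * (N / (2 * δ))) w + |nu| * (δ / (2 * N)) *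
        (w (f (firstAboveBefore (drifted lam nu f w) l N)).toNNReal) ^ 2) μ := hi1.add hi2
    have hmono : ∫ w, (l - ({w | N ≤ firstAbove (drifted lam nu f w) l}.indicator
        (fun _ => l + |nu| * (N / (2 * δ))) w +
        |nu| * (δ / (2 * N)) * (w (f (firstAboveBefore (drifted lam nu f w) l N)).toNNReal) ^ 2)) ∂μ
        ≤ ∫ w, drifted lam nu f w (firstAboveBefore (drifted lam nu f w) l N) ∂μ := by
      refine integral_mono_ae ((integrable_const _).sub hi3) d1 ?_
      filter_upwards [ae_above_nonempty (nu := nu) hB hf hm hf0 hlam hl] with w hw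
      exact le_drifted_firstAboveBefore hf hlam hN0 hδ0 hw
    rw [d2] at hmono
    refine le_trans ?_ hmono
    rw [integral_sub (integrable_const _) hi3, integral_add hi1 hi2,
      integral_indicator_const _ hset, integral_const_mul, smul_eq_mul, integral_const]
    simp only [probReal_univ, smul_eq_mul, one_mul]
    have h5 : |nu| * (δ / (2 * N)) *
        ∫ w, (w (f (firstAboveBefore (drifted lam nu f w) l N)).toNNReal) ^ 2 ∂μ ≤
        |nu| * (δ / (2 * N)) * (C * (1 + N * c)) := by
      gcongr
      exact w3.trans hfτ
    have h6 : |nu| * (δ / (2 * N)) * (C * (1 + N * c)) = |nu| * (δ / 2) * (C / N + C * c) := by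
      field_simp
    have h7 : a n * (l + |nu| * (N / (2 * δ))) = l * a n + |nu| / (2 * δ) * (N * a n) := by
      field_simp
    change l - (l * a n + |nu| / (2 * δ) * (N * a n) + _) ≤ l - (a n * _ + _)
    rw [h7]
    linarith
  have hCn : Tendsto (fun n : ℕ => C / ((n + 1 : ℕ) : ℝ)) atTop (𝓝 0) :=
    (tendsto_natCast_atTop_atTop.comp (tendsto_add_atTop_nat 1)).const_div_atTop C
  have hleft : Tendsto (fun n : ℕ => l - (l * a n + |nu| / (2 * δ) * (((n + 1 : ℕ) : ℝ) * a n) +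
      |nu| * (δ / 2) * (C / (n + 1 : ℕ) + C * c))) atTop
      (𝓝 (l - (l * 0 + |nu| / (2 * δ) * 0 + |nu| * (δ / 2) * (0 + C * c)))) :=
    tendsto_const_nhds.sub (((ha0.const_mul l).add (hNa.const_mul _)).add
      ((hCn.add_const _).const_mul _))
  have hfin := le_of_tendsto_of_tendsto' hleft (hlim.const_mul (1 + lam)) hbound
  have hδε : |nu| * (δ / 2) * (C * c) ≤ ε := by
    have : |nu| * (δ / 2) * (C * c) = ε * ((|nu| * (C * c) / 2) / (|nu| * (C * c) / 2 + 1)) := by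
      rw [hδ]; field_simp
    rw [this]
    have h1 : (|nu| * (C * c) / 2) / (|nu| * (C * c) / 2 + 1) ≤ 1 :=
      (div_le_one (by positivity)).2 (by linarith)
    nlinarith
  rw [zero_add, mul_zero, mul_zero, zero_add, zero_add] at hfin
  linarith

end Expectation

/-! ### Convolution with a non-negative kernel -/

section Kernel

variable {K : ℝ → ℝ}

theorem intervalIntegrable_of_locallyIntegrableOn (hK : LocallyIntegrableOn K (Ici 0)) {a b : ℝ}
    (ha : 0 ≤ a) (hb : 0 ≤ b) : IntervalIntegrable K volume a b := by
  refine (hK.integrableOn_compact_subset ?_ isCompact_uIcc).intervalIntegrable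
  intro x hx
  exact (le_min ha hb).trans hx.1

theorem intervalIntegrable_comp_sub (hK : LocallyIntegrableOn K (Ici 0)) {s t : ℝ}
    (hst : s ≤ t) : IntervalIntegrable (fun u => K (t - u)) volume s t := by
  have h := (intervalIntegrable_of_locallyIntegrableOn hK le_rfl
    (sub_nonneg.2 hst)).comp_sub_left t
  simp only [sub_zero, sub_sub_cancel] at h
  exact h.symm

theorem integral_comp_sub (t e : ℝ) : ∫ u in (t - e)..t, K (t - u) = ∫ u in (0 : ℝ)..e, K u := by
  rw [intervalIntegral.integral_comp_sub_left (fun u => K u) t]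
  simp

theorem integral_kernel_mono (hK : LocallyIntegrableOn K (Ici 0)) (hK0 : ∀ t, 0 ≤ t → 0 ≤ K t)
    {s t : ℝ} (hs : 0 ≤ s) (hst : s ≤ t) : ∫ u in (0 : ℝ)..s, K u ≤ ∫ u in (0 : ℝ)..t, K u := by
  rw [← intervalIntegral.integral_add_adjacent_intervals
    (intervalIntegrable_of_locallyIntegrableOn hK le_rfl hs)
    (intervalIntegrable_of_locallyIntegrableOn hK hs (hs.trans hst))]
  have := intervalIntegral.integral_nonneg (μ := volume) hst fun u hu => hK0 u (hs.trans hu.1)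
  linarith

theorem intervalIntegrable_kernel_mul (hK : LocallyIntegrableOn K (Ici 0)) {t : ℝ} (ht : 0 ≤ t)
    {φ : ℝ → ℝ} (hφ : ContinuousOn φ (Icc 0 t)) :
    IntervalIntegrable (fun u => K (t - u) * φ u) volume 0 t :=
  (intervalIntegrable_comp_sub hK ht).mul_continuousOn (by rwa [uIcc_of_le ht])

/-- Only the window `[t - e, t]` is kept, where monotonicity gives `φ ≥ φ (t - e)`. -/
theorem mul_integral_kernel_le (hK : LocallyIntegrableOn K (Ici 0)) (hK0 : ∀ t, 0 ≤ t → 0 ≤ K t)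
    {t e : ℝ} (he : 0 ≤ e) (het : e ≤ t) {φ : ℝ → ℝ} (hφ : ContinuousOn φ (Icc 0 t))
    (hm : MonotoneOn φ (Icc 0 t)) (h0 : 0 ≤ φ 0) :
    (∫ u in (0 : ℝ)..e, K u) * φ (t - e) ≤ ∫ u in (0 : ℝ)..t, K (t - u) * φ u := by
  have ht : 0 ≤ t := he.trans het
  have hte : 0 ≤ t - e := sub_nonneg.2 het
  have hint := intervalIntegrable_kernel_mul hK ht hφ
  have hi1 : IntervalIntegrable (fun u => K (t - u) * φ u) volume 0 (t - e) :=
    hint.mono_set (by rw [uIcc_of_le hte, uIcc_of_le ht]; exact Icc_subset_Icc_right (by linarith))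
  have hi2 : IntervalIntegrable (fun u => K (t - u) * φ u) volume (t - e) t :=
    hint.mono_set (by
      rw [uIcc_of_le (by linarith), uIcc_of_le ht]; exact Icc_subset_Icc_left hte)
  rw [← intervalIntegral.integral_add_adjacent_intervals hi1 hi2, ← integral_comp_sub t e,
    ← intervalIntegral.integral_mul_const]
  have h1 : 0 ≤ ∫ u in (0 : ℝ)..(t - e), K (t - u) * φ u := by
    refine intervalIntegral.integral_nonneg hte fun u hu => ?_
    have hut : u ≤ t := hu.2.trans (by linarith)
    exact mul_nonneg (hK0 _ (by linarith))
      (h0.trans (hm ⟨le_rfl, ht⟩ ⟨hu.1, hut⟩ hu.1))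
  have h2 : ∫ u in (t - e)..t, K (t - u) * φ (t - e) ≤ ∫ u in (t - e)..t, K (t - u) * φ u := by
    refine intervalIntegral.integral_mono_on (by linarith)
      ((intervalIntegrable_comp_sub hK (by linarith)).mul_const _) hi2 fun u hu => ?_
    exact mul_le_mul_of_nonneg_left (hm ⟨hte, by linarith⟩ ⟨hte.trans hu.1, hu.2⟩ hu.1)
      (hK0 _ (by linarith [hu.2]))
  linarith

/-- If a monotone path solves a Volterra equation whose kernel is close to a unit mass at zero,
then its driver has to reach the level of the input. -/
theorem exists_le_of_volterra (hK : LocallyIntegrableOn K (Ici 0)) (hK0 : ∀ t, 0 ≤ t → 0 ≤ K t)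
    {a b e κ ρ R l lam : ℝ} {k : ℕ} {G x V : ℝ → ℝ} (ha : 0 ≤ a) (he : 0 ≤ e)
    (hkb : a + k * e = b) (hG : MonotoneOn G (Ici 0)) (hx : ContinuousOn x (Icc 0 b))
    (hxm : MonotoneOn x (Icc 0 b)) (hx0 : x 0 = 0) (hV : ContinuousOn V (Icc 0 b))
    (heq : ∀ t ∈ Icc 0 b, x t = G t + ∫ s in (0 : ℝ)..t, K (t - s) * (-lam * x s + V s))
    (hxR : x b ≤ R) (hl : 0 ≤ l) (hκ0 : 0 ≤ κ) (hκe : 1 - κ ≤ ∫ u in (0 : ℝ)..e, K u)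
    (hκb : ∫ u in (0 : ℝ)..b, K u ≤ 1 + κ) (hρ : κ * (R + l) + ρ ≤ G a - l) (hkR : R < k * ρ) :
    ∃ s ∈ Icc 0 b, l ≤ (1 + lam) * x s - V s := by
  -- If the driver stayed below `l`, then `-lam * x + V > x - l` throughout, so the equation gives
  -- `x t ≥ G a + (1 - κ) * x (t - e) - (1 + κ) * l ≥ x (t - e) + ρ` for `t ≥ a + e`. Going from `a`
  -- to `b` in `k` steps yields `x b ≥ k * ρ > R`, a contradiction.
  by_contra! hcon
  have hab : a ≤ b := by rw [← hkb]; have : 0 ≤ (k : ℝ) * e := by positivity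
                         linarith
  have hxnn : ∀ t ∈ Icc 0 b, 0 ≤ x t := fun t ht => by
    rw [← hx0]; exact hxm ⟨le_rfl, ht.1.trans ht.2⟩ ht ht.1
  have hstep : ∀ t, a + e ≤ t → t ≤ b → x (t - e) + ρ ≤ x t := by
    intro t hta htb
    have ht0 : 0 ≤ t := by linarith
    have hsub : Icc 0 t ⊆ Icc 0 b := Icc_subset_Icc_right htb
    have hxt := hx.mono hsub
    have h1 := mul_integral_kernel_le hK hK0 he (by linarith : e ≤ t) hxt (hxm.mono hsub) hx0.ge
    have h2 : ∫ s in (0 : ℝ)..t, K (t - s) * (x s - l) ≤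
        ∫ s in (0 : ℝ)..t, K (t - s) * (-lam * x s + V s) := by
      refine intervalIntegral.integral_mono_on ht0
        (intervalIntegrable_kernel_mul hK ht0 (hxt.sub continuousOn_const))
        (intervalIntegrable_kernel_mul hK ht0
          ((continuousOn_const.mul hxt).add (hV.mono hsub))) fun s hs => ?_
      refine mul_le_mul_of_nonneg_left ?_ (hK0 _ (by linarith [hs.2]))
      have := hcon s (hsub hs)
      linarith
    have h3 : ∫ s in (0 : ℝ)..t, K (t - s) * (x s - l) =
        (∫ s in (0 : ℝ)..t, K (t - s) * x s) - (∫ s in (0 : ℝ)..t, K s) * l := by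
      simp_rw [mul_sub]
      rw [intervalIntegral.integral_sub (intervalIntegrable_kernel_mul hK ht0 hxt)
        ((intervalIntegrable_comp_sub hK ht0).mul_const l),
        intervalIntegral.integral_mul_const]
      have := integral_comp_sub (K := K) t t
      rw [sub_self] at this
      rw [this]
    have h4 := heq t ⟨ht0, htb⟩
    have h5 : G a ≤ G t := hG ha ht0 (by linarith)
    have h6 := integral_kernel_mono hK hK0 ht0 htb
    have hte : t - e ∈ Icc 0 b := ⟨by linarith, by linarith⟩
    have h7 := hxnn _ hte
    have h8 : x (t - e) ≤ R := (hxm hte ⟨by linarith, le_rfl⟩ hte.2).trans hxR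
    have h9 : (1 - κ) * x (t - e) ≤ (∫ u in (0 : ℝ)..e, K u) * x (t - e) := by gcongr
    have h10 : (∫ s in (0 : ℝ)..t, K s) * l ≤ (1 + κ) * l := by gcongr; linarith
    have h11 : κ * x (t - e) ≤ κ * R := by gcongr
    nlinarith
  have hind : ∀ j : ℕ, j ≤ k → j * ρ ≤ x (a + j * e) := by
    intro j
    induction j with
    | zero => intro _; simpa using hxnn a ⟨ha, hab⟩
    | succ j ih =>
      intro hj
      have h1 := ih (by omega)
      have hje : (0 : ℝ) ≤ j * e := by positivity
      have h2 := hstep (a + (j + 1 : ℕ) * e) (by push_cast; linarith) (by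
        rw [← hkb]; gcongr)
      have h3 : a + (j + 1 : ℕ) * e - e = a + j * e := by push_cast; ring
      rw [h3] at h2
      push_cast at h2 ⊢
      linarith
  have := hind k le_rfl
  rw [hkb] at this
  linarith

/-- The mass of an approximation of the unit mass at zero concentrates near zero. -/
theorem tendsto_integral_kernel {T : ℝ} {Kn : ℕ → ℝ → ℝ}
    (hK0 : ∀ n t, 0 ≤ t → 0 ≤ Kn n t) (hK : ∀ n, LocallyIntegrableOn (Kn n) (Ici 0))
    (hlim : ∀ φ : ℝ → ℝ, ContinuousOn φ (Icc 0 T) →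
      Tendsto (fun n => ∫ t in (0 : ℝ)..T, φ t * Kn n t) atTop (𝓝 (φ 0)))
    {u : ℝ} (hu : 0 < u) (huT : u ≤ T) :
    Tendsto (fun n => ∫ t in (0 : ℝ)..u, Kn n t) atTop (𝓝 1) := by
  have h1 := hlim (fun _ => 1) continuousOn_const
  simp only [one_mul] at h1
  -- The indicator of `[0, u]` is not continuous; it is squeezed between this tent, equal to `1` at
  -- `0`, and the constant `1`.
  have hc : Continuous fun t : ℝ => max 0 (1 - t / u) := by fun_prop
  have h2 := hlim (fun t => max 0 (1 - t / u)) hc.continuousOn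
  simp only [zero_div, sub_zero, max_eq_right zero_le_one] at h2
  refine tendsto_of_tendsto_of_tendsto_of_le_of_le h2 h1 (fun n => ?_)
    (fun n => integral_kernel_mono (hK n) (hK0 n) hu.le huT)
  have hi : ∀ a b, 0 ≤ a → 0 ≤ b →
      IntervalIntegrable (fun t => max 0 (1 - t / u) * Kn n t) volume a b := fun a b ha hb =>
    (intervalIntegrable_of_locallyIntegrableOn (hK n) ha hb).continuousOn_mul hc.continuousOn
  change ∫ t in (0 : ℝ)..T, max 0 (1 - t / u) * Kn n t ≤ _
  rw [← intervalIntegral.integral_add_adjacent_intervals (hi 0 u le_rfl hu.le)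
    (hi u T hu.le (hu.le.trans huT))]
  have h3 : ∫ t in u..T, max 0 (1 - t / u) * Kn n t = 0 := by
    have : ∫ t in u..T, max 0 (1 - t / u) * Kn n t = ∫ _t in u..T, (0 : ℝ) := by
      refine intervalIntegral.integral_congr fun t ht => ?_
      rw [uIcc_of_le huT] at ht
      have : 1 ≤ t / u := (one_le_div hu).2 ht.1
      simp only [max_eq_left (by linarith : 1 - t / u ≤ 0), zero_mul]
    rw [this, intervalIntegral.integral_zero]
  rw [h3, add_zero]
  refine intervalIntegral.integral_mono_on hu.le (hi 0 u le_rfl hu.le)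
    (intervalIntegrable_of_locallyIntegrableOn (hK n) le_rfl hu.le) fun t ht => ?_
  have h4 : max 0 (1 - t / u) ≤ 1 := max_le zero_le_one (by
    have : 0 ≤ t / u := div_nonneg ht.1 hu.le
    linarith)
  have h5 := hK0 n t ht.1
  nlinarith

end Kernel

/-! ### Moments of weak solutions -/

section WeakSolution

variable {Ω : Type*} {mΩ : MeasurableSpace Ω} {T : ℝ} {G K f : ℝ → ℝ} {lam nu : ℝ}
  {𝒢 : Filtration ℝ≥0 mΩ} {P : Measure Ω} {W : ℝ≥0 → Ω → ℝ} {X : ℝ → Ω → ℝ}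

namespace IsWeakSolution

variable (h : IsWeakSolution T G K f lam nu 𝒢 P W X)

include h

theorem clock_nonneg {t : ℝ} (ht : t ∈ Icc 0 T) (ω : Ω) : 0 ≤ X t ω := by
  rw [← h.clock_zero ω]
  exact h.monotone_clock ω ⟨le_rfl, ht.1.trans ht.2⟩ ht ht.1

theorem continuousOn_timeChanged (hf : IsTimeChange f) (ω : Ω) :
    ContinuousOn (fun t => timeChanged f W X t ω) (Icc 0 T) :=
  ((h.brownian.continuous_path ω).comp continuous_real_toNNReal).comp_continuousOn
    (hf.contDiff.continuousOn.comp (h.continuous_clock ω) fun _ ht => h.clock_nonneg ht ω)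

theorem martingale_moments [IsProbabilityMeasure P] (hf : IsTimeChange f) {t : ℝ}
    (ht : t ∈ Icc 0 T) :
    StronglyMeasurable (timeChanged f W X t) ∧ Integrable (timeChanged f W X t) P ∧
      ∫ ω, timeChanged f W X t ω ∂P = 0 ∧
      ∫ ω, |timeChanged f W X t ω| ∂P ≤ ∫ ω, |timeChanged f W X T ω| ∂P := by
  obtain ⟨hM, hmart⟩ := h.martingale
  have hT : 0 ≤ T := ht.1.trans ht.2
  refine ⟨hM ⟨t, ht⟩, hmart.integrable ⟨t, ht⟩, ?_, ?_⟩
  · have h1 := hmart.condExp_ae_eq (show (⟨0, le_rfl, hT⟩ : Icc (0 : ℝ) T) ≤ ⟨t, ht⟩ from ht.1)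
    have h2 := integral_congr_ae h1
    rw [integral_condExp] at h2
    rw [h2]
    have h3 : ∀ᵐ ω ∂P, W 0 ω = 0 := h.brownian.brownian.eval_zero_ae_eq_zero
    refine integral_eq_zero_of_ae ?_
    filter_upwards [h3] with ω hω
    simp [timeChanged, h.clock_zero ω, hf.zero, hω]
  · have h1 := hmart.condExp_ae_eq (show (⟨t, ht⟩ : Icc (0 : ℝ) T) ≤ ⟨T, hT, le_rfl⟩ from ht.2)
    have h2 : (fun ω => |timeChanged f W X t ω|) =ᵐ[P] _ := h1.symm.fun_comp (fun x => |x|)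
    rw [integral_congr_ae h2]
    exact integral_abs_condExp_le _

theorem integral_convolution [IsProbabilityMeasure P] (hf : IsTimeChange f)
    (hK : LocallyIntegrableOn K (Ici 0)) {t : ℝ} (ht : t ∈ Icc 0 T) :
    Integrable (fun ω => ∫ s in (0 : ℝ)..t, K (t - s) * timeChanged f W X s ω) P ∧
      ∫ ω, (∫ s in (0 : ℝ)..t, K (t - s) * timeChanged f W X s ω) ∂P = 0 := by
  have hT : 0 ≤ T := ht.1.trans ht.2
  -- Freezing time outside `[0, T]` makes all paths continuous on `ℝ`, which yields joint
  -- measurability.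
  set V : ℝ → Ω → ℝ := fun s ω => timeChanged f W X (projIcc 0 T hT s) ω with hV
  have hVm : Measurable (Function.uncurry V) := by
    refine measurable_uncurry_of_continuous_of_measurable (fun ω => ?_) (fun s => ?_)
    · exact (continuousOn_iff_continuous_domRestrict.1 (h.continuousOn_timeChanged hf ω)).comp
        continuous_projIcc
    · exact (h.martingale_moments hf (projIcc 0 T hT s).2).1.measurable
  have hVeq : ∀ s ∈ Icc 0 T, V s = timeChanged f W X s := by
    intro s hs
    simp only [hV, projIcc_of_mem hT hs]
  have hKi := (intervalIntegrable_comp_sub hK ht.1).1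
  have hprod : Integrable (Function.uncurry fun s ω => K (t - s) * V s ω)
      ((volume.restrict (Ioc 0 t)).prod P) := by
    have hmeas : AEStronglyMeasurable (Function.uncurry fun s ω => K (t - s) * V s ω)
        ((volume.restrict (Ioc 0 t)).prod P) :=
      (hKi.aestronglyMeasurable.comp_fst).mul hVm.aestronglyMeasurable
    rw [integrable_prod_iff hmeas]
    refine ⟨ae_of_all _ fun s =>
      (h.martingale_moments hf (projIcc 0 T hT s).2).2.1.const_mul (K (t - s)), ?_⟩
    refine (hKi.norm.mul_const (∫ ω, |timeChanged f W X T ω| ∂P)).mono'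
      hmeas.norm.integral_prod_right' (ae_of_all _ fun s => ?_)
    rw [Real.norm_eq_abs, abs_of_nonneg (integral_nonneg fun ω => norm_nonneg _)]
    simp only [Function.uncurry_apply_pair, norm_mul]
    rw [integral_const_mul]
    exact mul_le_mul_of_nonneg_left (h.martingale_moments hf (projIcc 0 T hT s).2).2.2.2
      (norm_nonneg _)
  have hcongr : ∀ ω, ∫ s in (0 : ℝ)..t, K (t - s) * timeChanged f W X s ω =
      ∫ s in Ioc 0 t, K (t - s) * V s ω := by
    intro ω
    rw [intervalIntegral.integral_of_le ht.1]
    refine setIntegral_congr_fun measurableSet_Ioc fun s hs => ?_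
    simp only [hVeq s ⟨hs.1.le, hs.2.trans ht.2⟩]
  simp_rw [hcongr]
  refine ⟨hprod.integral_prod_right, ?_⟩
  rw [← integral_integral_swap hprod]
  refine integral_eq_zero_of_ae (ae_of_all _ fun s => ?_)
  simp only [Pi.zero_apply]
  rw [integral_const_mul, (h.martingale_moments hf (projIcc 0 T hT s).2).2.2.1, mul_zero]

/-- The mean-reversion term is bounded by its part over the last window of length `e`. The case `e =
0` drops it altogether; a positive `e` keeps enough of it to produce the factor `1 / (1 + lam)` in
the limit. -/
theorem clock_le [IsProbabilityMeasure P] (hf : IsTimeChange f)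
    (hK : LocallyIntegrableOn K (Ici 0)) (hK0 : ∀ t, 0 ≤ t → 0 ≤ K t) (hlam : 0 ≤ lam) {t e : ℝ}
    (ht : t ∈ Icc 0 T) (he : 0 ≤ e) (het : e ≤ t) :
    ∀ᵐ ω ∂P, X t ω + lam * ((∫ u in (0 : ℝ)..e, K u) * X (t - e) ω) ≤
      G t + nu * ∫ s in (0 : ℝ)..t, K (t - s) * timeChanged f W X s ω := by
  filter_upwards [h.equation] with ω hω
  have hsub : Icc 0 t ⊆ Icc 0 T := Icc_subset_Icc_right ht.2
  have hxt := (h.continuous_clock ω).mono hsub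
  have hvt := (h.continuousOn_timeChanged hf ω).mono hsub
  have h1 := mul_integral_kernel_le hK hK0 he het hxt ((h.monotone_clock ω).mono hsub)
    (h.clock_zero ω).ge
  have h2 : ∫ s in (0 : ℝ)..t, K (t - s) * (-lam * X s ω + nu * timeChanged f W X s ω) =
      -lam * (∫ s in (0 : ℝ)..t, K (t - s) * X s ω) +
        nu * ∫ s in (0 : ℝ)..t, K (t - s) * timeChanged f W X s ω := by
    rw [← intervalIntegral.integral_const_mul, ← intervalIntegral.integral_const_mul,
      ← intervalIntegral.integral_add ((intervalIntegrable_kernel_mul hK ht.1 hxt).const_mul _)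
        ((intervalIntegrable_kernel_mul hK ht.1 hvt).const_mul _)]
    congr 1 with s
    ring
  rw [hω t ht, h2]
  have h3 := mul_le_mul_of_nonneg_left h1 hlam
  linarith

theorem integrable_clock [IsProbabilityMeasure P] (hf : IsTimeChange f)
    (hK : LocallyIntegrableOn K (Ici 0)) (hK0 : ∀ t, 0 ≤ t → 0 ≤ K t) (hlam : 0 ≤ lam) {t : ℝ}
    (ht : t ∈ Icc 0 T) : Integrable (X t) P := by
  refine ((integrable_const (G t)).add ((h.integral_convolution hf hK ht).1.const_mul nu)).mono'
    (h.measurable_clock t ht).aestronglyMeasurable ?_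
  filter_upwards [h.clock_le hf hK hK0 hlam ht le_rfl ht.1] with ω hω
  rw [Real.norm_eq_abs, abs_of_nonneg (h.clock_nonneg ht ω)]
  simpa using hω

theorem integral_clock_add_le [IsProbabilityMeasure P] (hf : IsTimeChange f)
    (hK : LocallyIntegrableOn K (Ici 0)) (hK0 : ∀ t, 0 ≤ t → 0 ≤ K t) (hlam : 0 ≤ lam) {t e : ℝ}
    (ht : t ∈ Icc 0 T) (he : 0 ≤ e) (het : e ≤ t) :
    ∫ ω, X t ω ∂P + lam * ((∫ u in (0 : ℝ)..e, K u) * ∫ ω, X (t - e) ω ∂P) ≤ G t := by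
  have hte : t - e ∈ Icc 0 T := ⟨by linarith, by linarith [ht.2]⟩
  obtain ⟨h1, h2⟩ := h.integral_convolution hf hK ht
  have hi1 := h.integrable_clock hf hK hK0 hlam ht
  have hi2 := h.integrable_clock hf hK hK0 hlam hte
  have h3 := integral_mono_ae (hi1.add ((hi2.const_mul _).const_mul lam))
    ((integrable_const (G t)).add (h1.const_mul nu)) (h.clock_le hf hK hK0 hlam ht he het)
  simp only [Pi.add_apply] at h3
  rw [integral_add (integrable_const _) (h1.const_mul nu), integral_const_mul, h2] at h3
  rw [integral_add hi1 ((hi2.const_mul _).const_mul lam), integral_const_mul,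
    integral_const_mul] at h3
  simpa using h3

end IsWeakSolution

end WeakSolution

/-! ### Convergence of the clocks -/

section Asymptotics

theorem tendsto_drifted {lamn nun : ℕ → ℝ} {fn : ℕ → ℝ → ℝ} {lam nu : ℝ} {f : ℝ → ℝ}
    (hfn : ∀ n, ContinuousOn (fn n) (Ici 0)) (hf : ContinuousOn f (Ici 0))
    (hf_lim : TendstoLocallyUniformlyOn fn f atTop (Ici 0))
    (hlam_lim : Tendsto lamn atTop (𝓝 lam)) (hnu_lim : Tendsto nun atTop (𝓝 nu))
    (w : C(ℝ≥0, ℝ)) (R : ℝ) {η : ℝ} (hη : 0 < η) :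
    ∀ᶠ n in atTop, ∀ x ∈ Icc 0 R,
      |drifted (lamn n) (nun n) (fn n) w x - drifted lam nu f w x| ≤ η := by
  have hsub : Icc 0 R ⊆ Ici 0 := fun x hx => hx.1
  let F : ℕ → C(Icc 0 R, ℝ) := fun n =>
    ⟨_, continuousOn_iff_continuous_domRestrict.1 ((hfn n).mono hsub)⟩
  let F' : C(Icc 0 R, ℝ) := ⟨_, continuousOn_iff_continuous_domRestrict.1 (hf.mono hsub)⟩
  let I : C(Icc 0 R, ℝ) := ⟨_, continuous_subtype_val⟩
  let w' : C(ℝ, ℝ) := w.comp ⟨_, continuous_real_toNNReal⟩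
  have hF : Tendsto F atTop (𝓝 F') := by
    rw [ContinuousMap.tendsto_iff_tendstoUniformly]
    have h1 := (tendstoLocallyUniformlyOn_iff_tendstoUniformlyOn_of_compact isCompact_Icc).1
      (hf_lim.mono hsub)
    exact tendstoUniformlyOn_iff_tendstoUniformly_comp_coe.1 h1
  have hD : Tendsto (fun n => (1 + lamn n) • I - nun n • w'.comp (F n)) atTop
      (𝓝 ((1 + lam) • I - nu • w'.comp F')) :=
    ((hlam_lim.const_add 1).smul_const I).sub
      (hnu_lim.smul (((ContinuousMap.continuous_postcomp w').tendsto F').comp hF))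
  filter_upwards [Metric.tendsto_nhds.1 hD η hη] with n hn x hx
  exact ((ContinuousMap.dist_apply_le_dist (⟨x, hx⟩ : Icc 0 R)).trans hn.le)

theorem tendsto_measure_zero_of_eventually_notMem {α : Type*} {mα : MeasurableSpace α}
    {μ : Measure α} [IsFiniteMeasure μ] {A : ℕ → Set α} (hA : ∀ n, MeasurableSet (A n))
    (h : ∀ x, ∀ᶠ n in atTop, x ∉ A n) : Tendsto (fun n => μ.real (A n)) atTop (𝓝 0) := by
  have heq : ∀ n, μ.real (A n) = ∫ x, (A n).indicator (fun _ => (1 : ℝ)) x ∂μ := fun n => by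
    rw [integral_indicator_const _ (hA n), smul_eq_mul, mul_one]
  simp_rw [heq]
  have : Tendsto (fun n => ∫ x, (A n).indicator (fun _ => (1 : ℝ)) x ∂μ) atTop
      (𝓝 (∫ _x, (0 : ℝ) ∂μ)) := by
    refine tendsto_integral_of_dominated_convergence (fun _ => 1)
      (fun n => (measurable_const.indicator (hA n)).aestronglyMeasurable) (integrable_const _)
      (fun n => ae_of_all _ fun x => ?_) (ae_of_all _ fun x => ?_)
    · by_cases hx : x ∈ A n <;> simp [hx]
    · refine tendsto_const_nhds.congr' ?_
      filter_upwards [h x] with n hn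
      rw [indicator_of_notMem hn]
  simpa using this

theorem tendsto_zero_of_eventually_le {u : ℕ → ℝ} (hu : ∀ n, 0 ≤ u n) (c : ℝ) (hc : 0 < c)
    (h : ∀ δ > 0, ∀ᶠ n in atTop, u n ≤ c * δ) : Tendsto u atTop (𝓝 0) := by
  rw [Metric.tendsto_nhds]
  intro ε hε
  filter_upwards [h (ε / (2 * c)) (by positivity)] with n hn
  rw [Real.dist_eq, sub_zero, abs_of_nonneg (hu n)]
  have : c * (ε / (2 * c)) = ε / 2 := by field_simp
  linarith

theorem tendsto_measure_drifted {lamn nun : ℕ → ℝ} {fn : ℕ → ℝ → ℝ} {lam nu : ℝ} {f : ℝ → ℝ}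
    {μ : Measure C(ℝ≥0, ℝ)} [IsProbabilityMeasure μ]
    (hfn : ∀ n, ContinuousOn (fn n) (Ici 0)) (hf : ContinuousOn f (Ici 0))
    (hf_lim : TendstoLocallyUniformlyOn fn f atTop (Ici 0))
    (hlam_lim : Tendsto lamn atTop (𝓝 lam)) (hnu_lim : Tendsto nun atTop (𝓝 nu))
    (R : ℝ) {η : ℝ} (hη : 0 < η) :
    (∀ n, MeasurableSet {w | ∃ x ∈ Icc 0 R,
      η < |drifted (lamn n) (nun n) (fn n) w x - drifted lam nu f w x|}) ∧
    Tendsto (fun n => μ.real {w | ∃ x ∈ Icc 0 R,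
      η < |drifted (lamn n) (nun n) (fn n) w x - drifted lam nu f w x|}) atTop (𝓝 0) := by
  have hm : ∀ n, MeasurableSet {w | ∃ x ∈ Icc 0 R,
      η < |drifted (lamn n) (nun n) (fn n) w x - drifted lam nu f w x|} := by
    intro n
    have : {w | ∃ x ∈ Icc 0 R, η < |drifted (lamn n) (nun n) (fn n) w x - drifted lam nu f w x|} =
        ⋃ x ∈ Icc 0 R, {w | η < |drifted (lamn n) (nun n) (fn n) w x - drifted lam nu f w x|} := by
      ext w
      simp
    rw [this]
    exact (isOpen_biUnion fun x _ => isOpen_lt continuous_const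
      ((continuous_drifted_left x).sub (continuous_drifted_left x)).abs).measurableSet
  refine ⟨hm, tendsto_measure_zero_of_eventually_notMem hm fun w => ?_⟩
  filter_upwards [tendsto_drifted hfn hf hf_lim hlam_lim hnu_lim w R hη] with n hn
  rintro ⟨x, hx, hlt⟩
  exact absurd (hn x hx) (not_le.2 hlt)

variable {T : ℝ} {Ω : ℕ → Type*} {mΩ : ∀ n, MeasurableSpace (Ω n)}
  {P : ∀ n, Measure (Ω n)} [∀ n, IsProbabilityMeasure (P n)] {𝒢 : ∀ n, Filtration ℝ≥0 (mΩ n)}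
  {W : ∀ n, ℝ≥0 → Ω n → ℝ} {X : ∀ n, ℝ → Ω n → ℝ} {G₀n Kn fn : ℕ → ℝ → ℝ} {lamn nun : ℕ → ℝ}
  {G₀ f : ℝ → ℝ} {lam nu : ℝ} {μ : Measure C(ℝ≥0, ℝ)} [IsProbabilityMeasure μ]
  {w : ∀ n, Ω n → C(ℝ≥0, ℝ)} {C : ℝ}
  (hlam_nonneg : ∀ n, 0 ≤ lamn n)
  (hfn : ∀ n, IsTimeChange (fn n))
  (hK_nonneg : ∀ n t, 0 ≤ t → 0 ≤ Kn n t)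
  (hK_loc : ∀ n, LocallyIntegrableOn (Kn n) (Ici 0))
  (hG_mono : ∀ n, MonotoneOn (G₀n n) (Ici 0)) (hG_zero : ∀ n, G₀n n 0 = 0)
  (hsol : ∀ n, IsWeakSolution T (G₀n n) (Kn n) (fn n) (lamn n) (nun n) (𝒢 n) (P n) (W n) (X n))
  (hK_lim : ∀ φ : ℝ → ℝ, ContinuousOn φ (Icc 0 T) →
    Tendsto (fun n => ∫ t in (0 : ℝ)..T, φ t * Kn n t) atTop (𝓝 (φ 0)))
  (hG_lim : ∀ t ∈ Icc 0 T, Tendsto (fun n => G₀n n t) atTop (𝓝 (G₀ t)))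
  (hG_cont : ContinuousOn G₀ (Icc 0 T))
  (hf_lim : TendstoLocallyUniformlyOn fn f atTop (Ici 0))
  (hlam_lim : Tendsto lamn atTop (𝓝 lam)) (hnu_lim : Tendsto nun atTop (𝓝 nu))
  (hf : ContinuousOn f (Ici 0)) (hfm : MonotoneOn f (Ici 0)) (hf0 : f 0 = 0)
  (hC : ∀ x, 0 ≤ x → f x ≤ C * (1 + x ^ 2))
  (hμ : IsPreBrownianReal (fun s (w : C(ℝ≥0, ℝ)) => w s) μ)
  (hw : ∀ n, Measurable (w n)) (hwW : ∀ n ω s, w n ω s = W n s ω)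
  (hlaw : ∀ n, (P n).map (w n) = μ)

include hG_mono hG_lim in
theorem limit_input_mono : MonotoneOn G₀ (Icc 0 T) := fun s hs t ht hst =>
  le_of_tendsto_of_tendsto' (hG_lim s hs) (hG_lim t ht) fun n => hG_mono n hs.1 ht.1 hst

include hG_mono hG_zero hG_lim in
theorem limit_input_nonneg {t : ℝ} (ht : t ∈ Icc 0 T) : 0 ≤ G₀ t :=
  ge_of_tendsto' (hG_lim t ht) fun n => by
    rw [← hG_zero n]; exact hG_mono n self_mem_Ici ht.1 ht.1

include hG_zero hG_lim in
theorem limit_input_zero (hT : 0 ≤ T) : G₀ 0 = 0 :=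
  tendsto_nhds_unique (hG_lim 0 ⟨le_rfl, hT⟩) (by simp_rw [hG_zero]; exact tendsto_const_nhds)

include hlam_nonneg hlam_lim in
theorem limit_lam_nonneg : 0 ≤ lam := ge_of_tendsto' hlam_lim hlam_nonneg

omit [∀ n, IsProbabilityMeasure (P n)] [IsProbabilityMeasure μ] in
include hw hlaw in
theorem measureReal_path_mem (n : ℕ) {A : Set C(ℝ≥0, ℝ)} (hA : MeasurableSet A) :
    (P n).real {ω | w n ω ∈ A} = μ.real A := by
  rw [← hlaw n, map_measureReal_apply (hw n) hA]
  rfl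

omit [∀ n, IsProbabilityMeasure (P n)] [IsProbabilityMeasure μ] in
include hw hlaw in
theorem ae_path (n : ℕ) {p : C(ℝ≥0, ℝ) → Prop} (hp : ∀ᵐ w ∂μ, p w) : ∀ᵐ ω ∂(P n), p (w n ω) := by
  rw [← hlaw n] at hp
  exact ae_of_ae_map (hw n).aemeasurable hp

include hlam_nonneg hfn hK_nonneg hK_loc hsol in
theorem integral_clock_le (n : ℕ) {b : ℝ} (hb : b ∈ Icc 0 T) : ∫ ω, X n b ω ∂(P n) ≤ G₀n n b := by
  have := (hsol n).integral_clock_add_le (hfn n) (hK_loc n) (hK_nonneg n) (hlam_nonneg n) hb le_rfl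
    hb.1
  simpa using this

-- Markov's inequality for a non-negative difference whose mean is known exactly from
-- `integral_firstAbove`. It gives the continuity in probability of the passage time in its level,
-- although single paths may jump.
include hf hfm hf0 hC hμ in
theorem measureReal_firstAbove_sub_le (hlam : 0 ≤ lam) {l l' ε : ℝ} (hl : 0 ≤ l) (hll : l ≤ l')
    (hε : 0 < ε) :
    μ.real {w | ε ≤ firstAbove (drifted lam nu f w) l' - firstAbove (drifted lam nu f w) l} ≤
      (l' - l) / ((1 + lam) * ε) := by
  have hl' := hl.trans hll
  have hi := integrable_firstAbove (nu := nu) hμ hf hfm hf0 hlam hl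
  have hi' := integrable_firstAbove (nu := nu) hμ hf hfm hf0 hlam hl'
  have h1 := mul_meas_ge_le_integral_of_nonneg (μ := μ)
    (f := fun w => firstAbove (drifted lam nu f w) l' - firstAbove (drifted lam nu f w) l) (by
      filter_upwards [ae_above_nonempty (nu := nu) hμ hf hfm hf0 hlam hl'] with w hw
      exact sub_nonneg.2 (firstAbove_mono hll hw)) (hi'.sub hi) ε
  rw [integral_sub hi' hi, integral_firstAbove hμ hf hfm hf0 hC hlam hl,
    integral_firstAbove hμ hf hfm hf0 hC hlam hl', ← sub_div] at h1
  rw [← div_div, le_div_iff₀' hε]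
  exact h1

include hf hfm hf0 hC hμ in
theorem ae_firstAbove_zero (hlam : 0 ≤ lam) : ∀ᵐ w ∂μ, firstAbove (drifted lam nu f w) 0 = 0 := by
  have h1 := integral_firstAbove (nu := nu) hμ hf hfm hf0 hC hlam le_rfl
  rw [zero_div] at h1
  exact (integral_eq_zero_iff_of_nonneg (fun w => firstAbove_nonneg)
    (integrable_firstAbove (nu := nu) hμ hf hfm hf0 hlam le_rfl)).1 h1

-- Three events of probability at most `δ` each are discarded: the clock at `b` reaches `R`; the
-- drifted paths with the `n`-th and the limiting coefficients differ by more than `θ / 4` on `[0,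
-- R]`; the passage times of the levels `l` and `l - θ` are at least `ε` apart. Elsewhere
-- `exists_le_of_volterra` supplies `s ≤ b` such that the limiting drifted path exceeds `l - θ` at
-- `X s ≤ X b`.
include hlam_nonneg hfn hK_nonneg hK_loc hG_mono hG_zero hsol hK_lim hG_lim hG_cont hf_lim hlam_lim
  hnu_lim hf hfm hf0 hC hμ hw hwW hlaw in
theorem tendsto_measure_clock_lt {b : ℝ} (hb : b ∈ Icc 0 T) {ε : ℝ} (hε : 0 < ε) :
    Tendsto (fun n => (P n).real {ω | X n b ω <
      firstAbove (drifted lam nu f (w n ω)) (G₀ b) - ε}) atTop (𝓝 0) := by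
  have hlam := limit_lam_nonneg hlam_nonneg hlam_lim
  have hT : 0 ≤ T := hb.1.trans hb.2
  set l := G₀ b with hl
  have hl0 : 0 ≤ l := limit_input_nonneg hG_mono hG_zero hG_lim hb
  -- At level `0` there is no room for a smaller non-negative level, but there the passage time
  -- vanishes almost surely.
  rcases hl0.eq_or_lt with hl0 | hl0
  · refine tendsto_const_nhds.congr fun n => ?_
    rw [eq_comm, measureReal_eq_zero_iff]
    rw [← hl0]
    have := ae_path hw hlaw n (ae_firstAbove_zero (nu := nu) hf hfm hf0 hC hμ hlam)
    rw [← compl_mem_ae_iff]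
    filter_upwards [this] with ω hω
    simp only [mem_compl_iff, mem_ofPred_eq, not_lt, hω]
    linarith [(hsol n).clock_nonneg hb ω]
  have hb0 : 0 < b := by
    rcases hb.1.eq_or_lt with h | h
    · rw [hl, ← h, limit_input_zero hG_zero hG_lim hT] at hl0
      exact absurd hl0 (lt_irrefl _)
    · exact h
  refine tendsto_zero_of_eventually_le (fun _ => measureReal_nonneg) 3 (by norm_num) fun δ hδ => ?_
  -- Error budget: the Volterra argument is run at `l₂ = l - θ / 2` and the comparison of drifted
  -- paths costs `θ / 4`, so the limiting path still exceeds `l - θ`. The gap `G₀n n a - l₂ > θ / 4`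
  -- is shared equally between the kernel error `κ * (R + l₂)` and the step `ρ = θ / 8`. The second
  -- bound on `θ` is what Markov's inequality requires.
  set θ := min l (δ * ((1 + lam) * ε)) with hθ
  have hθ0 : 0 < θ := lt_min hl0 (by positivity)
  have hθl : θ ≤ l := min_le_left _ _
  obtain ⟨a, haG, ha0, hab⟩ : ∃ a, l - θ / 4 < G₀ a ∧ 0 ≤ a ∧ a < b := by
    have hnb : (𝓝[Ico 0 b] b).NeBot := by
      rw [← mem_closure_iff_nhdsWithin_neBot, closure_Ico hb0.ne]
      exact right_mem_Icc.2 hb0.le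
    have h1 : ∀ᶠ t in 𝓝[Ico 0 b] b, l - θ / 4 < G₀ t :=
      ((hG_cont b hb).mono_left (nhdsWithin_mono _ fun t ht => ⟨ht.1, ht.2.le.trans hb.2⟩))
        |>.eventually_const_lt (by linarith)
    obtain ⟨a, h2, h3⟩ := (h1.and self_mem_nhdsWithin).exists
    exact ⟨a, h2, h3.1, h3.2⟩
  have haT : a ∈ Icc 0 T := ⟨ha0, hab.le.trans hb.2⟩
  set R := (l + 1) / δ with hR
  have hR0 : 0 < R := by positivity
  set l₂ := l - θ / 2 with hl₂
  have hl₂0 : 0 ≤ l₂ := by linarith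
  set κ := (θ / 8) / (R + l₂) with hκ
  have hκ0 : 0 < κ := by positivity
  obtain ⟨k, hk⟩ := exists_nat_gt (R / (θ / 8))
  have hk0 : (0 : ℝ) < k := lt_trans (by positivity) hk
  have hba : 0 < b - a := sub_pos.2 hab
  set e := (b - a) / k with he
  have he0 : 0 < e := by positivity
  have heb : e ≤ b := by
    have h1 : (1 : ℝ) ≤ k := by exact_mod_cast (by exact_mod_cast hk0 : 0 < k)
    have : e ≤ b - a := div_le_self hba.le h1
    linarith
  obtain ⟨hAm, hA⟩ := tendsto_measure_drifted (μ := μ) (fun n => (hfn n).contDiff.continuousOn) hf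
    hf_lim hlam_lim hnu_lim R (η := θ / 4) (by positivity)
  have hKe := tendsto_integral_kernel hK_nonneg hK_loc hK_lim he0 (heb.trans hb.2)
  have hKb := tendsto_integral_kernel hK_nonneg hK_loc hK_lim hb0 hb.2
  filter_upwards [hA.eventually_lt_const hδ, hKe.eventually_const_lt (by linarith : 1 - κ < 1),
    hKb.eventually_lt_const (by linarith : 1 < 1 + κ), (hG_lim a haT).eventually_const_lt haG,
    (hG_lim b hb).eventually_lt_const (by linarith : G₀ b < l + 1)] with n h1 h2 h3 h4 h5
  set S1 : Set (Ω n) := {ω | R ≤ X n b ω}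
  set S2 : Set (Ω n) := {ω | w n ω ∈ {w | ∃ x ∈ Icc 0 R,
      θ / 4 < |drifted (lamn n) (nun n) (fn n) w x - drifted lam nu f w x|}}
  set S3 : Set (Ω n) := {ω | w n ω ∈ {w | ε ≤ firstAbove (drifted lam nu f w) l -
    firstAbove (drifted lam nu f w) (l - θ)}}
  have hS1 : (P n).real S1 ≤ δ := by
    have hm := mul_meas_ge_le_integral_of_nonneg (μ := P n) (f := X n b)
      (ae_of_all _ fun ω => (hsol n).clock_nonneg hb ω)
      ((hsol n).integrable_clock (hfn n) (hK_loc n) (hK_nonneg n) (hlam_nonneg n) hb) R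
    have hm2 := integral_clock_le hlam_nonneg hfn hK_nonneg hK_loc hsol n hb
    have h6 : (l + 1) * (P n).real S1 ≤ (l + 1) * δ := by
      have : R * (P n).real S1 ≤ l + 1 := hm.trans (hm2.trans h5.le)
      rw [hR, div_mul_eq_mul_div, div_le_iff₀ hδ] at this
      exact this
    exact le_of_mul_le_mul_left h6 (by linarith)
  have hS2 : (P n).real S2 < δ := by
    rw [measureReal_path_mem hw hlaw n (hAm n)]
    exact h1
  have hS3 : (P n).real S3 ≤ δ := by
    have hm : MeasurableSet {w | ε ≤ firstAbove (drifted lam nu f w) l -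
        firstAbove (drifted lam nu f w) (l - θ)} :=
      measurableSet_le measurable_const ((measurable_firstAbove _).sub (measurable_firstAbove _))
    rw [measureReal_path_mem hw hlaw n hm]
    refine (measureReal_firstAbove_sub_le hf hfm hf0 hC hμ hlam (by linarith) (by linarith)
      hε).trans ?_
    rw [div_le_iff₀ (by positivity), sub_sub_cancel]
    exact min_le_right _ _
  have hsub : ∀ᵐ ω ∂(P n), ω ∈ {ω | X n b ω < firstAbove (drifted lam nu f (w n ω)) l - ε} →
      ω ∈ S1 ∪ S2 ∪ S3 := by
    filter_upwards [(hsol n).equation] with ω hω hlt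
    by_contra hcon
    simp only [mem_union, not_or] at hcon
    obtain ⟨⟨c1, c2⟩, c3⟩ := hcon
    have hbsub : Icc 0 b ⊆ Icc 0 T := Icc_subset_Icc_right hb.2
    have c1' : X n b ω < R := not_le.1 c1
    obtain ⟨s, hs, hls⟩ := exists_le_of_volterra (hK_loc n) (hK_nonneg n) (a := a) (b := b)
      (e := e) (κ := κ) (ρ := θ / 8) (R := R) (l := l₂) (lam := lamn n) (k := k) (G := G₀n n)
      (x := fun t => X n t ω) (V := fun t => nun n * timeChanged (fn n) (W n) (X n) t ω) ha0 he0.le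
      (by rw [he]; field_simp; ring) (hG_mono n) (((hsol n).continuous_clock ω).mono hbsub)
      (((hsol n).monotone_clock ω).mono hbsub) ((hsol n).clock_zero ω)
      (continuousOn_const.mul (((hsol n).continuousOn_timeChanged (hfn n) ω).mono hbsub))
      (fun t ht => hω t (hbsub ht)) c1'.le hl₂0 hκ0.le h2.le h3.le
      (by
        have : κ * (R + l₂) = θ / 8 := by rw [hκ]; field_simp
        rw [this]; linarith)
      (by rw [div_lt_iff₀ (by positivity)] at hk; exact hk)
    have hxs : X n s ω ≤ X n b ω := (hsol n).monotone_clock ω (hbsub hs) hb hs.2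
    have hxs0 := (hsol n).clock_nonneg (hbsub hs) ω
    have hd : drifted (lamn n) (nun n) (fn n) (w n ω) (X n s ω) =
        (1 + lamn n) * X n s ω - nun n * timeChanged (fn n) (W n) (X n) s ω := by
      simp only [drifted, timeChanged, hwW]
    have hclose : |drifted (lamn n) (nun n) (fn n) (w n ω) (X n s ω) -
        drifted lam nu f (w n ω) (X n s ω)| ≤ θ / 4 := by
      by_contra hc
      exact c2 ⟨X n s ω, ⟨hxs0, hxs.trans c1'.le⟩, not_le.1 hc⟩
    rw [hd] at hclose
    have hlow := (abs_le.1 hclose).2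
    have hfirst : firstAbove (drifted lam nu f (w n ω)) (l - θ) ≤ X n s ω :=
      firstAbove_le hxs0 (by linarith)
    have hlt' : X n b ω < firstAbove (drifted lam nu f (w n ω)) l - ε := hlt
    apply c3
    change ε ≤ firstAbove (drifted lam nu f (w n ω)) l -
      firstAbove (drifted lam nu f (w n ω)) (l - θ)
    linarith
  have hle : (P n).real {ω | X n b ω < firstAbove (drifted lam nu f (w n ω)) l - ε} ≤
      (P n).real (S1 ∪ S2 ∪ S3) :=
    ENNReal.toReal_mono (measure_ne_top _ _) (measure_mono_ae hsub)
  have hu1 := measureReal_union_le (μ := P n) (S1 ∪ S2) S3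
  have hu2 := measureReal_union_le (μ := P n) S1 S2
  have : (P n).real {ω | X n b ω < firstAbove (drifted lam nu f (w n ω)) l - ε} ≤ 3 * δ := by
    linarith
  exact this

omit [∀ n, IsProbabilityMeasure (P n)] [IsProbabilityMeasure μ] in
include hlaw hw in
theorem integral_path (n : ℕ) {Y : C(ℝ≥0, ℝ) → ℝ} (hY : Integrable Y μ) :
    Integrable (fun ω => Y (w n ω)) (P n) ∧ ∫ ω, Y (w n ω) ∂(P n) = ∫ w, Y w ∂μ := by
  rw [← hlaw n] at hY ⊢
  exact ⟨hY.comp_measurable (hw n), (integral_map (hw n).aemeasurable hY.aestronglyMeasurable).symm⟩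

theorem tendsto_integral_max_sub {α : Type*} {mα : MeasurableSpace α} {μ : Measure α} {Y : α → ℝ}
    (hY : Integrable Y μ) (hY0 : ∀ x, 0 ≤ Y x) :
    Tendsto (fun n : ℕ => ∫ x, max (Y x - n) 0 ∂μ) atTop (𝓝 0) := by
  have : Tendsto (fun n : ℕ => ∫ x, max (Y x - n) 0 ∂μ) atTop (𝓝 (∫ _x, (0 : ℝ) ∂μ)) := by
    refine tendsto_integral_of_dominated_convergence Y
      (fun n => (hY.aestronglyMeasurable.sub aestronglyMeasurable_const).sup
        aestronglyMeasurable_const) hY (fun n => ae_of_all _ fun x => ?_)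
      (ae_of_all _ fun x => ?_)
    · rw [Real.norm_eq_abs, abs_of_nonneg (le_max_right _ _)]
      exact max_le (by linarith [n.cast_nonneg (α := ℝ)]) (hY0 x)
    · obtain ⟨n₀, hn₀⟩ := exists_nat_ge (Y x)
      refine tendsto_const_nhds.congr' ?_
      filter_upwards [eventually_ge_atTop n₀] with n hn
      rw [max_eq_right]
      have : (n₀ : ℝ) ≤ n := by exact_mod_cast hn
      linarith
  simpa using this

-- The law of the passage time of `w n` does not depend on `n`, so uniform integrability is
-- automatic: the integrand is at most `δ`, plus `R` on the event that the clock lags by more than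
-- `δ`, plus the excess of the passage time over `R`.
include hlam_nonneg hfn hK_nonneg hK_loc hG_mono hG_zero hsol hK_lim hG_lim hG_cont hf_lim hlam_lim
  hnu_lim hf hfm hf0 hC hμ hw hwW hlaw in
theorem tendsto_integral_firstAbove_sub_clock {b : ℝ} (hb : b ∈ Icc 0 T) :
    Tendsto (fun n => ∫ ω, max (firstAbove (drifted lam nu f (w n ω)) (G₀ b) - X n b ω) 0 ∂(P n))
      atTop (𝓝 0) := by
  have hlam := limit_lam_nonneg hlam_nonneg hlam_lim
  have hl0 : 0 ≤ G₀ b := limit_input_nonneg hG_mono hG_zero hG_lim hb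
  have hi := integrable_firstAbove (nu := nu) hμ hf hfm hf0 hlam hl0
  refine tendsto_zero_of_eventually_le (fun n => integral_nonneg fun ω => le_max_right _ _) 3
    (by norm_num) fun δ hδ => ?_
  obtain ⟨R, hR⟩ := ((tendsto_integral_max_sub hi fun w => firstAbove_nonneg).eventually_lt_const
    hδ).exists
  have hS := tendsto_measure_clock_lt hlam_nonneg hfn hK_nonneg hK_loc hG_mono hG_zero hsol hK_lim
    hG_lim hG_cont hf_lim hlam_lim hnu_lim hf hfm hf0 hC hμ hw hwW hlaw hb hδ
  have hRS := hS.const_mul (R : ℝ)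
  rw [mul_zero] at hRS
  filter_upwards [hRS.eventually_lt_const hδ] with n hn
  set Y : Ω n → ℝ := fun ω => firstAbove (drifted lam nu f (w n ω)) (G₀ b) with hYdef
  have hY : Integrable Y (P n) := (integral_path hw hlaw n hi).1
  have hX := (hsol n).integrable_clock (hfn n) (hK_loc n) (hK_nonneg n) (hlam_nonneg n) hb
  have hXm := (hsol n).measurable_clock b hb
  have hYm : Measurable Y := (measurable_firstAbove _).comp (hw n)
  set S : Set (Ω n) := {ω | X n b ω < Y ω - δ} with hSdef
  have hSm : MeasurableSet S := measurableSet_lt hXm (hYm.sub_const δ)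
  have hmaxi : Integrable (fun w => max (firstAbove (drifted lam nu f w) (G₀ b) - R) 0) μ :=
    (hi.sub (integrable_const _)).pos_part
  obtain ⟨hm1, hm2⟩ := integral_path hw hlaw n hmaxi
  have hind : Integrable (fun ω => S.indicator (fun _ => (R : ℝ)) ω) (P n) :=
    (integrable_const _).indicator hSm
  have hδi : Integrable (fun ω => δ + S.indicator (fun _ => (R : ℝ)) ω) (P n) :=
    (integrable_const δ).add hind
  calc ∫ ω, max (Y ω - X n b ω) 0 ∂(P n)
      ≤ ∫ ω, (δ + S.indicator (fun _ => (R : ℝ)) ω + max (Y ω - R) 0) ∂(P n) := by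
        refine integral_mono (hY.sub hX).pos_part (hδi.add hm1) fun ω => ?_
        change max (Y ω - X n b ω) 0 ≤ δ + S.indicator (fun _ => (R : ℝ)) ω + max (Y ω - R) 0
        have h0 : 0 ≤ max (Y ω - R) 0 := le_max_right _ _
        have h1 : Y ω - R ≤ max (Y ω - R) 0 := le_max_left _ _
        have h2 := (hsol n).clock_nonneg hb ω
        have h3 : (0 : ℝ) ≤ R := R.cast_nonneg
        by_cases hω : ω ∈ S
        · rw [indicator_of_mem hω]
          exact max_le (by linarith) (by linarith)
        · rw [indicator_of_notMem hω]
          have h4 : Y ω - δ ≤ X n b ω := not_lt.1 hω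
          exact max_le (by linarith) (by linarith)
    _ = δ + R * (P n).real S +
          ∫ w, max (firstAbove (drifted lam nu f w) (G₀ b) - R) 0 ∂μ := by
        rw [integral_add hδi hm1, integral_add (integrable_const δ) hind,
          integral_indicator_const _ hSm, hm2]
        simp [mul_comm]
    _ ≤ 3 * δ := by linarith

-- For `a < b` the mean equation bounds `E X_b` by `G₀n n b` minus `lamn n` times nearly `E X_a`,
-- and the lower bound on the clock gives `E X_a ≥ G₀ a / (1 + lam) - o(1)`. By continuity of `G₀`,
-- a choice of `a` close to `b` makes `G₀ b - lam * G₀ a / (1 + lam)` nearly `G₀ b / (1 + lam)`.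
include hlam_nonneg hfn hK_nonneg hK_loc hG_mono hG_zero hsol hK_lim hG_lim hG_cont hf_lim hlam_lim
  hnu_lim hf hfm hf0 hC hμ hw hwW hlaw in
theorem eventually_integral_clock_le {b : ℝ} (hb : b ∈ Icc 0 T) {δ : ℝ} (hδ : 0 < δ) :
    ∀ᶠ n in atTop, ∫ ω, X n b ω ∂(P n) ≤ G₀ b / (1 + lam) + δ := by
  have hlam := limit_lam_nonneg hlam_nonneg hlam_lim
  have h1lam : 0 < 1 + lam := by linarith
  have hT : 0 ≤ T := hb.1.trans hb.2
  rcases hb.1.eq_or_lt with hb0 | hb0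
  · refine Eventually.of_forall fun n => ?_
    rw [← hb0]
    simp only [(hsol n).clock_zero, integral_zero]
    have := limit_input_nonneg hG_mono hG_zero hG_lim (⟨le_rfl, hT⟩ : (0 : ℝ) ∈ Icc 0 T)
    positivity
  obtain ⟨a, haG, ha0, hab⟩ : ∃ a, G₀ b - δ / (2 * (lam + 1)) < G₀ a ∧ 0 ≤ a ∧ a < b := by
    have hnb : (𝓝[Ico 0 b] b).NeBot := by
      rw [← mem_closure_iff_nhdsWithin_neBot, closure_Ico hb0.ne]
      exact right_mem_Icc.2 hb0.le
    have h1 : ∀ᶠ t in 𝓝[Ico 0 b] b, G₀ b - δ / (2 * (lam + 1)) < G₀ t :=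
      ((hG_cont b hb).mono_left (nhdsWithin_mono _ fun t ht => ⟨ht.1, ht.2.le.trans hb.2⟩))
        |>.eventually_const_lt (by
          have : 0 < δ / (2 * (lam + 1)) := by positivity
          linarith)
    obtain ⟨a, h2, h3⟩ := (h1.and self_mem_nhdsWithin).exists
    exact ⟨a, h2, h3.1, h3.2⟩
  have haT : a ∈ Icc 0 T := ⟨ha0, hab.le.trans hb.2⟩
  have hl0 : 0 ≤ G₀ a := limit_input_nonneg hG_mono hG_zero hG_lim haT
  have hi := integrable_firstAbove (nu := nu) hμ hf hfm hf0 hlam hl0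
  set D : ℕ → ℝ := fun n =>
    ∫ ω, max (firstAbove (drifted lam nu f (w n ω)) (G₀ a) - X n a ω) 0 ∂(P n) with hD
  have hDlim : Tendsto D atTop (𝓝 0) := tendsto_integral_firstAbove_sub_clock hlam_nonneg hfn
    hK_nonneg hK_loc hG_mono hG_zero hsol hK_lim hG_lim hG_cont hf_lim hlam_lim hnu_lim hf hfm hf0
    hC hμ hw hwW hlaw haT
  have hKe := tendsto_integral_kernel hK_nonneg hK_loc hK_lim (sub_pos.2 hab)
    (by linarith [hb.2] : b - a ≤ T)
  have hlimit : Tendsto (fun n => G₀n n b - lamn n * ((∫ u in (0 : ℝ)..(b - a), Kn n u) *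
      (G₀ a / (1 + lam) - D n))) atTop (𝓝 (G₀ b - lam * (1 * (G₀ a / (1 + lam) - 0)))) :=
    (hG_lim b hb).sub (hlam_lim.mul (hKe.mul (hDlim.const_sub _)))
  have hlt : G₀ b - lam * (1 * (G₀ a / (1 + lam) - 0)) < G₀ b / (1 + lam) + δ := by
    have e1 : G₀ b - lam * (1 * (G₀ a / (1 + lam) - 0)) =
        G₀ b / (1 + lam) + lam / (1 + lam) * (G₀ b - G₀ a) := by field_simp; ring
    rw [e1]
    have e2 : lam / (1 + lam) ≤ 1 := (div_le_one h1lam).2 (by linarith)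
    have e3 : 0 ≤ lam / (1 + lam) := by positivity
    have e4 : δ / (2 * (lam + 1)) ≤ δ / 2 := by gcongr; linarith
    have e5 : G₀ b - G₀ a ≤ δ / 2 := by linarith
    nlinarith
  filter_upwards [hlimit.eventually_lt_const hlt] with n hn
  have hmain := (hsol n).integral_clock_add_le (hfn n) (hK_loc n) (hK_nonneg n) (hlam_nonneg n) hb
    (sub_pos.2 hab).le (by linarith)
  rw [sub_sub_cancel] at hmain
  have hX := (hsol n).integrable_clock (hfn n) (hK_loc n) (hK_nonneg n) (hlam_nonneg n) haT
  obtain ⟨hY, hYe⟩ := integral_path hw hlaw n hi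
  have hlow : G₀ a / (1 + lam) - D n ≤ ∫ ω, X n a ω ∂(P n) := by
    have hpos : Integrable
        (fun ω => max (firstAbove (drifted lam nu f (w n ω)) (G₀ a) - X n a ω) 0) (P n) :=
      (hY.sub hX).pos_part
    rw [← integral_firstAbove (nu := nu) hμ hf hfm hf0 hC hlam hl0, ← hYe, sub_le_iff_le_add]
    change _ ≤ _ + ∫ ω, max (firstAbove (drifted lam nu f (w n ω)) (G₀ a) - X n a ω) 0 ∂(P n)
    rw [← integral_add hX hpos]
    refine integral_mono hY (hX.add hpos) fun ω => ?_
    change _ ≤ X n a ω + max (firstAbove (drifted lam nu f (w n ω)) (G₀ a) - X n a ω) 0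
    linarith [le_max_left (firstAbove (drifted lam nu f (w n ω)) (G₀ a) - X n a ω) 0]
  have hKnn : 0 ≤ ∫ u in (0 : ℝ)..(b - a), Kn n u :=
    intervalIntegral.integral_nonneg (sub_pos.2 hab).le fun u hu => hK_nonneg n u hu.1
  have := mul_le_mul_of_nonneg_left (mul_le_mul_of_nonneg_left hlow hKnn) (hlam_nonneg n)
  linarith

include hlam_nonneg hfn hK_nonneg hK_loc hG_mono hG_zero hsol hK_lim hG_lim hG_cont hf_lim hlam_lim
  hnu_lim hf hfm hf0 hC hμ hw hwW hlaw in
/-- The clocks are asymptotically the first passage times of their Brownian motions. -/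
theorem tendsto_measure_clock_sub {b : ℝ} (hb : b ∈ Icc 0 T) {ε : ℝ} (hε : 0 < ε) :
    Tendsto (fun n => (P n).real {ω | ε <
      |X n b ω - firstAbove (drifted lam nu f (w n ω)) (G₀ b)|}) atTop (𝓝 0) := by
  have hlam := limit_lam_nonneg hlam_nonneg hlam_lim
  have hl0 : 0 ≤ G₀ b := limit_input_nonneg hG_mono hG_zero hG_lim hb
  have hi := integrable_firstAbove (nu := nu) hμ hf hfm hf0 hlam hl0
  have hDlim := tendsto_integral_firstAbove_sub_clock hlam_nonneg hfn
    hK_nonneg hK_loc hG_mono hG_zero hsol hK_lim hG_lim hG_cont hf_lim hlam_lim hnu_lim hf hfm hf0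
    hC hμ hw hwW hlaw hb
  refine tendsto_zero_of_eventually_le (fun n => measureReal_nonneg) (3 / ε) (by positivity)
    fun δ hδ => ?_
  filter_upwards [hDlim.eventually_lt_const hδ, eventually_integral_clock_le hlam_nonneg hfn
    hK_nonneg hK_loc hG_mono hG_zero hsol hK_lim hG_lim hG_cont hf_lim hlam_lim hnu_lim hf hfm hf0
    hC hμ hw hwW hlaw hb hδ] with n h1 h2
  have hX := (hsol n).integrable_clock (hfn n) (hK_loc n) (hK_nonneg n) (hlam_nonneg n) hb
  obtain ⟨hY, hYe⟩ := integral_path hw hlaw n hi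
  set Y : Ω n → ℝ := fun ω => firstAbove (drifted lam nu f (w n ω)) (G₀ b) with hYdef
  -- Since `|x - y| = (x - y) + 2 max (y - x) 0`, a one-sided `L¹` estimate and a comparison of
  -- means give two-sided closeness; the resulting bound is `δ + 2 * δ`.
  have habs : ∫ ω, |X n b ω - Y ω| ∂(P n) =
      ∫ ω, X n b ω ∂(P n) - ∫ ω, Y ω ∂(P n) + 2 * ∫ ω, max (Y ω - X n b ω) 0 ∂(P n) := by
    have hsub : Integrable (fun ω => X n b ω - Y ω) (P n) := hX.sub hY
    have hpos : Integrable (fun ω => max (Y ω - X n b ω) 0) (P n) := (hY.sub hX).pos_part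
    rw [← integral_sub hX hY, ← integral_const_mul, ← integral_add hsub (hpos.const_mul 2)]
    congr 1 with ω
    rcases le_total (X n b ω) (Y ω) with h | h
    · rw [abs_of_nonpos (by linarith), max_eq_left (by linarith)]; ring
    · rw [abs_of_nonneg (by linarith), max_eq_right (by linarith)]; ring
  rw [hYe, integral_firstAbove (nu := nu) hμ hf hfm hf0 hC hlam hl0] at habs
  have hmk := mul_meas_ge_le_integral_of_nonneg (μ := P n) (f := fun ω => |X n b ω - Y ω|)
    (ae_of_all _ fun ω => abs_nonneg _) (hX.sub hY).abs ε
  have hle : (P n).real {ω | ε < |X n b ω - Y ω|} ≤ (P n).real {ω | ε ≤ |X n b ω - Y ω|} :=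
    measureReal_mono (fun ω (hω : ε < |X n b ω - Y ω|) => hω.le) (measure_ne_top _ _)
  rw [div_mul_eq_mul_div, le_div_iff₀' hε]
  have := mul_le_mul_of_nonneg_left hle hε.le
  linarith

end Asymptotics

/-! ### The limiting clock -/

section PassageClock

variable {T : ℝ} {G₀ f : ℝ → ℝ} {lam nu : ℝ}

/-- The lower estimate is monotonicity; the upper one combines right-continuity of the passage time
in the level with continuity of `G₀`. -/
theorem continuousWithinAt_firstAbove_comp (hG : MonotoneOn G₀ (Icc 0 T))
    (hGc : ContinuousOn G₀ (Icc 0 T)) {g : ℝ → ℝ} (h : {s | 0 ≤ s ∧ G₀ T < g s}.Nonempty)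
    (t : Icc (0 : ℝ) T) :
    ContinuousWithinAt (fun t : Icc (0 : ℝ) T => firstAbove g (G₀ t)) (Ici t) t := by
  have hT : T ∈ Icc 0 T := ⟨t.2.1.trans t.2.2, le_rfl⟩
  have hne : ∀ s : Icc (0 : ℝ) T, {u | 0 ≤ u ∧ G₀ s < g u}.Nonempty := fun s =>
    above_nonempty_mono (hG s.2 hT s.2.2) h
  rw [ContinuousWithinAt, tendsto_order]
  constructor
  · intro a ha
    filter_upwards [self_mem_nhdsWithin] with s hs
    exact ha.trans_le (firstAbove_mono (hG t.2 s.2 hs) (hne s))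
  · intro a ha
    obtain ⟨l', hl', hlt⟩ := exists_firstAbove_lt (hne t) (sub_pos.2 ha)
    have hc := (continuousOn_iff_continuous_domRestrict.1 hGc).tendsto t
    filter_upwards [nhdsWithin_le_nhds (hc.eventually_lt_const hl')] with s hs
    have := hlt _ hs
    rwa [add_sub_cancel] at this

open Classical in
/-- The path `t ↦ inf {s ≥ 0 : (1 + lam) s - nu w(f(s)) > G₀(t)}`, or the zero path if it is not
finite. -/
def passageClock (hG : MonotoneOn G₀ (Icc 0 T)) (hGc : ContinuousOn G₀ (Icc 0 T))
    (f : ℝ → ℝ) (lam nu : ℝ) (w : C(ℝ≥0, ℝ)) : DUp T :=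
  if h : {s | 0 ≤ s ∧ G₀ T < drifted lam nu f w s}.Nonempty then
    have hmono : Monotone fun t : Icc (0 : ℝ) T => firstAbove (drifted lam nu f w) (G₀ t) :=
      fun s t hst => firstAbove_mono (hG s.2 t.2 hst)
        (above_nonempty_mono (hG t.2 ⟨t.2.1.trans t.2.2, le_rfl⟩ t.2.2) h)
    ⟨{  toFun := fun t => firstAbove (drifted lam nu f w) (G₀ t)
        right_cont := continuousWithinAt_firstAbove_comp hG hGc h
        left_lim := fun t => ⟨_, hmono.tendsto_leftLim t⟩ },
      hmono, fun _ => firstAbove_nonneg⟩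
  else DUp.ofContinuous (fun _ => 0) continuousOn_const (fun _ _ _ _ _ => le_rfl) rfl

variable {hG : MonotoneOn G₀ (Icc 0 T)} {hGc : ContinuousOn G₀ (Icc 0 T)}

theorem passageClock_apply {w : C(ℝ≥0, ℝ)}
    (h : {s | 0 ≤ s ∧ G₀ T < drifted lam nu f w s}.Nonempty) (t : Icc (0 : ℝ) T) :
    (passageClock hG hGc f lam nu w).1 t = firstAbove (drifted lam nu f w) (G₀ t) := by
  rw [passageClock, dif_pos h]

theorem passageClock_apply_of_not {w : C(ℝ≥0, ℝ)}
    (h : ¬ {s | 0 ≤ s ∧ G₀ T < drifted lam nu f w s}.Nonempty) (t : Icc (0 : ℝ) T) :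
    (passageClock hG hGc f lam nu w).1 t = 0 := by
  rw [passageClock, dif_neg h]
  rfl

theorem measurable_passageClock_apply (t : Icc (0 : ℝ) T) :
    Measurable fun w => (passageClock hG hGc f lam nu w).1 t := by
  classical
  have : (fun w => (passageClock hG hGc f lam nu w).1 t) =
      {w | {s | 0 ≤ s ∧ G₀ T < drifted lam nu f w s}.Nonempty}.indicator
        fun w => firstAbove (drifted lam nu f w) (G₀ t) := by
    ext w
    by_cases h : {s | 0 ≤ s ∧ G₀ T < drifted lam nu f w s}.Nonempty
    · rw [passageClock_apply h, indicator_of_mem (by exact h)]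
    · rw [passageClock_apply_of_not h, indicator_of_notMem (by exact h)]
  rw [this]
  exact (measurable_firstAbove _).indicator (measurableSet_above_nonempty _)

end PassageClock

/-! ### Transfer to the path space and the main theorem -/

theorem isPreBrownianReal_map {Ω : Type*} {mΩ : MeasurableSpace Ω} {P : Measure Ω}
    {w : Ω → C(ℝ≥0, ℝ)} (hw : Measurable w) (hB : IsPreBrownianReal (fun s ω => w ω s) P) :
    IsPreBrownianReal (fun s (w : C(ℝ≥0, ℝ)) => w s) (P.map w) where
  hasLaw I := by
    have hm : Measurable fun (v : C(ℝ≥0, ℝ)) => I.restrict fun s => v s :=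
      measurable_pi_lambda _ fun s => measurable_eval_path s
    refine ⟨hm.aemeasurable, ?_⟩
    rw [Measure.map_map hm hw]
    exact (hB.hasLaw I).map_eq

theorem limit_timeChange {fn : ℕ → ℝ → ℝ} {f : ℝ → ℝ} (hfn : ∀ n, IsTimeChange (fn n))
    (hf_lim : TendstoLocallyUniformlyOn fn f atTop (Ici 0)) :
    ContinuousOn f (Ici 0) ∧ MonotoneOn f (Ici 0) ∧ f 0 = 0 := by
  refine ⟨hf_lim.continuousOn (Frequently.of_forall fun n => (hfn n).contDiff.continuousOn),
    fun x hx y hy hxy => ?_, ?_⟩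
  · exact le_of_tendsto_of_tendsto' (hf_lim.tendsto_at hx) (hf_lim.tendsto_at hy)
      fun n => (hfn n).mono hx hy hxy
  · refine tendsto_nhds_unique (hf_lim.tendsto_at self_mem_Ici) ?_
    simp_rw [(hfn _).zero]
    exact tendsto_const_nhds

theorem limit_growth {fn : ℕ → ℝ → ℝ} {f : ℝ → ℝ} {C : ℝ}
    (hC : ∀ n x, 0 ≤ x → fn n x / (1 + x ^ 2) ≤ C)
    (hf_lim : TendstoLocallyUniformlyOn fn f atTop (Ici 0)) {x : ℝ} (hx : 0 ≤ x) :
    f x ≤ C * (1 + x ^ 2) :=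
  le_of_tendsto' (hf_lim.tendsto_at hx) fun n => (div_le_iff₀ (by positivity)).1 (hC n x hx)

/-- The driving Brownian motion of a weak solution as a random continuous path. -/
def IsFilteredBrownian.toPath {Ω : Type*} {mΩ : MeasurableSpace Ω} {P : Measure Ω}
    {𝒢 : Filtration ℝ≥0 mΩ} {W : ℝ≥0 → Ω → ℝ} (h : IsFilteredBrownian 𝒢 P W) (ω : Ω) :
    C(ℝ≥0, ℝ) := ⟨fun s => W s ω, h.continuous_path ω⟩

theorem IsFilteredBrownian.measurable_toPath {Ω : Type*} {mΩ : MeasurableSpace Ω} {P : Measure Ω}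
    {𝒢 : Filtration ℝ≥0 mΩ} {W : ℝ≥0 → Ω → ℝ} (h : IsFilteredBrownian 𝒢 P W) :
    Measurable h.toPath :=
  measurable_continuousMap fun s => (h.adapted s).measurable.mono (𝒢.le s) le_rfl

end VolterraClock

end

theorem mainTheorem1 {T : ℝ} (hT : 0 < T)
    -- the filtered probability spaces carrying the weak solutions
    {Ω : ℕ → Type*} {mΩ : ∀ n, MeasurableSpace (Ω n)}
    (P : ∀ n, Measure (Ω n)) [∀ n, IsProbabilityMeasure (P n)]
    (𝒢 : ∀ n, Filtration ℝ≥0 (mΩ n))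
    (W : ∀ n, ℝ≥0 → Ω n → ℝ) (X : ∀ n, ℝ → Ω n → ℝ)
    -- the inputs and their limits
    (G₀n Kn fn : ℕ → ℝ → ℝ) (lamn nun : ℕ → ℝ) (G₀ f : ℝ → ℝ) (lam nu : ℝ)
    (hlam_nonneg : ∀ n, 0 ≤ lamn n) (hnu_nonneg : ∀ n, 0 ≤ nun n)
    (hf : ∀ n, VolterraClock.IsTimeChange (fn n))
    (hK_nonneg : ∀ n t, 0 ≤ t → 0 ≤ Kn n t)
    (hK_loc : ∀ n, LocallyIntegrableOn (Kn n) (Ici 0))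
    (hG_mono : ∀ n, MonotoneOn (G₀n n) (Ici 0)) (hG_zero : ∀ n, G₀n n 0 = 0)
    (hsol : ∀ n, VolterraClock.IsWeakSolution T (G₀n n) (Kn n) (fn n) (lamn n) (nun n)
      (𝒢 n) (P n) (W n) (X n))
    -- weak convergence of the measures `Kn n t dt` on `[0,T]` to the Dirac mass at `0`
    (hK_lim : ∀ φ : ℝ → ℝ, ContinuousOn φ (Icc 0 T) →
      Tendsto (fun n => ∫ t in (0 : ℝ)..T, φ t * Kn n t) atTop (𝓝 (φ 0)))
    (hG_lim : ∀ t ∈ Icc 0 T, Tendsto (fun n => G₀n n t) atTop (𝓝 (G₀ t)))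
    (hG_cont : ContinuousOn G₀ (Icc 0 T))
    (hf_lim : TendstoLocallyUniformlyOn fn f atTop (Ici 0))
    (hf_growth : ∃ C : ℝ, ∀ n x, 0 ≤ x → fn n x / (1 + x ^ 2) ≤ C)
    (hlam_lim : Tendsto lamn atTop (𝓝 lam)) (hnu_lim : Tendsto nun atTop (𝓝 nu))
    -- an arbitrary standard Brownian motion
    {Ωs : Type*} {mΩs : MeasurableSpace Ωs} (Ps : Measure Ωs) [IsProbabilityMeasure Ps]
    (Ws : ℝ≥0 → Ωs → ℝ) (hWs : IsBrownianReal Ws Ps) :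
    ∃ Z : Ωs → VolterraClock.DCirc T,
      (∀ᵐ ω ∂Ps, ∀ s, (Z ω).path s = Ws s ω) ∧
      (∀ᵐ ω ∂Ps, ∀ t : Icc (0 : ℝ) T,
        IsGLB {s : ℝ | 0 ≤ s ∧ G₀ t < (1 + lam) * s - nu * Ws (f s).toNNReal ω}
          ((Z ω).clock.1 t)) ∧
      TendstoInDistribution (fun n => (hsol n).toDCirc) atTop Z P Ps := by
  obtain ⟨hfc, hfm, hf0⟩ := VolterraClock.limit_timeChange hf hf_lim
  obtain ⟨C, hC⟩ := hf_growth
  have hfC : ∀ x, 0 ≤ x → f x ≤ C * (1 + x ^ 2) := fun x =>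
    VolterraClock.limit_growth hC hf_lim
  have hG : MonotoneOn G₀ (Icc 0 T) := VolterraClock.limit_input_mono hG_mono hG_lim
  have hlam := VolterraClock.limit_lam_nonneg hlam_nonneg hlam_lim
  -- `Ws` is continuous only almost surely, so `Z` is built from a version with values in the path
  -- space.
  obtain ⟨w, hw, hwW⟩ := VolterraClock.exists_measurable_path (fun s => hWs.aemeasurable s) hWs.cont
  have hwB : IsPreBrownianReal (fun s ω => w ω s) Ps := hWs.toIsPreBrownianReal.congr fun s => by
    filter_upwards [hwW] with ω hω using (hω s).symm
  have hμ := VolterraClock.isPreBrownianReal_map hw hwB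
  have := Measure.isProbabilityMeasure_map (μ := Ps) hw.aemeasurable
  have hpath := fun n => (hsol n).brownian.measurable_toPath
  have hlaw : ∀ n, (P n).map (hsol n).brownian.toPath = Ps.map w := fun n =>
    VolterraClock.map_eq_of_isPreBrownianReal (hpath n) hw
      (hsol n).brownian.brownian.toIsPreBrownianReal hwB
  have hTT : T ∈ Icc 0 T := ⟨hT.le, le_rfl⟩
  -- Exceeding the top level `G₀ T` makes the passage times finite for all `t` at once, so a single
  -- null set suffices.
  have hne := VolterraClock.ae_above_nonempty (nu := nu) hμ hfc hfm hf0 hlam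
    (VolterraClock.limit_input_nonneg hG_mono hG_zero hG_lim hTT)
  refine ⟨fun ω => VolterraClock.DCirc.mk (w ω)
    (VolterraClock.passageClock hG hG_cont f lam nu (w ω)), hwW, ?_, ?_⟩
  · filter_upwards [hwW, ae_of_ae_map hw.aemeasurable hne] with ω hω hn t
    change IsGLB _ ((VolterraClock.passageClock hG hG_cont f lam nu (w ω)).1 t)
    rw [VolterraClock.passageClock_apply hn]
    simp_rw [← hω]
    exact isGLB_csInf (VolterraClock.above_nonempty_mono (hG t.2 hTT t.2.2) hn)
      VolterraClock.bddBelow_above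
  · refine VolterraClock.tendstoInDistribution_dCirc hT (W := fun n => (hsol n).brownian.toPath)
      (X := fun n ω => ((hsol n).toDCirc ω).clock)
      (clock := VolterraClock.passageClock hG hG_cont f lam nu)
      VolterraClock.measurable_passageClock_apply hpath
      (fun n t => (hsol n).measurable_clock t t.2) hw hlaw fun t ε hε => ?_
    refine (VolterraClock.tendsto_measure_clock_sub (w := fun n => (hsol n).brownian.toPath)
      hlam_nonneg hf hK_nonneg hK_loc hG_mono hG_zero hsol hK_lim hG_lim hG_cont hf_lim hlam_lim
      hnu_lim hfc hfm hf0 hfC hμ hpath (fun _ _ _ => rfl) hlaw t.2 hε).congr fun n => ?_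
    refine measureReal_congr ?_
    filter_upwards [VolterraClock.ae_path hpath hlaw n hne] with ω hω
    refine propext ?_
    change ε < |X n t ω - _| ↔ ε < |X n t ω - _|
    rw [VolterraClock.passageClock_apply hω]
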